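/- **Setting.** Let $k,m\ge 0$, $q\ge 1$, and consider $$\dot y=A_1y+\tilde g_1(y,z,u),\qquad \dot z=A_2z+B_2u+\tilde g_2(y,z,u),\qquad y\in\mathbb R^k,\ z\in\mathbb R^{q},\ u\in\mathbb R^m,$$ with $A_1=0$ and $\tilde g_1,\tilde g_2$ of class $C^2$, vanishing at the origin together with their first derivatives. Let $u=K(y;z)=K_{11}z+K_{12}y+K_n(y)$ with $K_n=0$, let $A_K=A_2+B_2K_{11}$ be Hurwitz, let $E$ satisfy $A_KE-EA_1+B_2K_{12}=0$, put $v=z-Ey$, and assume $K_1=[K_{12}+K_{11}E\ \ K_{11}]=[0\ \ K_{11}]$. With $g_1(y,z,u)=\tilde g_1(y,z,u)$ and $g_2(y,z,u)=B_2K_n(y)+\tilde g_2(y,z,u)-E\tilde g_1(y,z,u)$ the closed loop is $\dot y=A_1y+g_1$, $\dot v=A_Kv+g_2$, evaluated at $z=v+Ey$, $u=K(y;v+Ey)$. Let $v=h(y)$, $\|y\|<\delta_h$, be any $C^1$ center manifold of it, i.e. $h(0)=0$, $Dh(0)=0$, and solutions that start on the graph of $h$ stay on it as long as $\|y\|<\delta_h$.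 Put $w=v-h(y)$ and $g_1^h(y)=g_1(y,h(y)+Ey,K(y;h(y)+Ey))$, and assume that for some $p>1$, $k_5,k_6>0$, in a neighbourhood of $y=0$, $$\|g_1^h(y)\|\le k_5\|y\|^p,\qquad y^\top g_1^h(y)\le -k_6\|y\|^{p+1}$$ (so that the origin of the reduced system $\dot y=g_1^h(y)$ is locally asymptotically stable). Let $P,Q\succ0$ with $A_K^\top P+PA_K=-Q$, let $s_f\in(0,1)$, and let $\sigma>0$ satisfy $$2\sigma\,\|PB_2K_1\|\sqrt{\lambda_{\max}(P)}\le(1-s_f)\,\lambda_{\min}(Q)\sqrt{\lambda_{\min}(P)}.$$ In the event-triggered implementation $t_0=0$, the input is held at $u=K(y(t_i);z(t_i))$ on $[t_i,t_{i+1})$, and $t_{i+1}$ is the first time $t>t_i$ at which $\|e_v(t)\|\ge\sigma(\|w(t)\|+\|y(t)\|^{p+1})$, where $e_v(t)=v(t_i)-v(t)$ ($t_{i+1}=\infty$ if there is none; no events are generated while $(y;w)=0$). **Claim.** 1. The origin $(y;w)=0$ of the event-triggered closed loop is locally asymptotically stable (in particular every initial state near the origin admits a trajectory for all $t\ge0$).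 2. There are $\tau>0$ and a neighbourhood of the origin such that $t_{i+1}-t_i\ge\tau$ for all $i\ge0$ along every trajectory starting in that neighbourhood. 3. Explicit bound. Let $N_1,N_2$ be the perturbations in $\dot y=A_1y+g_1^h(y)+N_1(y,w,e)$, $\dot w=A_Kw+B_2K_1e+N_2(y,w,e)$, where $e=(e_y;e_v)$ is the measurement error and $u=K(y+e_y;w+h(y)+e_v+E(y+e_y))$. Let $\delta\in(0,\delta_h]$, $k_1,k_2,k_8>0$, $s_y\in(0,1)$ be such that for $\|y\|<\delta$ the two estimates on $g_1^h$ and $\|Dh(y)\|\le k_8\|y\|$ hold; such that $\|N_i(y,w,e)\|\le k_i(\|w\|+\|e_v\|)$, $i=1,2$, whenever $\|(y;w)\|<\delta$ and $\|e_v\|\le\sigma(\|w\|+\|y\|^{p+1})$; and such that $$(1+\sigma)\Big(k_1+k_2\tfrac{\lambda_{\max}(P)}{\sqrt{\lambda_{\min}(P)}}\Big)\le s_f\tfrac{\lambda_{\min}(Q)}{2\sqrt{\lambda_{\max}(P)}},\qquad \Big(k_1+k_2\tfrac{\lambda_{\max}(P)}{\sqrt{\lambda_{\min}(P)}}+\tfrac{\|PB_2K_1\|}{\sqrt{\lambda_{\min}(P)}}\Big)\sigma\|y\|^{p+1}\le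 k_6s_y\|y\|^p\ \ (\|y\|<\delta).$$ Put $a_1=\max(\|A_K\|+k_2+k_8k_1\delta,\;k_8k_5)$, $a_2=\|B_2K_{11}\|+k_2+\delta k_1k_8$, $a_3=\max(\|A_K\|+k_2+(p+1)\delta^pk_1,\;(p+1)\delta^{p-1}k_5)$, $a_4=\|B_2K_{11}\|+k_2+(p+1)\delta^pk_1$. If $4a_1a_4>(a_2+a_3)^2$ and $b=\sqrt{4a_1a_4-(a_2+a_3)^2}$, then along every trajectory with $\|y(0)\|+\sqrt{w(0)^\top Pw(0)}<\min(1,\sqrt{\lambda_{\min}(P)})\,\delta$ one has for all $i\ge0$ $$t_{i+1}-t_i\ \ge\ \tau_1=\frac2b\Big(\arctan\frac{2a_4\sigma+a_2+a_3}{b}-\arctan\frac{a_2+a_3}{b}\Big)>0,$$ and constants $\delta,k_1,k_2,k_8,s_y$ with all these properties, including $4a_1a_4>(a_2+a_3)^2$, exist. -/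

import Mathlib

open Set Filter Topology

noncomputable section

namespace CenterETC

/-- `ℝⁿ` with the Euclidean norm. -/
abbrev Vec (n : ℕ) : Type := EuclideanSpace ℝ (Fin n)

/-- The matrix-vector product, on Euclidean spaces. -/
def act {a b : ℕ} (M : Matrix (Fin a) (Fin b) ℝ) (x : Vec b) : Vec a :=
  Matrix.toEuclideanLin M x

/-- The induced 2-norm of a matrix. -/
def opNorm {ι κ : Type} [Fintype ι] [Fintype κ] [DecidableEq κ] (M : Matrix ι κ ℝ) : ℝ :=
  ‖LinearMap.toContinuousLinearMap (Matrix.toEuclideanLin M)‖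

/-- The smallest eigenvalue of a real symmetric matrix. -/
def lamMin {q : ℕ} (M : Matrix (Fin q) (Fin q) ℝ) : ℝ := sInf (spectrum ℝ M)

/-- The largest eigenvalue of a real symmetric matrix. -/
def lamMax {q : ℕ} (M : Matrix (Fin q) (Fin q) ℝ) : ℝ := sSup (spectrum ℝ M)

/-- All complex eigenvalues of a real square matrix have negative real part. -/
def Hurwitz {q : ℕ} (M : Matrix (Fin q) (Fin q) ℝ) : Prop :=
  ∀ μ ∈ spectrum ℂ (M.map (algebraMap ℝ ℂ)), μ.re < 0

/-- The Euclidean norm of the concatenated vector `(y; w)`. -/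
def pairNorm {k q : ℕ} (y : Vec k) (w : Vec q) : ℝ := Real.sqrt (‖y‖ ^ 2 + ‖w‖ ^ 2)

/-- The data of a plant `ẏ = A₁ y + G₁(y, z, u)`, `ż = A₂ z + B₂ u + G₂(y, z, u)` with
`y ∈ ℝᵏ`, `z ∈ ℝ^q`, `u ∈ ℝᵐ`, of a feedback `K(y; z) = K₁₁ z + K₁₂ y + Kₙ(y)`, and of the matrix
`E` of the change of variables `v = z - E y`. -/
structure Sys (k q m : ℕ) where
  A1 : Matrix (Fin k) (Fin k) ℝ
  A2 : Matrix (Fin q) (Fin q) ℝ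
  B2 : Matrix (Fin q) (Fin m) ℝ
  G1 : Vec k × Vec q × Vec m → Vec k
  G2 : Vec k × Vec q × Vec m → Vec q
  K11 : Matrix (Fin m) (Fin q) ℝ
  K12 : Matrix (Fin m) (Fin k) ℝ
  Kn : Vec k → Vec m
  E : Matrix (Fin q) (Fin k) ℝ

namespace Sys

variable {k q m : ℕ} (S : Sys k q m)

/-- The nonlinearities are twice continuously differentiable and vanish at the origin together
with their first derivatives. -/
def Regular : Prop :=
  ContDiff ℝ 2 S.G1 ∧ ContDiff ℝ 2 S.G2 ∧ S.G1 0 = 0 ∧ S.G2 0 = 0 ∧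
    fderiv ℝ S.G1 0 = 0 ∧ fderiv ℝ S.G2 0 = 0

/-- `A_K = A₂ + B₂ K₁₁`. -/
def AK : Matrix (Fin q) (Fin q) ℝ := S.A2 + S.B2 * S.K11

/-- `K₁ = [K₁₂ + K₁₁ E, K₁₁]`, the feedback matrix in the coordinates `(y; v)`. -/
def K1 : Matrix (Fin m) (Fin k ⊕ Fin q) ℝ :=
  Matrix.fromCols (S.K12 + S.K11 * S.E) S.K11

/-- The feedback law. -/
def K (y : Vec k) (z : Vec q) : Vec m := act S.K11 z + act S.K12 y + S.Kn y

/-- Right-hand side of the `y`-equation of the plant. -/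
def yDot (y : Vec k) (z : Vec q) (u : Vec m) : Vec k := act S.A1 y + S.G1 (y, z, u)

/-- Right-hand side of the `z`-equation of the plant. -/
def zDot (y : Vec k) (z : Vec q) (u : Vec m) : Vec q :=
  act S.A2 z + act S.B2 u + S.G2 (y, z, u)

/-- The nonlinearity of the `y`-equation in the coordinates `(y, v)`. -/
def g1 (y : Vec k) (z : Vec q) (u : Vec m) : Vec k := S.G1 (y, z, u)

/-- The nonlinearity of the `v`-equation in the coordinates `(y, v)`. -/
def g2 (y : Vec k) (z : Vec q) (u : Vec m) : Vec q :=
  act S.B2 (S.Kn y) + S.G2 (y, z, u) - act S.E (S.G1 (y, z, u))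

/-- `(y, v)` solves on `[0, T)` the closed loop with continuously updated feedback,
`ẏ = A₁ y + g₁(y, v + E y, K)`, `v̇ = A_K v + g₂(y, v + E y, K)`, `K = K(y; v + E y)`. -/
def IsClosedLoopSolution (T : ℝ) (y : ℝ → Vec k) (v : ℝ → Vec q) : Prop :=
  ContinuousOn y (Ico 0 T) ∧ ContinuousOn v (Ico 0 T) ∧
  ∀ s ∈ Ico 0 T,
    HasDerivWithinAt y
      (act S.A1 (y s) +
        S.g1 (y s) (v s + act S.E (y s)) (S.K (y s) (v s + act S.E (y s)))) (Ici s) s ∧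
    HasDerivWithinAt v
      (act S.AK (v s) +
        S.g2 (y s) (v s + act S.E (y s)) (S.K (y s) (v s + act S.E (y s)))) (Ici s) s

/-- `v = h(y)`, `‖y‖ < δ`, is a (local) center manifold of the closed loop: `h` is continuously
differentiable, `h(0) = 0`, `Dh(0) = 0`, and a solution that starts on the graph of `h` stays on it
as long as its `y`-component stays in the domain of `h`. The values of `h` outside of the ball play
no role. -/
def IsCenterManifold (δ : ℝ) (h : Vec k → Vec q) : Prop :=
  0 < δ ∧ ContDiffOn ℝ 1 h (Metric.ball 0 δ) ∧ h 0 = 0 ∧ fderiv ℝ h 0 = 0 ∧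
  ∀ (T : ℝ) (y : ℝ → Vec k) (v : ℝ → Vec q), S.IsClosedLoopSolution T y v →
    (∀ s ∈ Ico 0 T, ‖y s‖ < δ) → v 0 = h (y 0) → ∀ s ∈ Ico 0 T, v s = h (y s)

/-- `g₁` along the center manifold, `y ↦ g₁(y, h(y) + E y, K(y; h(y) + E y))`. -/
def g1Red (h : Vec k → Vec q) (y : Vec k) : Vec k :=
  S.g1 y (h y + act S.E y) (S.K y (h y + act S.E y))

/-- `g₂` along the center manifold. -/
def g2Red (h : Vec k → Vec q) (y : Vec k) : Vec q :=
  S.g2 y (h y + act S.E y) (S.K y (h y + act S.E y))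

/-- The held input `K(y + e_y; w + h(y) + e_v + E (y + e_y))` in the coordinates `(y, w)` and the
measurement errors. -/
def errInput (h : Vec k → Vec q) (y : Vec k) (w : Vec q) (ey : Vec k) (ev : Vec q) : Vec m :=
  S.K (y + ey) (w + h y + ev + act S.E (y + ey))

/-- The perturbation `N₁(y, w, e)` of the reduced dynamics. -/
def N1 (h : Vec k → Vec q) (y : Vec k) (w : Vec q) (ey : Vec k) (ev : Vec q) : Vec k :=
  S.g1 y (w + h y + act S.E y) (S.errInput h y w ey ev) - S.g1Red h y

/-- The nonlinearity `N₂(y, w, e)` of the `w`-dynamics. -/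
def N2 (h : Vec k → Vec q) (y : Vec k) (w : Vec q) (ey : Vec k) (ev : Vec q) : Vec q :=
  S.g2 y (w + h y + act S.E y) (S.errInput h y w ey ev) - S.g2Red h y -
    fderiv ℝ h y
      ((act S.A1 y + S.g1 y (w + h y + act S.E y) (S.errInput h y w ey ev)) -
        (act S.A1 y + S.g1Red h y))

/-- The coordinate `v = z - E y` of a plant state. -/
def vOf (y : Vec k) (z : Vec q) : Vec q := z - act S.E y

/-- The coordinate `w = v - h(y)` of a plant state. -/
def wOf (h : Vec k → Vec q) (y : Vec k) (z : Vec q) : Vec q := S.vOf y z - h y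

/-- The event condition at time `s` when the input was last updated at time `r`:
`‖e_v‖ ≥ σ (‖w‖ + ‖y‖^(p+1))` with `e_v(s) = v(r) - v(s)`. At the equilibrium `(y; w) = 0` itself,
where the threshold is zero, no event is generated. -/
def Trigger (h : Vec k → Vec q) (σ p : ℝ) (y : ℝ → Vec k) (z : ℝ → Vec q) (r s : ℝ) : Prop :=
  ¬ (y s = 0 ∧ S.wOf h (y s) (z s) = 0) ∧
  σ * (‖S.wOf h (y s) (z s)‖ + ‖y s‖ ^ (p + 1)) ≤ ‖S.vOf (y r) (z r) - S.vOf (y s) (z s)‖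

/-- `(y, z)` is a trajectory on `[0, T)`, `T ≤ ∞`, of the event-triggered closed loop with event
times `t 0 = 0`, `t 1`, `t 2`, …  Here `t (i + 1)` is the first time after `t i` (and before the
horizon `T`) at which the event condition holds, `⊤` if there is none; the input is held at
`K(y(t i); z(t i))` on `[t i, t (i + 1))`, and these intervals cover `[0, T)`. -/
def IsExecution (h : Vec k → Vec q) (σ p : ℝ) (T : EReal)
    (y : ℝ → Vec k) (z : ℝ → Vec q) (t : ℕ → EReal) : Prop :=
  t 0 = 0 ∧
  (∀ i, t (i + 1) = sInf (Real.toEReal ''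
    {s : ℝ | t i < (s : EReal) ∧ (s : EReal) < T ∧ S.Trigger h σ p y z (t i).toReal s})) ∧
  (∀ s : ℝ, 0 ≤ s → (s : EReal) < T → ∃ i, t i ≤ (s : EReal) ∧ (s : EReal) < t (i + 1)) ∧
  ContinuousOn y {s : ℝ | 0 ≤ s ∧ (s : EReal) < T} ∧
  ContinuousOn z {s : ℝ | 0 ≤ s ∧ (s : EReal) < T} ∧
  ∀ (i : ℕ) (s : ℝ), t i ≤ (s : EReal) → (s : EReal) < t (i + 1) → (s : EReal) < T →
    HasDerivWithinAt y
      (S.yDot (y s) (z s) (S.K (y (t i).toReal) (z (t i).toReal))) (Ici s) s ∧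
    HasDerivWithinAt z
      (S.zDot (y s) (z s) (S.K (y (t i).toReal) (z (t i).toReal))) (Ici s) s

/-- The origin of the event-triggered closed loop is locally asymptotically stable, in the
coordinates `(y; w)`: it is stable, and every initial state near it is the initial state of a
trajectory defined for all times, all of which converge to it. -/
def OriginLAS (h : Vec k → Vec q) (σ p : ℝ) : Prop :=
  (∀ ε > 0, ∃ r > 0, ∀ T y z t, S.IsExecution h σ p T y z t →
    pairNorm (y 0) (S.wOf h (y 0) (z 0)) < r →
    ∀ s : ℝ, 0 ≤ s → (s : EReal) < T → pairNorm (y s) (S.wOf h (y s) (z s)) < ε) ∧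
  ∃ r > 0,
    (∀ y₀ z₀, pairNorm y₀ (S.wOf h y₀ z₀) < r →
      ∃ y z t, S.IsExecution h σ p ⊤ y z t ∧ y 0 = y₀ ∧ z 0 = z₀) ∧
    ∀ y z t, S.IsExecution h σ p ⊤ y z t → pairNorm (y 0) (S.wOf h (y 0) (z 0)) < r →
      Tendsto (fun s => pairNorm (y s) (S.wOf h (y s) (z s))) atTop (𝓝 0)

/-- `δ` (a radius in the `(y; w)`-space) and `k₁, k₂, k₈, s_y` are constants for which the local
estimates behind the explicit bound on the inter-event times hold. `δh` is the radius of the domain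
of `h`. -/
structure LocalConstants (δh : ℝ) (h : Vec k → Vec q) (P Q : Matrix (Fin q) (Fin q) ℝ)
    (p k5 k6 sf σ δ k1 k2 k8 sy : ℝ) : Prop where
  pos_delta : 0 < δ
  delta_le : δ ≤ δh
  pos_k1 : 0 < k1
  pos_k2 : 0 < k2
  pos_k8 : 0 < k8
  pos_sy : 0 < sy
  sy_lt_one : sy < 1
  growth : ∀ y : Vec k, ‖y‖ < δ → ‖S.g1Red h y‖ ≤ k5 * ‖y‖ ^ p
  decay : ∀ y : Vec k, ‖y‖ < δ → inner ℝ y (S.g1Red h y) ≤ -k6 * ‖y‖ ^ (p + 1)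
  deriv_h : ∀ y : Vec k, ‖y‖ < δ → ‖fderiv ℝ h y‖ ≤ k8 * ‖y‖
  bound_N1 : ∀ (y : Vec k) (w : Vec q) (ey : Vec k) (ev : Vec q), pairNorm y w < δ →
    ‖ev‖ ≤ σ * (‖w‖ + ‖y‖ ^ (p + 1)) → ‖S.N1 h y w ey ev‖ ≤ k1 * (‖w‖ + ‖ev‖)
  bound_N2 : ∀ (y : Vec k) (w : Vec q) (ey : Vec k) (ev : Vec q), pairNorm y w < δ →
    ‖ev‖ ≤ σ * (‖w‖ + ‖y‖ ^ (p + 1)) → ‖S.N2 h y w ey ev‖ ≤ k2 * (‖w‖ + ‖ev‖)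
  small_w : (1 + σ) * (k1 + k2 * (lamMax P / Real.sqrt (lamMin P))) ≤
    sf * (lamMin Q / (2 * Real.sqrt (lamMax P)))
  small_y : ∀ y : Vec k, ‖y‖ < δ →
    (k1 + k2 * (lamMax P / Real.sqrt (lamMin P)) +
        opNorm (P * S.B2 * S.K1) / Real.sqrt (lamMin P)) * σ * ‖y‖ ^ (p + 1) ≤
      k6 * sy * ‖y‖ ^ p

/-- The coefficient `a₁`. -/
def a1 (k1 k2 k5 k8 δ : ℝ) : ℝ := max (opNorm S.AK + k2 + k8 * k1 * δ) (k8 * k5)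

/-- The coefficient `a₂`. -/
def a2 (k1 k2 k8 δ : ℝ) : ℝ := opNorm (S.B2 * S.K11) + k2 + δ * k1 * k8

/-- The coefficient `a₃`. -/
def a3 (p k1 k2 k5 δ : ℝ) : ℝ :=
  max (opNorm S.AK + k2 + (p + 1) * δ ^ p * k1) ((p + 1) * δ ^ (p - 1) * k5)

/-- The coefficient `a₄`. -/
def a4 (p k1 k2 δ : ℝ) : ℝ := opNorm (S.B2 * S.K11) + k2 + (p + 1) * δ ^ p * k1

end Sys

/-- The time that the solution of `φ' = a₁ + a φ + a₄ φ²`, `φ(0) = 0`, needs to reach `σ`, when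
`4 a₁ a₄ > a²`. -/
def arctanTime (a1 a a4 σ : ℝ) : ℝ :=
  2 / Real.sqrt (4 * a1 * a4 - a ^ 2) *
    (Real.arctan ((2 * a4 * σ + a) / Real.sqrt (4 * a1 * a4 - a ^ 2)) -
      Real.arctan (a / Real.sqrt (4 * a1 * a4 - a ^ 2)))

/-- The function `V(y, w) = ‖y‖ + √(wᵀ P w)`. -/
def lyap {k q : ℕ} (P : Matrix (Fin q) (Fin q) ℝ) (y : Vec k) (w : Vec q) : ℝ :=
  ‖y‖ + Real.sqrt (inner ℝ w (act P w))

end CenterETC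

end

/-!
In the coordinates `(y, v)`, the assumptions on the feedback make the input a function of `v` alone,
`u = K₁₁ (v + e_v)` with `e_v` the measurement error of `v`. In the coordinates `w = v - h(y)`, the
invariance equation `Dh(y) g₁ʰ(y) = A_K h(y) + g₂ʰ(y)` of the center manifold
(`IsCenterManifold.invariance`) turns the loop into `ẏ = g₁ʰ(y) + N₁`, `ẇ = A_K w + B₂K₁₁ e_v + N₂`,
where near the origin `N₁` and `N₂` are bounded by a small multiple of `‖w‖ + ‖e_v‖`.

The function `V = ‖y‖ + √(wᵀPw)` decreases as long as `‖e_v‖ ≤ σ (‖w‖ + ‖y‖^(p+1))`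
(`Setup.exists_hasDerivWithinAt_lyap`): the terms in `‖w‖ + ‖e_v‖` are dominated by the linear decay
of `√(wᵀPw)` and, as far as `‖y‖^(p+1)` is concerned, by the decay `-k₆ ‖y‖^p` of `‖y‖`. The event
rule enforces the inequality for `e_v` up to and including each event time (`IsHeld.error_le`), so
`V` decreases along trajectories, and it tends to zero when the constants leave some room.

Between events, the ratio `φ = ‖e_v‖ / (‖w‖ + ‖y‖^(p+1))` starts at zero and satisfies
`φ' ≤ a₁ + (a₂ + a₃) φ + a₄ φ²` (`Setup.exists_hasDerivWithinAt_ratio`). The comparison equation is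
solved by a tangent, and it needs the time `arctanTime` to reach `σ` (`arctanTime_le`). With the
inter-event times bounded from below, trajectories for all times are obtained by concatenating
solutions with held input (`Setup.exists_isExecution`).

The delicate point is that constants with these properties exist, since a center manifold that is
only `C¹` has to satisfy `‖Dh(y)‖ ≤ k₈ ‖y‖` near the origin. This uses that the reduced flow is
stable (`IsCenterManifold.exists_norm_fderiv_le`): each of its orbits comes from a fixed sphere,
where any Lipschitz bound on `h` suffices, and from there on differences of values of `h` are
contracted exponentially because `A_K` is Hurwitz, while `‖y‖` and differences of `y` vary slowly.
Then `k₈` may be enlarged until `a₁ ≥ k₈ k₅` makes the discriminant `4 a₁ a₄ - (a₂ + a₃)²` positive,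
after which `δ` is taken small (`IsCenterManifold.exists_localConstants`).
-/

noncomputable section

namespace CenterETC

/-! ### Matrices acting on Euclidean spaces -/

/-- `act M` as a continuous linear map. -/
def actL {a b : ℕ} (M : Matrix (Fin a) (Fin b) ℝ) : Vec b →L[ℝ] Vec a :=
  LinearMap.toContinuousLinearMap (Matrix.toEuclideanLin M)

theorem actL_apply {a b : ℕ} (M : Matrix (Fin a) (Fin b) ℝ) (x : Vec b) : actL M x = act M x := rfl

theorem act_map_add {a b : ℕ} (M : Matrix (Fin a) (Fin b) ℝ) (x y : Vec b) :
    act M (x + y) = act M x + act M y := map_add (actL M) x y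

theorem act_map_sub {a b : ℕ} (M : Matrix (Fin a) (Fin b) ℝ) (x y : Vec b) :
    act M (x - y) = act M x - act M y := map_sub (actL M) x y

@[simp] theorem act_map_zero {a b : ℕ} (M : Matrix (Fin a) (Fin b) ℝ) : act M 0 = 0 :=
  map_zero (actL M)

@[simp] theorem zero_act {a b : ℕ} (x : Vec b) : act (0 : Matrix (Fin a) (Fin b) ℝ) x = 0 := by
  simp [act]

theorem add_act {a b : ℕ} (M N : Matrix (Fin a) (Fin b) ℝ) (x : Vec b) :
    act (M + N) x = act M x + act N x := by
  simp [act]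

theorem mul_act {a b c : ℕ} (M : Matrix (Fin a) (Fin b) ℝ) (N : Matrix (Fin b) (Fin c) ℝ)
    (x : Vec c) : act (M * N) x = act M (act N x) := by
  simp [act, Matrix.toLpLin_apply]

theorem norm_act_le {a b : ℕ} (M : Matrix (Fin a) (Fin b) ℝ) (x : Vec b) :
    ‖act M x‖ ≤ opNorm M * ‖x‖ := (actL M).le_opNorm x

theorem opNorm_nonneg {ι κ : Type} [Fintype ι] [Fintype κ] [DecidableEq κ] (M : Matrix ι κ ℝ) :
    0 ≤ opNorm M := norm_nonneg _

theorem continuous_act {a b : ℕ} (M : Matrix (Fin a) (Fin b) ℝ) :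
    Continuous (act M) := (actL M).continuous

theorem inner_act_right {a b : ℕ} (M : Matrix (Fin a) (Fin b) ℝ) (x : Vec a) (y : Vec b) :
    inner ℝ x (act M y) = inner ℝ (act M.transpose x) y := by
  simp [act, Matrix.toLpLin_apply, EuclideanSpace.inner_eq_star_dotProduct,
    Matrix.dotProduct_mulVec, Matrix.mulVec_transpose, dotProduct_comm]

theorem PosSemidef.inner_act_nonneg {q : ℕ} {M : Matrix (Fin q) (Fin q) ℝ} (hM : M.PosSemidef)
    (x : Vec q) : 0 ≤ inner ℝ x (act M x) := by
  have := hM.dotProduct_mulVec_nonneg x.ofLp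
  simpa [act, Matrix.toLpLin_apply, EuclideanSpace.inner_eq_star_dotProduct,
    dotProduct_comm] using this

theorem scalar_act {q : ℕ} (c : ℝ) (x : Vec q) :
    act (algebraMap ℝ (Matrix (Fin q) (Fin q) ℝ) c) x = c • x := by
  rw [Algebra.algebraMap_eq_smul_one]
  simp [act]

theorem sub_act {a b : ℕ} (M N : Matrix (Fin a) (Fin b) ℝ) (x : Vec b) :
    act (M - N) x = act M x - act N x := by
  simp [act]

theorem isHermitian_scalar {q : ℕ} (c : ℝ) :
    (algebraMap ℝ (Matrix (Fin q) (Fin q) ℝ) c).IsHermitian := by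
  rw [Algebra.algebraMap_eq_smul_one]
  simp [Matrix.IsHermitian]

theorem spectrum_finite {q : ℕ} (M : Matrix (Fin q) (Fin q) ℝ) (hM : M.IsHermitian) :
    (spectrum ℝ M).Finite := by
  rw [hM.spectrum_real_eq_range_eigenvalues]; exact Set.finite_range _

theorem spectrum_nonempty_of_pos {q : ℕ} (hq : 0 < q) (M : Matrix (Fin q) (Fin q) ℝ)
    (hM : M.IsHermitian) : (spectrum ℝ M).Nonempty := by
  rw [hM.spectrum_real_eq_range_eigenvalues]
  exact ⟨_, ⟨⟨0, hq⟩, rfl⟩⟩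

theorem lamMin_mul_le {q : ℕ} {M : Matrix (Fin q) (Fin q) ℝ} (hM : M.IsHermitian) (x : Vec q) :
    lamMin M * ‖x‖ ^ 2 ≤ inner ℝ x (act M x) := by
  have h : (M - algebraMap ℝ _ (lamMin M)).PosSemidef := by
    rw [Matrix.posSemidef_iff_isHermitian_and_spectrum_nonneg]
    refine ⟨hM.sub (isHermitian_scalar _), ?_⟩
    intro μ hμ
    have h1 : μ + lamMin M ∈ spectrum ℝ M := by
      rw [spectrum.add_mem_iff]
      rwa [sub_eq_neg_add] at hμ
    have := csInf_le (spectrum_finite M hM).bddBelow h1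
    simp only [mem_ofPred_eq]
    unfold lamMin at *
    linarith
  have := PosSemidef.inner_act_nonneg h x
  rw [sub_act, scalar_act, inner_sub_right, inner_smul_right, real_inner_self_eq_norm_sq] at this
  linarith

theorem le_lamMax_mul {q : ℕ} {M : Matrix (Fin q) (Fin q) ℝ} (hM : M.IsHermitian) (x : Vec q) :
    inner ℝ x (act M x) ≤ lamMax M * ‖x‖ ^ 2 := by
  have h : (algebraMap ℝ _ (lamMax M) - M).PosSemidef := by
    rw [Matrix.posSemidef_iff_isHermitian_and_spectrum_nonneg]
    refine ⟨(isHermitian_scalar _).sub hM, ?_⟩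
    intro μ hμ
    have h1 : lamMax M - μ ∈ spectrum ℝ M := by
      rw [← spectrum.singleton_sub_eq, Set.singleton_sub] at hμ
      obtain ⟨ν, hν, rfl⟩ := hμ
      simpa using hν
    have := le_csSup (spectrum_finite M hM).bddAbove h1
    simp only [mem_ofPred_eq]
    unfold lamMax at *
    linarith
  have := PosSemidef.inner_act_nonneg h x
  rw [sub_act, scalar_act, inner_sub_right, inner_smul_right, real_inner_self_eq_norm_sq] at this
  linarith

theorem lamMin_pos {q : ℕ} (hq : 0 < q) {M : Matrix (Fin q) (Fin q) ℝ} (hM : M.PosDef) :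
    0 < lamMin M := by
  have hmem := (spectrum_nonempty_of_pos hq M hM.isHermitian).csInf_mem
    (spectrum_finite M hM.isHermitian)
  rw [hM.isHermitian.spectrum_real_eq_range_eigenvalues] at hmem
  obtain ⟨i, hi⟩ := hmem
  have := hM.eigenvalues_pos i
  unfold lamMin
  rw [hM.isHermitian.spectrum_real_eq_range_eigenvalues, ← hi]
  exact this

theorem lamMin_le_lamMax {q : ℕ} (hq : 0 < q) {M : Matrix (Fin q) (Fin q) ℝ} (hM : M.IsHermitian) :
    lamMin M ≤ lamMax M :=
  csInf_le_csSup (spectrum_nonempty_of_pos hq M hM) (spectrum_finite M hM).bddBelow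
    (spectrum_finite M hM).bddAbove

open scoped MatrixOrder in
/-- A positive definite matrix is of the form `BᵀB`. -/
theorem exists_factor {q : ℕ} {P : Matrix (Fin q) (Fin q) ℝ} (hP : P.PosDef) :
    ∃ B : Vec q →L[ℝ] Vec q, ∀ x y, inner ℝ (B x) (B y) = inner ℝ x (act P y) := by
  obtain ⟨B, hB⟩ := CStarAlgebra.nonneg_iff_eq_star_mul_self.mp hP.posSemidef.nonneg
  refine ⟨actL B, fun x y => ?_⟩
  rw [actL_apply, actL_apply, hB, mul_act, Matrix.star_eq_conjTranspose,
    Matrix.conjTranspose_eq_transpose_of_trivial, inner_act_right B.transpose,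
    Matrix.transpose_transpose]

/-- The norm of `M [N N']` bounds that of `M N'`: the vectors are padded by zeros. -/
theorem norm_act_act_le_opNorm_mul_fromCols {a b m k : ℕ} (M : Matrix (Fin a) (Fin m) ℝ)
    (N : Matrix (Fin m) (Fin k) ℝ) (N' : Matrix (Fin m) (Fin b) ℝ) (x : Vec b) :
    ‖act M (act N' x)‖ ≤ opNorm (M * Matrix.fromCols N N') * ‖x‖ := by
  have h := (LinearMap.toContinuousLinearMap
    (Matrix.toEuclideanLin (M * Matrix.fromCols N N'))).le_opNorm
      (WithLp.toLp 2 (Sum.elim 0 x.ofLp))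
  have h1 : ‖(WithLp.toLp 2 (Sum.elim 0 x.ofLp) : EuclideanSpace ℝ (Fin k ⊕ Fin b))‖ = ‖x‖ := by
    simp [EuclideanSpace.norm_eq]
  rw [h1] at h
  refine le_of_eq_of_le (congrArg norm ?_) h
  change _ = Matrix.toEuclideanLin (M * Matrix.fromCols N N') (WithLp.toLp 2 (Sum.elim 0 x.ofLp))
  simp only [act, Matrix.toLpLin_apply, ← Matrix.mulVec_mulVec, Matrix.fromCols_mulVec_sumElim]
  simp

/-! ### Weighted norms and their derivatives -/

/-- `B` is a factor of the symmetric matrix `P`: `⟪B x, B y⟫ = ⟪x, P y⟫`, so that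
`‖B x‖ = √(xᵀ P x)`. -/
def IsFactor {q : ℕ} (P : Matrix (Fin q) (Fin q) ℝ) (B : Vec q →L[ℝ] Vec q) : Prop :=
  ∀ x y, inner ℝ (B x) (B y) = inner ℝ x (act P y)

section Factor

variable {q : ℕ} {P Q A : Matrix (Fin q) (Fin q) ℝ} {B : Vec q →L[ℝ] Vec q}

theorem IsFactor.norm_sq (hB : IsFactor P B) (x : Vec q) :
    ‖B x‖ ^ 2 = inner ℝ x (act P x) := by
  rw [← hB, real_inner_self_eq_norm_sq]

theorem IsFactor.lyap_eq {k : ℕ} (hB : IsFactor P B) (y : Vec k) (w : Vec q) :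
    lyap P y w = ‖y‖ + ‖B w‖ := by
  rw [lyap, ← hB.norm_sq, Real.sqrt_sq (norm_nonneg _)]

theorem IsFactor.sqrt_lamMin_mul_norm_le (hB : IsFactor P B) (hP : P.PosDef) (x : Vec q) :
    Real.sqrt (lamMin P) * ‖x‖ ≤ ‖B x‖ := by
  rw [← Real.sqrt_sq (norm_nonneg x), ← Real.sqrt_mul' _ (sq_nonneg _),
    ← Real.sqrt_sq (norm_nonneg (B x)), hB.norm_sq]
  exact Real.sqrt_le_sqrt (lamMin_mul_le hP.isHermitian x)

theorem IsFactor.norm_le_sqrt_lamMax (hB : IsFactor P B) (hP : P.PosDef) (x : Vec q) :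
    ‖B x‖ ≤ Real.sqrt (lamMax P) * ‖x‖ := by
  rw [← Real.sqrt_sq (norm_nonneg x), ← Real.sqrt_mul' _ (sq_nonneg _),
    ← Real.sqrt_sq (norm_nonneg (B x)), hB.norm_sq]
  exact Real.sqrt_le_sqrt (le_lamMax_mul hP.isHermitian x)

theorem lamMax_pos (hq : 0 < q) (hP : P.PosDef) : 0 < lamMax P :=
  (lamMin_pos hq hP).trans_le (lamMin_le_lamMax hq hP.isHermitian)

theorem IsFactor.norm_act_le_lamMax (hB : IsFactor P B) (hq : 0 < q) (hP : P.PosDef) (x : Vec q) :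
    ‖act P x‖ ≤ lamMax P * ‖x‖ := by
  have h1 : ‖act P x‖ ^ 2 ≤ ‖B (act P x)‖ * ‖B x‖ := by
    rw [← real_inner_self_eq_norm_sq, ← hB]
    exact real_inner_le_norm _ _
  have h2 := hB.norm_le_sqrt_lamMax hP (act P x)
  have h3 := hB.norm_le_sqrt_lamMax hP x
  have h4 := Real.mul_self_sqrt (lamMax_pos hq hP).le
  have h5 : ‖B (act P x)‖ * ‖B x‖ ≤
      (Real.sqrt (lamMax P) * ‖act P x‖) * (Real.sqrt (lamMax P) * ‖x‖) := by gcongr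
  rcases (norm_nonneg (act P x)).eq_or_lt with h0 | h0
  · rw [← h0]; exact mul_nonneg (lamMax_pos hq hP).le (norm_nonneg _)
  · refine le_of_mul_le_mul_left ?_ h0
    calc ‖act P x‖ * ‖act P x‖ = ‖act P x‖ ^ 2 := by ring
      _ ≤ _ := h1.trans h5
      _ = ‖act P x‖ * ((Real.sqrt (lamMax P) * Real.sqrt (lamMax P)) * ‖x‖) := by ring
      _ = _ := by rw [h4]

theorem IsFactor.sqrt_lamMin_mul_norm_factor_le (hB : IsFactor P B) (hq : 0 < q) (hP : P.PosDef)
    (x : Vec q) : Real.sqrt (lamMin P) * ‖B x‖ ≤ ‖act P x‖ := by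
  have h1 : ‖B x‖ ^ 2 ≤ ‖x‖ * ‖act P x‖ := by
    rw [hB.norm_sq]; exact real_inner_le_norm _ _
  have h2 := hB.sqrt_lamMin_mul_norm_le hP x
  have h3 := Real.sqrt_pos.2 (lamMin_pos hq hP)
  rcases (norm_nonneg (B x)).eq_or_lt with h0 | h0
  · rw [← h0, mul_zero]; exact norm_nonneg _
  · refine le_of_mul_le_mul_left ?_ h0
    calc ‖B x‖ * (Real.sqrt (lamMin P) * ‖B x‖) = Real.sqrt (lamMin P) * ‖B x‖ ^ 2 := by ring
      _ ≤ Real.sqrt (lamMin P) * (‖x‖ * ‖act P x‖) := by gcongr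
      _ = (Real.sqrt (lamMin P) * ‖x‖) * ‖act P x‖ := by ring
      _ ≤ _ := by gcongr

/-- The quadratic form of the Lyapunov equation `AᵀP + PA = -Q`. -/
theorem inner_act_mul_of_lyapunov (hP : P.IsHermitian) (hPQ : A.transpose * P + P * A = -Q)
    (x : Vec q) : inner ℝ x (act P (act A x)) = -(1 / 2) * inner ℝ x (act Q x) := by
  have h1 : inner ℝ x (act (A.transpose * P + P * A) x) = -inner ℝ x (act Q x) := by
    rw [hPQ, ← inner_neg_right]
    congr 1
    simp [act]
  have hPt : P.transpose = P := by
    rw [← Matrix.conjTranspose_eq_transpose_of_trivial]; exact hP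
  rw [add_act, mul_act, mul_act, inner_add_right, inner_act_right A.transpose,
    Matrix.transpose_transpose, inner_act_right P, hPt, real_inner_comm] at h1
  rw [inner_act_right P, hPt] at h1 ⊢
  linarith

end Factor

/-- The norm of a curve in an inner product space has a right derivative wherever the curve has
one; at a zero of the curve it is the norm of the derivative. -/
theorem hasDerivWithinAt_norm_right {F : Type*} [NormedAddCommGroup F] [InnerProductSpace ℝ F]
    {f : ℝ → F} {f' : F} {s : ℝ} [Decidable (f s = 0)]
    (hf : HasDerivWithinAt f f' (Ici s) s) :
    HasDerivWithinAt (fun t => ‖f t‖)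
      (if f s = 0 then ‖f'‖ else inner ℝ (f s) f' / ‖f s‖) (Ici s) s := by
  split_ifs with h
  · rw [hasDerivWithinAt_iff_tendsto_slope, Ici_sdiff_left] at hf ⊢
    refine hf.norm.congr' ?_
    filter_upwards [self_mem_nhdsWithin] with t ht
    have ht : 0 < t - s := sub_pos.2 ht
    rw [slope_def_module, slope_def_module, h, norm_zero, sub_zero, sub_zero, norm_smul,
      norm_inv, Real.norm_of_nonneg ht.le, smul_eq_mul]
  · have h1 := hf.norm_sq.sqrt (by positivity)
    simp only [Real.sqrt_sq (norm_nonneg _)] at h1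
    convert h1 using 1
    field_simp

/-- Along `ẇ = A w + η` with `AᵀP + PA = -Q`, the right derivative of `√(wᵀPw) = ‖B w‖`. -/
theorem IsFactor.hasDerivWithinAt_norm_le {q : ℕ} {P Q A : Matrix (Fin q) (Fin q) ℝ}
    {B : Vec q →L[ℝ] Vec q} (hB : IsFactor P B) (hq : 0 < q) (hP : P.PosDef) (hQ : Q.PosDef)
    (hPQ : A.transpose * P + P * A = -Q) {w : ℝ → Vec q} {η : Vec q} {s : ℝ}
    (hw : HasDerivWithinAt w (act A (w s) + η) (Ici s) s) :
    ∃ D, HasDerivWithinAt (fun t => ‖B (w t)‖) D (Ici s) s ∧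
      D ≤ -(lamMin Q / (2 * Real.sqrt (lamMax P))) * ‖w s‖ +
        ‖act P η‖ / Real.sqrt (lamMin P) := by
  have hd : HasDerivWithinAt (fun t => B (w t)) (B (act A (w s) + η)) (Ici s) s :=
    B.hasFDerivAt.comp_hasDerivWithinAt s hw
  refine ⟨_, hasDerivWithinAt_norm_right hd, ?_⟩
  have hl := Real.sqrt_pos.2 (lamMin_pos hq hP)
  have hL := Real.sqrt_pos.2 (lamMax_pos hq hP)
  have hμ := lamMin_pos hq hQ
  have hlow := hB.sqrt_lamMin_mul_norm_le hP (w s)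
  have hup := hB.norm_le_sqrt_lamMax hP (w s)
  split_ifs with h
  · rw [h, norm_zero] at hlow
    have hw0 : w s = 0 := by
      rw [← norm_eq_zero]
      nlinarith [norm_nonneg (w s)]
    rw [hw0, norm_zero, mul_zero, zero_add, act_map_zero, zero_add, le_div_iff₀ hl, mul_comm]
    exact hB.sqrt_lamMin_mul_norm_factor_le hq hP η
  · have hpos : 0 < ‖B (w s)‖ := norm_pos_iff.2 h
    rw [hB, act_map_add, inner_add_right, inner_act_mul_of_lyapunov hP.isHermitian hPQ, add_div]
    have hQ1 := lamMin_mul_le hQ.isHermitian (w s)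
    apply add_le_add
    · rw [div_le_iff₀ hpos]
      have h1 : lamMin Q / (2 * Real.sqrt (lamMax P)) * ‖w s‖ * ‖B (w s)‖ ≤
          lamMin Q / 2 * ‖w s‖ ^ 2 := by
        calc lamMin Q / (2 * Real.sqrt (lamMax P)) * ‖w s‖ * ‖B (w s)‖ ≤
            lamMin Q / (2 * Real.sqrt (lamMax P)) * ‖w s‖ * (Real.sqrt (lamMax P) * ‖w s‖) := by
              gcongr
          _ = _ := by field_simp
      linarith
    · rw [div_le_div_iff₀ hpos hl]
      calc inner ℝ (w s) (act P η) * Real.sqrt (lamMin P)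
          ≤ (‖w s‖ * ‖act P η‖) * Real.sqrt (lamMin P) := by
            gcongr; exact real_inner_le_norm _ _
        _ = ‖act P η‖ * (Real.sqrt (lamMin P) * ‖w s‖) := by ring
        _ ≤ _ := by gcongr

/-- A `C²` map whose derivative vanishes at the origin has, near the origin, a Lipschitz constant
proportional to the radius. -/
theorem exists_quadratic_lipschitz {X Z : Type*} [NormedAddCommGroup X] [NormedSpace ℝ X]
    [NormedAddCommGroup Z] [NormedSpace ℝ Z] {G : X → Z} (hG : ContDiff ℝ 2 G)
    (h0 : fderiv ℝ G 0 = 0) :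
    ∃ C > 0, ∃ r > 0, ∀ ρ ≤ r, ∀ x x', ‖x‖ ≤ ρ → ‖x'‖ ≤ ρ →
      ‖G x - G x'‖ ≤ C * ρ * ‖x - x'‖ := by
  have h1 : ContDiff ℝ 1 (fderiv ℝ G) := hG.fderiv_right (by norm_num)
  obtain ⟨C, t, ht, hC⟩ := h1.contDiffAt (x := 0).exists_lipschitzOnWith
  obtain ⟨r, hr, hrt⟩ := Metric.nhds_basis_closedBall.mem_iff.1 ht
  refine ⟨C + 1, by positivity, r, hr, fun ρ hρ x x' hx hx' => ?_⟩
  refine (convex_closedBall (0 : X) ρ).norm_image_sub_le_of_norm_fderiv_le (𝕜 := ℝ)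
    (fun y _ => (hG.differentiable (by norm_num)) y) (fun y hy => ?_)
    (by simpa using hx') (by simpa using hx)
  have hy : ‖y‖ ≤ ρ := by simpa using hy
  have hρ0 : 0 ≤ ρ := (norm_nonneg _).trans hy
  have := hC.norm_sub_le (x := y) (y := 0) (hrt (by simpa using hy.trans hρ))
    (hrt (by simpa using hr.le))
  rw [h0, sub_zero, sub_zero] at this
  calc ‖fderiv ℝ G y‖ ≤ C * ‖y‖ := this
    _ ≤ (C + 1) * ρ := by gcongr; linarith

/-! ### The closed loop in the coordinates of the center manifold -/

namespace Sys

variable {k q m : ℕ} {S : Sys k q m} {h : Vec k → Vec q} {δh : ℝ}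

/-- The standing assumptions on the plant and the feedback. -/
structure Standing (S : Sys k q m) : Prop where
  regular : S.Regular
  A1_eq : S.A1 = 0
  Kn_eq : S.Kn = 0
  feedback : S.K12 + S.K11 * S.E = 0
  sylvester : S.AK * S.E - S.E * S.A1 + S.B2 * S.K12 = 0

variable (S) in
/-- The nonlinearity of the `y`-equation as a function of `y`, `v` and the measurement error `e` of
`v`, when the feedback is `u = K₁₁ (v + e)`. -/
def phi1 (y : Vec k) (v e : Vec q) : Vec k :=
  S.G1 (y, v + act S.E y, act S.K11 (v + e))

variable (S) in
/-- The nonlinearity of the `v`-equation as a function of `y`, `v` and the measurement error `e` of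
`v`, when the feedback is `u = K₁₁ (v + e)`. -/
def phi2 (y : Vec k) (v e : Vec q) : Vec q :=
  S.G2 (y, v + act S.E y, act S.K11 (v + e)) - act S.E (S.phi1 y v e)

variable (S) in
/-- The linear substitution behind `phi1` and `phi2`. -/
def subst : Vec k × Vec q × Vec q →L[ℝ] Vec k × Vec q × Vec m :=
  (ContinuousLinearMap.fst ℝ _ _).prod
    (((ContinuousLinearMap.fst ℝ _ _).comp (ContinuousLinearMap.snd ℝ _ _) +
        (actL S.E).comp (ContinuousLinearMap.fst ℝ _ _)).prod
      ((actL S.K11).comp ((ContinuousLinearMap.fst ℝ _ _).comp (ContinuousLinearMap.snd ℝ _ _) +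
        (ContinuousLinearMap.snd ℝ _ _).comp (ContinuousLinearMap.snd ℝ _ _))))

theorem subst_apply (y : Vec k) (v e : Vec q) :
    S.subst (y, v, e) = (y, v + act S.E y, act S.K11 (v + e)) := rfl

/-- The feedback only depends on the coordinate `v = z - E y`. -/
theorem Standing.feedback_eq (hS : S.Standing) (y : Vec k) (z : Vec q) :
    S.K y z = act S.K11 (z - act S.E y) := by
  have h1 : S.K12 = -(S.K11 * S.E) := eq_neg_of_add_eq_zero_left hS.feedback
  rw [K, hS.Kn_eq, h1, act_map_sub, ← mul_act]
  simp [act, sub_eq_add_neg]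

/-- The equation for `E` reduces to `A₂ E = 0`, because `A₁` and `K₁₂ + K₁₁ E` vanish. -/
theorem Standing.A2_mul_E (hS : S.Standing) : S.A2 * S.E = 0 := by
  have h1 := hS.sylvester
  rw [hS.A1_eq, Matrix.mul_zero, sub_zero, AK, Matrix.add_mul, Matrix.mul_assoc, add_assoc,
    ← Matrix.mul_add, add_comm (S.K11 * S.E), hS.feedback, Matrix.mul_zero, add_zero] at h1
  exact h1

theorem Standing.errInput_eq (hS : S.Standing) (y : Vec k) (w : Vec q) (ey : Vec k) (ev : Vec q) :
    S.errInput h y w ey ev = act S.K11 (w + h y + ev) := by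
  rw [errInput, hS.feedback_eq, add_sub_cancel_right]

theorem Standing.closedLoop_feedback (hS : S.Standing) (y : Vec k) (v : Vec q) :
    S.K y (v + act S.E y) = act S.K11 (v + 0) := by
  rw [hS.feedback_eq, add_sub_cancel_right, add_zero]

theorem Standing.g1_closedLoop (hS : S.Standing) (y : Vec k) (v : Vec q) :
    S.g1 y (v + act S.E y) (S.K y (v + act S.E y)) = S.phi1 y v 0 := by
  rw [hS.closedLoop_feedback]; rfl

theorem Standing.g2_eq (hS : S.Standing) (y : Vec k) (v e : Vec q) :
    S.g2 y (v + act S.E y) (act S.K11 (v + e)) = S.phi2 y v e := by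
  simp [g2, hS.Kn_eq, phi2, phi1]

theorem Standing.g2_closedLoop (hS : S.Standing) (y : Vec k) (v : Vec q) :
    S.g2 y (v + act S.E y) (S.K y (v + act S.E y)) = S.phi2 y v 0 := by
  rw [hS.closedLoop_feedback, hS.g2_eq]

theorem Standing.g1Red_eq (hS : S.Standing) (y : Vec k) : S.g1Red h y = S.phi1 y (h y) 0 :=
  hS.g1_closedLoop y (h y)

theorem Standing.g2Red_eq (hS : S.Standing) (y : Vec k) : S.g2Red h y = S.phi2 y (h y) 0 :=
  hS.g2_closedLoop y (h y)

theorem Standing.N1_eq (hS : S.Standing) (y : Vec k) (w : Vec q) (ey : Vec k) (ev : Vec q) :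
    S.N1 h y w ey ev = S.phi1 y (w + h y) ev - S.phi1 y (h y) 0 := by
  rw [N1, hS.errInput_eq, hS.g1Red_eq]; rfl

theorem Standing.N2_eq (hS : S.Standing) (y : Vec k) (w : Vec q) (ey : Vec k) (ev : Vec q) :
    S.N2 h y w ey ev = S.phi2 y (w + h y) ev - S.phi2 y (h y) 0 -
      fderiv ℝ h y (S.phi1 y (w + h y) ev - S.phi1 y (h y) 0) := by
  rw [N2, hS.errInput_eq, hS.g2_eq, hS.g1Red_eq, hS.g2Red_eq, add_sub_add_left_eq_sub]; rfl

theorem Standing.contDiff_phi (hS : S.Standing) :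
    ContDiff ℝ 2 (fun x : Vec k × Vec q × Vec q => S.phi1 x.1 x.2.1 x.2.2) ∧
    ContDiff ℝ 2 (fun x : Vec k × Vec q × Vec q => S.phi2 x.1 x.2.1 x.2.2) := by
  have h1 : ContDiff ℝ 2 (fun x : Vec k × Vec q × Vec q => S.phi1 x.1 x.2.1 x.2.2) :=
    hS.regular.1.comp S.subst.contDiff
  exact ⟨h1, (hS.regular.2.1.comp S.subst.contDiff).sub ((actL S.E).contDiff.comp h1)⟩

theorem Standing.fderiv_phi (hS : S.Standing) :
    fderiv ℝ (fun x : Vec k × Vec q × Vec q => S.phi1 x.1 x.2.1 x.2.2) 0 = 0 ∧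
    fderiv ℝ (fun x : Vec k × Vec q × Vec q => S.phi2 x.1 x.2.1 x.2.2) 0 = 0 := by
  obtain ⟨hG1, hG2, -, -, hd1, hd2⟩ := hS.regular
  have hs : S.subst 0 = 0 := map_zero S.subst
  have hE := (actL S.E).hasFDerivAt (x := S.G1 (S.subst 0))
  have e1 : HasFDerivAt (𝕜 := ℝ) S.G1 0 (S.subst 0) := by
    rw [hs, ← hd1]; exact (hG1.differentiable (by norm_num) 0).hasFDerivAt
  have e2 : HasFDerivAt (𝕜 := ℝ) S.G2 0 (S.subst 0) := by
    rw [hs, ← hd2]; exact (hG2.differentiable (by norm_num) 0).hasFDerivAt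
  have f1 := e1.comp (0 : Vec k × Vec q × Vec q) S.subst.hasFDerivAt
  have f2 := e2.comp (0 : Vec k × Vec q × Vec q) S.subst.hasFDerivAt
  have f3 := f2.sub (hE.comp (0 : Vec k × Vec q × Vec q) f1)
  rw [ContinuousLinearMap.zero_comp] at f1
  refine ⟨f1.fderiv, ?_⟩
  have f4 := f3.fderiv
  simp only [ContinuousLinearMap.zero_comp, ContinuousLinearMap.comp_zero, sub_zero] at f4
  exact f4

theorem Standing.phi_zero (hS : S.Standing) : S.phi1 0 0 0 = 0 ∧ S.phi2 0 0 0 = 0 := by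
  obtain ⟨-, -, h1, h2, -⟩ := hS.regular
  have h3 : S.phi1 0 0 0 = 0 := by
    rw [phi1, ← subst_apply (S := S)]; exact (congrArg S.G1 (map_zero S.subst)).trans h1
  refine ⟨h3, ?_⟩
  have h4 : S.phi2 0 0 0 = S.G2 (S.subst 0) - act S.E (S.phi1 0 0 0) := rfl
  rw [h4, h3, act_map_zero, sub_zero, map_zero, h2]

/-- Near the origin the nonlinearities have a Lipschitz constant proportional to the radius. -/
theorem Standing.exists_lipschitz_phi (hS : S.Standing) :
    ∃ C > 0, ∃ r > 0, ∀ ρ ≤ r, ∀ (y y' : Vec k) (v v' e e' : Vec q), ‖y‖ ≤ ρ → ‖y'‖ ≤ ρ →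
      ‖v‖ ≤ ρ → ‖v'‖ ≤ ρ → ‖e‖ ≤ ρ → ‖e'‖ ≤ ρ →
      ‖S.phi1 y v e - S.phi1 y' v' e'‖ ≤ C * ρ * (‖y - y'‖ + ‖v - v'‖ + ‖e - e'‖) ∧
      ‖S.phi2 y v e - S.phi2 y' v' e'‖ ≤ C * ρ * (‖y - y'‖ + ‖v - v'‖ + ‖e - e'‖) := by
  obtain ⟨C1, hC1, r1, hr1, H1⟩ := exists_quadratic_lipschitz hS.contDiff_phi.1 hS.fderiv_phi.1
  obtain ⟨C2, hC2, r2, hr2, H2⟩ := exists_quadratic_lipschitz hS.contDiff_phi.2 hS.fderiv_phi.2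
  refine ⟨max C1 C2, by positivity, min r1 r2, by positivity, ?_⟩
  intro ρ hρ y y' v v' e e' hy hy' hv hv' he he'
  have hρ0 : 0 ≤ ρ := (norm_nonneg _).trans hy
  have n1 : ‖((y, v, e) : Vec k × Vec q × Vec q)‖ ≤ ρ := by
    simp [Prod.norm_def, hy, hv, he]
  have n2 : ‖((y', v', e') : Vec k × Vec q × Vec q)‖ ≤ ρ := by
    simp [Prod.norm_def, hy', hv', he']
  have n3 : ‖((y, v, e) : Vec k × Vec q × Vec q) - (y', v', e')‖ ≤
      ‖y - y'‖ + ‖v - v'‖ + ‖e - e'‖ := by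
    have a1 := norm_nonneg (y - y')
    have a2 := norm_nonneg (v - v')
    have a3 := norm_nonneg (e - e')
    simp only [Prod.mk_sub_mk, Prod.norm_def, sup_le_iff]
    refine ⟨?_, ?_, ?_⟩ <;> linarith
  refine ⟨(H1 ρ (hρ.trans (min_le_left _ _)) _ _ n1 n2).trans ?_,
    (H2 ρ (hρ.trans (min_le_right _ _)) _ _ n1 n2).trans ?_⟩
  · gcongr; exact le_max_left _ _
  · gcongr; exact le_max_right _ _

/-- The plant with a held input in the coordinates `(y, v)`. -/
theorem Standing.hasDerivWithinAt_coords (hS : S.Standing) {y : ℝ → Vec k} {z : ℝ → Vec q}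
    {yr : Vec k} {zr : Vec q} {s : ℝ}
    (hy : HasDerivWithinAt y (S.yDot (y s) (z s) (S.K yr zr)) (Ici s) s)
    (hz : HasDerivWithinAt z (S.zDot (y s) (z s) (S.K yr zr)) (Ici s) s) :
    HasDerivWithinAt y
      (S.phi1 (y s) (S.vOf (y s) (z s)) (S.vOf yr zr - S.vOf (y s) (z s))) (Ici s) s ∧
    HasDerivWithinAt (fun t => S.vOf (y t) (z t))
      (act S.AK (S.vOf (y s) (z s)) +
        act (S.B2 * S.K11) (S.vOf yr zr - S.vOf (y s) (z s)) +
        S.phi2 (y s) (S.vOf (y s) (z s)) (S.vOf yr zr - S.vOf (y s) (z s))) (Ici s) s := by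
  have hu : S.K yr zr = act S.K11 (S.vOf (y s) (z s) + (S.vOf yr zr - S.vOf (y s) (z s))) := by
    rw [hS.feedback_eq, add_sub_cancel]; rfl
  have hz0 : z s = S.vOf (y s) (z s) + act S.E (y s) := by simp [vOf]
  have h1 : S.yDot (y s) (z s) (S.K yr zr) =
      S.phi1 (y s) (S.vOf (y s) (z s)) (S.vOf yr zr - S.vOf (y s) (z s)) := by
    rw [yDot, hS.A1_eq, zero_act, zero_add, phi1, hu, ← hz0]
  rw [h1] at hy
  refine ⟨hy, ?_⟩
  have h2 : HasDerivWithinAt (fun t => S.vOf (y t) (z t)) _ (Ici s) s :=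
    hz.sub ((actL S.E).hasFDerivAt.comp_hasDerivWithinAt s hy)
  convert h2 using 1
  have h3 : act S.A2 (z s) = act S.A2 (S.vOf (y s) (z s)) := by
    conv_lhs => rw [hz0]
    rw [act_map_add, ← mul_act, hS.A2_mul_E, zero_act, add_zero]
  rw [zDot, h3, phi2, actL_apply, hu, ← hz0, act_map_add S.K11, act_map_add S.B2, AK, add_act,
    mul_act, mul_act]
  abel

theorem IsCenterManifold.hasFDerivAt (hcm : S.IsCenterManifold δh h) {y : Vec k}
    (hy : ‖y‖ < δh) : HasFDerivAt h (fderiv ℝ h y) y := by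
  have hmem : Metric.ball (0 : Vec k) δh ∈ 𝓝 y :=
    Metric.isOpen_ball.mem_nhds (by simpa using hy)
  exact ((hcm.2.1.contDiffAt hmem).differentiableAt (by norm_num)).hasFDerivAt

theorem IsCenterManifold.continuousOn_fderiv (hcm : S.IsCenterManifold δh h) :
    ContinuousOn (fderiv ℝ h) (Metric.ball 0 δh) :=
  hcm.2.1.continuousOn_fderiv_of_isOpen Metric.isOpen_ball le_rfl

/-- The invariance equation of the center manifold: `Dh(y) g₁ʰ(y) = A_K h(y) + g₂ʰ(y)`. -/
theorem IsCenterManifold.invariance (hS : S.Standing) (hcm : S.IsCenterManifold δh h) {y : Vec k}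
    (hy : ‖y‖ < δh) :
    fderiv ℝ h y (S.phi1 y (h y) 0) = act S.AK (h y) + S.phi2 y (h y) 0 := by
  -- differentiate `v = h(y)` along the solution that starts at `(y, h(y))`
  let F : Vec k × Vec q → Vec k × Vec q := fun x =>
    (S.phi1 x.1 x.2 0, act S.AK x.2 + S.phi2 x.1 x.2 0)
  have hF : ContDiff ℝ 1 F := by
    let ι : Vec k × Vec q →L[ℝ] Vec k × Vec q × Vec q :=
      (ContinuousLinearMap.fst ℝ _ _).prod ((ContinuousLinearMap.snd ℝ _ _).prod 0)
    have h1 : ContDiff ℝ 2 (fun x : Vec k × Vec q => S.phi1 x.1 x.2 0) :=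
      hS.contDiff_phi.1.comp ι.contDiff
    have h2 : ContDiff ℝ 2 (fun x : Vec k × Vec q => S.phi2 x.1 x.2 0) :=
      hS.contDiff_phi.2.comp ι.contDiff
    have h3 : ContDiff ℝ 2 (fun x : Vec k × Vec q => act S.AK x.2) :=
      (actL S.AK).contDiff.comp contDiff_snd
    exact (h1.prodMk (h3.add h2)).of_le (by norm_num)
  obtain ⟨r, hr, ε, hε, H⟩ := (hF.contDiffAt (x := (y, h y)))
    |>.exists_forall_mem_closedBall_exists_eq_forall_mem_Ioo_hasDerivAt 0
  obtain ⟨α, hα0, hα⟩ := H (y, h y) (Metric.mem_closedBall_self hr.le)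
  simp only [zero_sub, zero_add] at hα
  have hαc : ContinuousAt α 0 := (hα 0 ⟨by linarith, hε⟩).continuousAt
  have hev : ∀ᶠ s in 𝓝 (0 : ℝ), ‖(α s).1‖ < δh := by
    refine (hαc.fst.norm).eventually_lt continuousAt_const ?_
    rw [hα0]; exact hy
  obtain ⟨T0, hT0, hball⟩ := Metric.eventually_nhds_iff.1 hev
  let T := min T0 ε
  have hT : 0 < T := lt_min hT0 hε
  have hin : ∀ s ∈ Ico 0 T, s ∈ Ioo (-ε) ε := fun s hs =>
    ⟨by linarith [hs.1], hs.2.trans_le (min_le_right _ _)⟩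
  have hfst : ∀ s ∈ Ico 0 T, HasDerivAt (fun t => (α t).1) (F (α s)).1 s := fun s hs =>
    (hα s (hin s hs)).fst
  have hsnd : ∀ s ∈ Ico 0 T, HasDerivAt (fun t => (α t).2) (F (α s)).2 s := fun s hs =>
    (hα s (hin s hs)).snd
  have hsol : S.IsClosedLoopSolution T (fun t => (α t).1) (fun t => (α t).2) := by
    refine ⟨fun s hs => (hfst s hs).continuousAt.continuousWithinAt,
      fun s hs => (hsnd s hs).continuousAt.continuousWithinAt, fun s hs => ⟨?_, ?_⟩⟩
    · rw [hS.g1_closedLoop, hS.A1_eq, zero_act, zero_add]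
      exact (hfst s hs).hasDerivWithinAt
    · rw [hS.g2_closedLoop]
      exact (hsnd s hs).hasDerivWithinAt
  have hgraph := hcm.2.2.2.2 T _ _ hsol (fun s hs => hball (by
    rw [Real.dist_eq, sub_zero, abs_of_nonneg hs.1]
    exact hs.2.trans_le (min_le_left _ _))) (by rw [hα0])
  have h0 : (0 : ℝ) ∈ Ico 0 T := ⟨le_rfl, hT⟩
  have d1 : HasDerivWithinAt (fun t => (α t).2) (F (α 0)).2 (Ici 0) 0 :=
    (hsnd 0 h0).hasDerivWithinAt
  have d2 : HasDerivWithinAt (fun t => h (α t).1) (fderiv ℝ h y (F (α 0)).1) (Ici 0) 0 := by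
    have := hcm.hasFDerivAt hy
    refine HasFDerivAt.comp_hasDerivWithinAt (f := fun t => (α t).1) 0 ?_
      (hfst 0 h0).hasDerivWithinAt
    rw [hα0]; exact this
  have d3 : HasDerivWithinAt (fun t => h (α t).1) (F (α 0)).2 (Ici 0) 0 := by
    refine d1.congr_of_eventuallyEq ?_ ?_
    · filter_upwards [Ico_mem_nhdsGE hT] with t ht
      exact (hgraph t ht).symm
    · rw [hα0]
  have := (uniqueDiffWithinAt_Ici (0 : ℝ)).eq_deriv _ d2 d3
  simpa [F, hα0] using this

/-- The plant with a held input in the coordinates `(y, w)`. -/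
theorem Standing.hasDerivWithinAt_wOf (hS : S.Standing) (hcm : S.IsCenterManifold δh h)
    {y : ℝ → Vec k} {z : ℝ → Vec q} {yr : Vec k} {zr : Vec q} {s : ℝ} (hys : ‖y s‖ < δh)
    (hy : HasDerivWithinAt y (S.yDot (y s) (z s) (S.K yr zr)) (Ici s) s)
    (hz : HasDerivWithinAt z (S.zDot (y s) (z s) (S.K yr zr)) (Ici s) s) :
    HasDerivWithinAt y (S.g1Red h (y s) + S.N1 h (y s) (S.wOf h (y s) (z s)) (yr - y s)
      (S.vOf yr zr - S.vOf (y s) (z s))) (Ici s) s ∧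
    HasDerivWithinAt (fun t => S.wOf h (y t) (z t))
      (act S.AK (S.wOf h (y s) (z s)) + (act (S.B2 * S.K11) (S.vOf yr zr - S.vOf (y s) (z s)) +
        S.N2 h (y s) (S.wOf h (y s) (z s)) (yr - y s)
          (S.vOf yr zr - S.vOf (y s) (z s)))) (Ici s) s := by
  obtain ⟨h1, h2⟩ := hS.hasDerivWithinAt_coords hy hz
  have hwv : S.wOf h (y s) (z s) + h (y s) = S.vOf (y s) (z s) := by simp [wOf]
  rw [hS.N1_eq, hS.N2_eq, hwv, hS.g1Red_eq, add_sub_cancel]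
  refine ⟨h1, ?_⟩
  have h3 : HasDerivWithinAt (fun t => S.wOf h (y t) (z t)) _ (Ici s) s :=
    h2.sub ((hcm.hasFDerivAt hys).comp_hasDerivWithinAt s h1)
  convert h3 using 1
  rw [map_sub, hcm.invariance hS hys, wOf, act_map_sub]
  abel

end Sys

/-! ### Global integral curves -/

open scoped NNReal in
/-- A bounded Lipschitz vector field has global integral curves. -/
theorem exists_global_integralCurve {X : Type*} [NormedAddCommGroup X] [NormedSpace ℝ X]
    [CompleteSpace X] {F : X → X} {K M : ℝ≥0} (hK : LipschitzWith K F) (hM : ∀ x, ‖F x‖ ≤ M)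
    (x₀ : X) : ∃ α : ℝ → X, α 0 = x₀ ∧ ∀ t, HasDerivAt α (F (α t)) t := by
  have hloc : ∀ n : ℕ, ∃ α : ℝ → X, α 0 = x₀ ∧
      ∀ t ∈ Ioo (-(n + 1 : ℝ)) (n + 1), HasDerivAt α (F (α t)) t := by
    intro n
    have hn : (0 : ℝ) ≤ n + 1 := by positivity
    let t₀ : Icc (-(n + 1 : ℝ)) (n + 1) := ⟨0, by constructor <;> linarith⟩
    have hpl : IsPicardLindelof (fun _ => F) t₀ x₀ (M * (n + 1)) 0 M K :=
      { lipschitzOnWith := fun t _ => hK.lipschitzOnWith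
        continuousOn := fun x _ => continuousOn_const
        norm_le := fun t _ x _ => hM x
        mul_max_le := by simp [t₀] }
    obtain ⟨α, h0, hα⟩ := hpl.exists_eq_forall_mem_Icc_hasDerivWithinAt₀
    exact ⟨α, h0, fun t ht => (hα t (Ioo_subset_Icc_self ht)).hasDerivAt
      (Icc_mem_nhds ht.1 ht.2)⟩
  choose A hA0 hA using hloc
  have hagree : ∀ j n : ℕ, j ≤ n → ∀ t ∈ Ioo (-(j + 1 : ℝ)) (j + 1), A j t = A n t := by
    intro j n hjn t ht
    have hjn' : (j : ℝ) ≤ n := by exact_mod_cast hjn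
    have hj0 : (0 : ℝ) ≤ j := by positivity
    refine ODE_solution_unique_of_mem_Ioo (v := fun _ => F) (s := fun _ => univ) (K := K)
      (t₀ := 0) (fun t _ => hK.lipschitzOnWith) ⟨by linarith, by linarith⟩
      (fun t ht => ⟨hA j t ht, mem_univ _⟩)
      (fun t ht => ⟨hA n t ⟨by linarith [ht.1], by linarith [ht.2]⟩, mem_univ _⟩)
      ((hA0 j).trans (hA0 n).symm) ht
  -- at time `t` use the curve that is defined on an interval of radius `⌈|t|⌉ + 1`
  refine ⟨fun t => A ⌈|t|⌉₊ t, hA0 _, fun t => ?_⟩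
  set n := ⌈|t|⌉₊ + 1 with hn
  have hloc : ∀ᶠ t' in 𝓝 t, A ⌈|t'|⌉₊ t' = A n t' := by
    have : ∀ᶠ t' in 𝓝 t, |t'| < |t| + 1 :=
      continuous_abs.continuousAt.eventually_lt continuousAt_const (by linarith)
    filter_upwards [this] with t' ht'
    refine hagree _ _ ?_ t' ?_
    · rw [Nat.ceil_le]
      have := Nat.le_ceil (|t|)
      push_cast [hn]; linarith
    · have := Nat.le_ceil (|t'|)
      rw [mem_Ioo, ← abs_lt]; linarith
  have hd : HasDerivAt (A n) (F (A n t)) t := by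
    refine hA n t ?_
    rw [mem_Ioo, ← abs_lt]
    have := Nat.le_ceil (|t|)
    push_cast [hn]; linarith
  have := hd.congr_of_eventuallyEq hloc
  rwa [← hloc.self_of_nhds] at this

open scoped NNReal in
/-- A vector field that is `C¹` on a ball agrees on a smaller ball with a Lipschitz vector field
that has global integral curves. -/
theorem exists_cutoff {X : Type*} [NormedAddCommGroup X] [NormedSpace ℝ X]
    [FiniteDimensional ℝ X] {F : X → X} {ρ R : ℝ} (hρ : 0 < ρ) (hR : ρ < R)
    (hF : ContDiffOn ℝ 1 F (Metric.ball 0 R)) :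
    ∃ F' : X → X, ∃ K : ℝ≥0, LipschitzWith K F' ∧ (∀ x, ‖x‖ ≤ ρ → F' x = F x) ∧
      ∀ x₀, ∃ α : ℝ → X, α 0 = x₀ ∧ ∀ t, HasDerivAt α (F' (α t)) t := by
  let χ : ContDiffBump (0 : X) := ⟨ρ, (ρ + R) / 2, hρ, by linarith⟩
  let F' : X → X := fun x => χ x • F x
  have hcd : ContDiff ℝ 1 F' := by
    rw [contDiff_iff_contDiffAt]
    intro x
    by_cases hx : x ∈ Metric.ball (0 : X) R
    · exact (χ.contDiff.contDiffAt).smul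
        (hF.contDiffAt (Metric.isOpen_ball.mem_nhds hx))
    · have : F' =ᶠ[𝓝 x] fun _ => 0 := by
        have hmem : (Metric.closedBall (0 : X) ((ρ + R) / 2))ᶜ ∈ 𝓝 x := by
          refine Metric.isClosed_closedBall.isOpen_compl.mem_nhds ?_
          simp only [Metric.mem_ball, dist_zero_right, not_lt] at hx
          simp only [mem_compl_iff, Metric.mem_closedBall, dist_zero_right, not_le]
          linarith
        filter_upwards [hmem] with x' hx'
        have : χ x' = 0 := χ.zero_of_le_dist (by
          simp only [mem_compl_iff, Metric.mem_closedBall, not_le] at hx'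
          exact hx'.le)
        simp [F', this]
      exact contDiffAt_const.congr_of_eventuallyEq this
  have hcs : HasCompactSupport F' := χ.hasCompactSupport.smul_right
  obtain ⟨K, hK⟩ := hcd.lipschitzWith_of_hasCompactSupport hcs (by norm_num)
  obtain ⟨M, hM⟩ := hcs.exists_bound_of_continuous hcd.continuous
  have hM0 : 0 ≤ M := (norm_nonneg _).trans (hM 0)
  refine ⟨F', K, hK, fun x hx => ?_,
    fun x₀ => exists_global_integralCurve (M := ⟨M, hM0⟩) hK hM x₀⟩
  have : χ x = 1 := χ.one_of_mem_closedBall (by simpa using hx)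
  simp [F', this]

/-! ### The derivative of the center manifold -/

/-- A function with `g' ≥ θ g` on `[0, T]` that is nonpositive at `T` is nonpositive at `0`. -/
theorem nonpos_of_deriv_ge_mul {g g' : ℝ → ℝ} {θ T : ℝ} (hT : 0 ≤ T)
    (hg : ∀ s ∈ Icc 0 T, HasDerivAt g (g' s) s) (hle : ∀ s ∈ Icc 0 T, θ * g s ≤ g' s)
    (hend : g T ≤ 0) : g 0 ≤ 0 := by
  have hd : ∀ s ∈ Icc 0 T, HasDerivAt (fun s => Real.exp (-(θ * s)) * g s)
      (Real.exp (-(θ * s)) * (g' s - θ * g s)) s := by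
    intro s hs
    have h1 : HasDerivAt (fun s => Real.exp (-(θ * s))) (Real.exp (-(θ * s)) * (-(θ * 1))) s :=
      (((hasDerivAt_id s).const_mul θ).neg).exp
    exact (h1.mul (hg s hs)).congr_deriv (by ring)
  have hmono : MonotoneOn (fun s => Real.exp (-(θ * s)) * g s) (Icc 0 T) := by
    refine monotoneOn_of_hasDerivWithinAt_nonneg (convex_Icc 0 T)
      (fun s hs => (hd s hs).continuousAt.continuousWithinAt)
      (fun s hs => (hd s (interior_subset hs)).hasDerivWithinAt) (fun s hs => ?_)
    exact mul_nonneg (Real.exp_pos _).le (sub_nonneg.2 (hle s (interior_subset hs)))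
  have h2 := hmono ⟨le_rfl, hT⟩ ⟨hT, le_rfl⟩ hT
  simp only [mul_zero, neg_zero, Real.exp_zero, one_mul] at h2
  exact h2.trans (mul_nonpos_of_nonneg_of_nonpos (Real.exp_pos _).le hend)

/-- Backwards along the flow of a field with `⟪y, f y⟫ ≤ -c ‖y‖^α`, the norm increases until it
reaches any prescribed radius `r`. -/
theorem exists_reach_sphere {X : Type*} [NormedAddCommGroup X] [InnerProductSpace ℝ X]
    {f : X → X} {Y : ℝ → X} {r c α : ℝ} (hc : 0 < c) (hα : 0 ≤ α)
    (hY : ∀ s, ‖Y s‖ ≤ r → HasDerivAt Y (-f (Y s)) s) (hYc : Continuous Y)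
    (hf : ∀ x, ‖x‖ ≤ r → inner ℝ x (f x) ≤ -c * ‖x‖ ^ α) (h0 : 0 < ‖Y 0‖) (h0r : ‖Y 0‖ < r) :
    ∃ T ≥ 0, ‖Y T‖ = r ∧ ∀ s ∈ Icc 0 T, ‖Y 0‖ ≤ ‖Y s‖ ∧ ‖Y s‖ ≤ r := by
  have hcont : Continuous fun s => ‖Y s‖ ^ 2 := (hYc.norm).pow 2
  have hder : ∀ s, ‖Y s‖ ≤ r → HasDerivAt (fun s => ‖Y s‖ ^ 2) (2 * inner ℝ (Y s) (-f (Y s))) s :=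
    fun s hs => (hY s hs).norm_sq
  have hge : ∀ s, ‖Y s‖ ≤ r → 2 * c * ‖Y s‖ ^ α ≤ 2 * inner ℝ (Y s) (-f (Y s)) := by
    intro s hs
    have := hf _ hs
    rw [inner_neg_right]
    linarith
  have hmono : ∀ T, (∀ s ∈ Ico 0 T, ‖Y s‖ ≤ r) → ∀ s ∈ Icc 0 T, ‖Y 0‖ ≤ ‖Y s‖ := by
    intro T hT s hs
    have := image_le_of_deriv_right_le_deriv_boundary (f := fun _ => ‖Y 0‖ ^ 2)
      (f' := fun _ => 0) (B := fun s => ‖Y s‖ ^ 2) (a := 0) (b := T) continuousOn_const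
      (fun s _ => hasDerivWithinAt_const _ _ _) le_rfl hcont.continuousOn
      (fun s hs => (hder s (hT s hs)).hasDerivWithinAt)
      (fun s hs => (by positivity : (0 : ℝ) ≤ 2 * c * ‖Y s‖ ^ α).trans (hge s (hT s hs))) hs
    exact le_of_sq_le_sq this (norm_nonneg _)
  have hgrow : ∀ T, (∀ s ∈ Ico 0 T, ‖Y s‖ ≤ r) → ∀ s ∈ Icc 0 T,
      2 * c * ‖Y 0‖ ^ α * s ≤ ‖Y s‖ ^ 2 := by
    intro T hT s hs
    refine image_le_of_deriv_right_le_deriv_boundary (f := fun s => 2 * c * ‖Y 0‖ ^ α * s)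
      (f' := fun _ => 2 * c * ‖Y 0‖ ^ α * 1) (B := fun s => ‖Y s‖ ^ 2) (a := 0) (b := T)
      (by fun_prop)
      (fun s _ => ((hasDerivAt_id s).const_mul _).hasDerivWithinAt) (by simp)
      hcont.continuousOn (fun s hs => (hder s (hT s hs)).hasDerivWithinAt) (fun s hs => ?_) hs
    refine le_trans ?_ (hge s (hT s hs))
    have := hmono T hT s (Ico_subset_Icc_self hs)
    rw [mul_one]
    gcongr
  have hpos : 0 < 2 * c * ‖Y 0‖ ^ α := by positivity
  obtain ⟨T₀, hT₀, hT₀r⟩ : ∃ T ≥ 0, r ≤ ‖Y T‖ := by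
    by_contra! hcon
    set T := r ^ 2 / (2 * c * ‖Y 0‖ ^ α) with hTdef
    have hT : 0 ≤ T := by positivity
    have h1 := hgrow T (fun s hs => (hcon s hs.1).le) T ⟨hT, le_rfl⟩
    rw [hTdef, mul_div_cancel₀ _ hpos.ne'] at h1
    have h2 := hcon T hT
    nlinarith [norm_nonneg (Y T)]
  have hcomp : IsCompact (Icc 0 T₀ ∩ {s | r ≤ ‖Y s‖}) :=
    isCompact_Icc.inter_right (isClosed_le continuous_const hYc.norm)
  obtain ⟨T, ⟨⟨hT0, hTT₀⟩, hTr⟩, hleast⟩ := hcomp.exists_isLeast ⟨T₀, ⟨hT₀, le_rfl⟩, hT₀r⟩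
  have hlt : ∀ s ∈ Ico 0 T, ‖Y s‖ < r := by
    intro s hs
    by_contra! hcon
    exact absurd (hleast ⟨⟨hs.1, hs.2.le.trans hTT₀⟩, hcon⟩) (not_le.2 hs.2)
  have hTeq : ‖Y T‖ = r := by
    obtain ⟨s, hs, hsr⟩ := intermediate_value_Icc hT0 hYc.norm.continuousOn ⟨h0r.le, hTr⟩
    have : T ≤ s := hleast ⟨⟨hs.1, hs.2.trans hTT₀⟩, hsr.ge⟩
    rw [le_antisymm this hs.2]; exact hsr
  refine ⟨T, hT0, hTeq, fun s hs => ⟨hmono T (fun s hs => (hlt s hs).le) s hs, ?_⟩⟩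
  rcases hs.2.eq_or_lt with h | h
  · rw [h, hTeq]
  · exact (hlt s ⟨hs.1, h⟩).le

/-- The differential inequality behind the bound on the derivative of the center manifold: `D` and
`d` stand for the differences of the `v`- and `y`-components of two solutions in reversed time. -/
theorem IsFactor.comparison_deriv_ge {k q : ℕ} {P Q A : Matrix (Fin q) (Fin q) ℝ}
    {B : Vec q →L[ℝ] Vec q} (hB : IsFactor P B) (hq : 0 < q) (hP : P.PosDef) (hQ : Q.PosDef)
    (hPQ : A.transpose * P + P * A = -Q) {C r κ κ' : ℝ} {Y d fY Δf : Vec k} {D Δg : Vec q}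
    (hC : 0 ≤ C) (hY : ‖Y‖ ≤ r) (hr : 12 * C * r ≤ lamMin Q / (2 * lamMax P) / 2)
    (hκ0 : 0 ≤ κ) (hκ : 4 * C * lamMax P ≤ κ * κ') (hκ1 : κ ≤ lamMin Q / 2)
    (hκ2 : κ ≤ lamMin Q / (2 * lamMax P) / 2) (hfY : ‖fY‖ ≤ 2 * C * ‖Y‖ * ‖Y‖)
    (hΔf : ‖Δf‖ ≤ 4 * C * ‖Y‖ * ‖d‖) (hΔg : ‖Δg‖ ≤ 4 * C * ‖Y‖ * ‖d‖) :
    lamMin Q / (2 * lamMax P) * (‖B D‖ ^ 2 - κ' ^ 2 * (‖Y‖ ^ 2 * ‖d‖ ^ 2)) ≤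
      2 * inner ℝ (B D) (B (-(act A D + Δg))) - κ' ^ 2 *
        (2 * inner ℝ Y (-fY) * ‖d‖ ^ 2 + ‖Y‖ ^ 2 * (2 * inner ℝ d (-Δf))) := by
  have hL := lamMax_pos hq hP
  have hμ := lamMin_pos hq hQ
  have nY := norm_nonneg Y
  have nd := norm_nonneg d
  have nD := norm_nonneg D
  have e1 : 2 * inner ℝ Y (-fY) ≤ 4 * C * r * ‖Y‖ ^ 2 := by
    have h1 := real_inner_le_norm Y (-fY)
    rw [norm_neg] at h1
    have h2 : ‖Y‖ * ‖fY‖ ≤ ‖Y‖ * (2 * C * r * ‖Y‖) := by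
      refine mul_le_mul_of_nonneg_left (hfY.trans ?_) nY
      gcongr
    linarith
  have e2 : 2 * inner ℝ d (-Δf) ≤ 8 * C * r * ‖d‖ ^ 2 := by
    have h1 := real_inner_le_norm d (-Δf)
    rw [norm_neg] at h1
    have h2 : ‖d‖ * ‖Δf‖ ≤ ‖d‖ * (4 * C * r * ‖d‖) := by
      refine mul_le_mul_of_nonneg_left (hΔf.trans ?_) nd
      gcongr
    linarith
  have e3 : lamMin Q * ‖D‖ ^ 2 - 8 * C * lamMax P * (‖D‖ * (‖Y‖ * ‖d‖)) ≤
      2 * inner ℝ (B D) (B (-(act A D + Δg))) := by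
    have h6 : act P (-(act A D + Δg)) = -(act P (act A D) + act P Δg) := by
      rw [← act_map_add]; exact map_neg (actL P) _
    rw [hB, h6, inner_neg_right, inner_add_right, inner_act_mul_of_lyapunov hP.isHermitian hPQ]
    have h8 := lamMin_mul_le hQ.isHermitian D
    have h9 : inner ℝ D (act P Δg) ≤ ‖D‖ * (lamMax P * (4 * C * ‖Y‖ * ‖d‖)) := by
      refine (real_inner_le_norm _ _).trans ?_
      gcongr
      exact (hB.norm_act_le_lamMax hq hP _).trans (by gcongr)
    linarith
  have e4 : ‖B D‖ ^ 2 ≤ lamMax P * ‖D‖ ^ 2 := by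
    rw [hB.norm_sq]; exact le_lamMax_mul hP.isHermitian _
  generalize lamMin Q = μ at *
  generalize lamMax P = L at *
  have hθ : 0 < μ / (2 * L) := by positivity
  have e5 : κ' ^ 2 * (2 * inner ℝ Y (-fY) * ‖d‖ ^ 2 + ‖Y‖ ^ 2 * (2 * inner ℝ d (-Δf))) ≤
      (μ / (2 * L) / 2) * (κ' * (‖Y‖ * ‖d‖)) ^ 2 := by
    calc _ ≤ κ' ^ 2 * (4 * C * r * ‖Y‖ ^ 2 * ‖d‖ ^ 2 +
        ‖Y‖ ^ 2 * (8 * C * r * ‖d‖ ^ 2)) := by gcongr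
      _ = (12 * C * r) * (κ' * (‖Y‖ * ‖d‖)) ^ 2 := by ring
      _ ≤ _ := by gcongr
  have e6 : 8 * C * L * (‖D‖ * (‖Y‖ * ‖d‖)) ≤ κ * (‖D‖ ^ 2 + (κ' * (‖Y‖ * ‖d‖)) ^ 2) := by
    calc 8 * C * L * (‖D‖ * (‖Y‖ * ‖d‖)) = 2 * (4 * C * L) * (‖D‖ * (‖Y‖ * ‖d‖)) := by ring
      _ ≤ 2 * (κ * κ') * (‖D‖ * (‖Y‖ * ‖d‖)) := by gcongr
      _ = κ * (2 * ‖D‖ * (κ' * (‖Y‖ * ‖d‖))) := by ring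
      _ ≤ _ := by gcongr; exact two_mul_le_add_sq _ _
  have e7 : μ / (2 * L) * ‖B D‖ ^ 2 ≤ (μ / 2) * ‖D‖ ^ 2 := by
    calc μ / (2 * L) * ‖B D‖ ^ 2 ≤ μ / (2 * L) * (L * ‖D‖ ^ 2) := by gcongr
      _ = _ := by field_simp
  have e8 : κ * (‖D‖ ^ 2 + (κ' * (‖Y‖ * ‖d‖)) ^ 2) ≤
      (μ / 2) * ‖D‖ ^ 2 + (μ / (2 * L) / 2) * (κ' * (‖Y‖ * ‖d‖)) ^ 2 := by
    rw [mul_add]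
    gcongr
  have e9 : κ' ^ 2 * (‖Y‖ ^ 2 * ‖d‖ ^ 2) = (κ' * (‖Y‖ * ‖d‖)) ^ 2 := by ring
  rw [e9]
  linarith

namespace Sys

variable {k q m : ℕ} {S : Sys k q m} {h : Vec k → Vec q} {δh : ℝ}

theorem IsCenterManifold.exists_lipschitz (hcm : S.IsCenterManifold δh h) {ε : ℝ} (hε : 0 < ε) :
    ∃ r > 0, r < δh ∧ (∀ y, ‖y‖ < r → ‖fderiv ℝ h y‖ ≤ ε) ∧
      ∀ y y' : Vec k, ‖y‖ < r → ‖y'‖ < r → ‖h y - h y'‖ ≤ ε * ‖y - y'‖ := by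
  have hδ := hcm.1
  have h0 : (0 : Vec k) ∈ Metric.ball (0 : Vec k) δh := Metric.mem_ball_self hδ
  have hc : ContinuousAt (fderiv ℝ h) 0 :=
    hcm.continuousOn_fderiv.continuousAt (Metric.isOpen_ball.mem_nhds h0)
  have hev : ∀ᶠ y in 𝓝 (0 : Vec k), ‖fderiv ℝ h y‖ < ε := by
    refine hc.norm.eventually_lt continuousAt_const ?_
    rw [hcm.2.2.2.1, norm_zero]; exact hε
  obtain ⟨r0, hr0, hball⟩ := Metric.eventually_nhds_iff.1 hev
  have hb : ∀ y : Vec k, ‖y‖ < min r0 (δh / 2) → ‖fderiv ℝ h y‖ ≤ ε := fun y hy =>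
    (hball (by rw [dist_zero_right]; exact hy.trans_le (min_le_left _ _))).le
  refine ⟨min r0 (δh / 2), by positivity, (min_le_right _ _).trans_lt (by linarith), hb,
    fun y y' hy hy' => ?_⟩
  refine (convex_ball (0 : Vec k) (min r0 (δh / 2))).norm_image_sub_le_of_norm_fderiv_le (𝕜 := ℝ)
    (fun x hx => (hcm.hasFDerivAt ?_).differentiableAt) (fun x hx => hb x (by simpa using hx))
    (by simpa using hy') (by simpa using hy)
  have hx : ‖x‖ < min r0 (δh / 2) := mem_ball_zero_iff.1 hx
  exact hx.trans_le ((min_le_right _ _).trans (by linarith))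

theorem IsCenterManifold.contDiffOn_g1Red (hS : S.Standing) (hcm : S.IsCenterManifold δh h) :
    ContDiffOn ℝ 1 (fun y => S.phi1 y (h y) 0) (Metric.ball 0 δh) :=
  (hS.contDiff_phi.1.of_le (by norm_num)).comp_contDiffOn
    (contDiffOn_id.prodMk (hcm.2.1.prodMk contDiffOn_const))

/-- The derivative of a `C¹` center manifold of the closed loop is `O(‖y‖)` at the origin.

Two nearby points of the manifold are followed backwards along the reduced flow until their norms
reach a fixed sphere. With `D = h(Y₁) - h(Y₂)` and `d = Y₁ - Y₂`, the function
`DᵀPD - κ² ‖Y₁‖² ‖d‖²`, if positive at the start, would grow exponentially on the way, because `A_K`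
is Hurwitz and the reduced dynamics is slow; but on the sphere it is nonpositive when `κ` is
large. -/
theorem IsCenterManifold.exists_norm_fderiv_le (hS : S.Standing) (hcm : S.IsCenterManifold δh h)
    (hq : 0 < q) {P Q : Matrix (Fin q) (Fin q) ℝ} (hP : P.PosDef) (hQ : Q.PosDef)
    (hPQ : S.AK.transpose * P + P * S.AK = -Q) {p k6 : ℝ} (hp : 1 < p) (hk6 : 0 < k6)
    (hdecay : ∀ᶠ y in 𝓝 (0 : Vec k), inner ℝ y (S.g1Red h y) ≤ -k6 * ‖y‖ ^ (p + 1)) :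
    ∃ k8 > 0, ∃ r > 0, ∀ y, ‖y‖ < r → ‖fderiv ℝ h y‖ ≤ k8 * ‖y‖ := by
  obtain ⟨B, hB⟩ : ∃ B, IsFactor P B := exists_factor hP
  have hl := lamMin_pos hq hP
  have hL := lamMax_pos hq hP
  have hμ := lamMin_pos hq hQ
  set l := lamMin P
  set L := lamMax P
  set μ := lamMin Q
  obtain ⟨r0, hr0, hr0δ, -, hLip⟩ := hcm.exists_lipschitz one_pos
  obtain ⟨C, hC, rφ, hrφ, hφ⟩ := hS.exists_lipschitz_phi
  obtain ⟨rd, hrd, hball⟩ := Metric.eventually_nhds_iff.1 hdecay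
  set θ := μ / (2 * L) with hθdef
  have hθ : 0 < θ := by positivity
  -- Young's inequality with weight `κ` splits the cross terms of `comparison_deriv_ge`
  set κ := min (μ / 2) (θ / 2) with hκdef
  have hκ : 0 < κ := by positivity
  set r1 := min (min (r0 / 4) (rφ / 4)) (min (rd / 2) (θ / (24 * C))) with hr1def
  have hr1 : 0 < r1 := by positivity
  have hr1a : r1 ≤ r0 / 4 := (min_le_left _ _).trans (min_le_left _ _)
  have hr1b : r1 ≤ rφ / 4 := (min_le_left _ _).trans (min_le_right _ _)
  have hr1c : r1 ≤ rd / 2 := (min_le_right _ _).trans (min_le_left _ _)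
  have hr1d : r1 ≤ θ / (24 * C) := (min_le_right _ _).trans (min_le_right _ _)
  have hr1e : 12 * C * r1 ≤ θ / 2 := by
    rw [le_div_iff₀ (by positivity)] at hr1d
    linarith
  -- the second bound makes the comparison function nonpositive on the sphere of radius `r1`
  set κ' := max (4 * C * L / κ) (‖B‖ / r1) with hκ'def
  have hκ'pos : 0 < κ' := lt_max_of_lt_left (by positivity)
  have hκ'1 : 4 * C * L ≤ κ * κ' := by
    have := le_max_left (4 * C * L / κ) (‖B‖ / r1)
    rw [div_le_iff₀ hκ] at this
    linarith
  have hκ'2 : ‖B‖ ≤ κ' * r1 := by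
    have := le_max_right (4 * C * L / κ) (‖B‖ / r1)
    rwa [div_le_iff₀ hr1] at this
  set f : Vec k → Vec k := fun y => S.phi1 y (h y) 0 with hfdef
  set g : Vec k → Vec q := fun y => S.phi2 y (h y) 0 with hgdef
  have hh0 : h 0 = 0 := hcm.2.2.1
  have hhle : ∀ y : Vec k, ‖y‖ < r0 → ‖h y‖ ≤ ‖y‖ := fun y hy => by
    have := hLip y 0 hy (by simpa using hr0)
    simpa [hh0] using this
  -- Lipschitz bounds on the right-hand sides
  have hfg : ∀ ρ ≤ 2 * r1, ∀ y y' : Vec k, ‖y‖ ≤ ρ → ‖y'‖ ≤ ρ →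
      ‖f y - f y'‖ ≤ 2 * C * ρ * ‖y - y'‖ ∧ ‖g y - g y'‖ ≤ 2 * C * ρ * ‖y - y'‖ := by
    intro ρ hρ y y' hy hy'
    have hρ0 : 0 ≤ ρ := (norm_nonneg _).trans hy
    have hyr : ‖y‖ < r0 := by linarith
    have hyr' : ‖y'‖ < r0 := by linarith
    have h1 := hLip y y' hyr hyr'
    obtain ⟨e1, e2⟩ := hφ ρ (by linarith) y y' (h y) (h y') 0 0 hy hy'
      ((hhle y hyr).trans hy) ((hhle y' hyr').trans hy') (by simpa) (by simpa)
    have e3 : C * ρ * (‖y - y'‖ + ‖h y - h y'‖ + ‖(0 : Vec q) - 0‖) ≤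
        2 * C * ρ * ‖y - y'‖ := by
      rw [sub_self, norm_zero, add_zero]
      calc _ ≤ C * ρ * (‖y - y'‖ + 1 * ‖y - y'‖) := by gcongr
        _ = _ := by ring
    exact ⟨e1.trans e3, e2.trans e3⟩
  have hf0 : f 0 = 0 := by simp only [hfdef, hh0]; exact hS.phi_zero.1
  obtain ⟨F, Kl, hFl, hFeq, hFint⟩ := exists_cutoff (F := fun y => -f y) (ρ := 2 * r1) (R := δh)
    (by positivity) (by linarith) (hcm.contDiffOn_g1Red hS).neg
  -- comparison of the values of `h` at two nearby points
  have key : ∀ y : Vec k, 0 < ‖y‖ → ‖y‖ < r1 → ∀ᶠ y' in 𝓝 y,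
      ‖B (h y' - h y)‖ ≤ κ' * ‖y‖ * ‖y' - y‖ := by
    intro y hy0 hyr
    obtain ⟨Y, hY0, hY⟩ := hFint y
    have hYc : Continuous Y := continuous_iff_continuousAt.2 fun s => (hY s).continuousAt
    obtain ⟨T, hT, hTr, hYT⟩ := exists_reach_sphere (f := f) (Y := Y) (r := r1) (c := k6)
      (α := p + 1) hk6 (by linarith)
      (fun s hs => by have := hY s; rwa [hFeq _ (by linarith)] at this) hYc
      (fun x hx => by
        have := hball (y := x) (by rw [dist_zero_right]; linarith)
        rwa [hS.g1Red_eq] at this) (by rwa [hY0]) (by rwa [hY0])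
    rw [hY0] at hYT
    -- by Grönwall, a starting point this close to `y` stays within `‖Y‖` of `Y` up to time `T`
    have hη : 0 < ‖y‖ * Real.exp (-(Kl * T)) := by positivity
    filter_upwards [Metric.ball_mem_nhds y hη] with y' hy'
    obtain ⟨Z, hZ0, hZ⟩ := hFint y'
    have hZc : Continuous Z := continuous_iff_continuousAt.2 fun s => (hZ s).continuousAt
    have hYZ : ∀ s ∈ Icc 0 T, ‖Z s‖ ≤ 2 * ‖Y s‖ := by
      intro s hs
      have h1 := dist_le_of_trajectories_ODE (v := fun _ => F) (K := Kl) (f := Z) (g := Y) (a := 0)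
        (b := T) (fun _ => hFl) hZc.continuousOn (fun t _ => (hZ t).hasDerivWithinAt)
        hYc.continuousOn (fun t _ => (hY t).hasDerivWithinAt) (by rw [hZ0, hY0]) s hs
      have h2 : dist y' y * Real.exp (Kl * (s - 0)) ≤ ‖y‖ := by
        calc dist y' y * Real.exp (Kl * (s - 0))
            ≤ (‖y‖ * Real.exp (-(Kl * T))) * Real.exp (Kl * T) := by
              have := Metric.mem_ball.1 hy'
              gcongr
              linarith [hs.2]
          _ = ‖y‖ := by rw [mul_assoc, ← Real.exp_add]; simp
      rw [dist_eq_norm] at h1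
      have h3 := (hYT s hs).1
      have h4 := norm_le_norm_add_norm_sub' (Z s) (Y s)
      linarith
    -- the comparison function
    set D : ℝ → Vec q := fun s => h (Y s) - h (Z s) with hDdef
    set d : ℝ → Vec k := fun s => Y s - Z s with hddef
    set D' : ℝ → Vec q := fun s => -(act S.AK (D s) + (g (Y s) - g (Z s))) with hD'def
    set d' : ℝ → Vec k := fun s => -(f (Y s) - f (Z s)) with hd'def
    have hYs : ∀ s ∈ Icc 0 T, ‖Y s‖ ≤ r1 := fun s hs => (hYT s hs).2
    have hZs : ∀ s ∈ Icc 0 T, ‖Z s‖ ≤ 2 * r1 := fun s hs => by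
      linarith [hYZ s hs, hYs s hs]
    have dY : ∀ s ∈ Icc 0 T, HasDerivAt Y (-f (Y s)) s := fun s hs => by
      have := hY s; rwa [hFeq _ (by linarith [hYs s hs])] at this
    have dZ : ∀ s ∈ Icc 0 T, HasDerivAt Z (-f (Z s)) s := fun s hs => by
      have := hZ s; rwa [hFeq _ (hZs s hs)] at this
    have dh : ∀ (W : ℝ → Vec k) (s : ℝ), ‖W s‖ ≤ 2 * r1 → HasDerivAt W (-f (W s)) s →
        HasDerivAt (fun t => h (W t)) (-(act S.AK (h (W s)) + g (W s))) s := by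
      intro W s hW hd
      have hWδ : ‖W s‖ < δh := by linarith
      have := (hcm.hasFDerivAt hWδ).comp_hasDerivAt s hd
      rw [map_neg, hcm.invariance hS hWδ] at this
      exact this
    have dD : ∀ s ∈ Icc 0 T, HasDerivAt D (D' s) s := by
      intro s hs
      refine ((dh Y s (by linarith [hYs s hs]) (dY s hs)).sub
        (dh Z s (hZs s hs) (dZ s hs))).congr_deriv ?_
      simp only [hD'def, hDdef, act_map_sub]
      abel
    have dd : ∀ s ∈ Icc 0 T, HasDerivAt d (d' s) s := by
      intro s hs
      exact ((dY s hs).sub (dZ s hs)).congr_deriv (by simp only [hd'def]; abel)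
    have dG : ∀ s ∈ Icc 0 T, HasDerivAt
        (fun s => ‖B (D s)‖ ^ 2 - κ' ^ 2 * (‖Y s‖ ^ 2 * ‖d s‖ ^ 2))
        (2 * inner ℝ (B (D s)) (B (D' s)) - κ' ^ 2 *
          (2 * inner ℝ (Y s) (-f (Y s)) * ‖d s‖ ^ 2 +
            ‖Y s‖ ^ 2 * (2 * inner ℝ (d s) (d' s)))) s := by
      intro s hs
      exact ((B.hasFDerivAt.comp_hasDerivAt s (dD s hs)).norm_sq).sub
        (((dY s hs).norm_sq.mul (dd s hs).norm_sq).const_mul _)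
    have hineq := nonpos_of_deriv_ge_mul (θ := θ) hT dG ?_ ?_
    · rw [sub_nonpos, hddef, hDdef] at hineq
      simp only [hY0, hZ0] at hineq
      have h1 : ‖B (h y - h y')‖ ≤ κ' * ‖y‖ * ‖y - y'‖ := by
        refine le_of_sq_le_sq (le_of_le_of_eq hineq (by ring)) (by positivity)
      rwa [norm_sub_rev y y', ← norm_neg, ← map_neg, neg_sub] at h1
    · intro s hs
      obtain ⟨hΔf, hΔg⟩ := hfg (2 * ‖Y s‖) (by linarith [hYs s hs]) (Y s) (Z s)
        (by linarith [norm_nonneg (Y s)]) (hYZ s hs)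
      have hfY := (hfg ‖Y s‖ (by linarith [hYs s hs]) (Y s) 0 le_rfl (by simp)).1
      rw [hf0, sub_zero, sub_zero] at hfY
      exact hB.comparison_deriv_ge hq hP hQ hPQ hC.le (hYs s hs) hr1e hκ.le hκ'1
        (min_le_left _ _) (min_le_right _ _) hfY (hΔf.trans (le_of_eq (by ring)))
        (hΔg.trans (le_of_eq (by ring)))
    · have hTm : T ∈ Icc 0 T := ⟨hT, le_rfl⟩
      rw [sub_nonpos, hTr]
      have h1 : ‖B (D T)‖ ≤ κ' * r1 * ‖d T‖ := by
        calc ‖B (D T)‖ ≤ ‖B‖ * ‖D T‖ := B.le_opNorm _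
          _ ≤ ‖B‖ * (1 * ‖d T‖) := by
            gcongr
            exact hLip _ _ (by linarith [hYs T hTm]) (by linarith [hZs T hTm])
          _ ≤ _ := by rw [one_mul]; gcongr
      calc ‖B (D T)‖ ^ 2 ≤ (κ' * r1 * ‖d T‖) ^ 2 := by gcongr
        _ = _ := by ring
  have hsl : 0 < Real.sqrt l := Real.sqrt_pos.2 hl
  refine ⟨κ' / Real.sqrt l, by positivity, r1, hr1, fun y hyr => ?_⟩
  rcases (norm_nonneg y).eq_or_lt with h0 | h0
  · have : y = 0 := norm_eq_zero.1 h0.symm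
    rw [this, hcm.2.2.2.1]; simp
  · refine (hcm.hasFDerivAt (by linarith)).le_of_lip' (by positivity) ?_
    filter_upwards [key y h0 hyr] with y' hy'
    have h1 := hB.sqrt_lamMin_mul_norm_le hP (h y' - h y)
    rw [div_mul_eq_mul_div, div_mul_eq_mul_div, le_div_iff₀ hsl, mul_comm]
    exact h1.trans hy'

end Sys

/-! ### Existence of the local constants -/

namespace Sys

variable {k q m : ℕ} {S : Sys k q m} {h : Vec k → Vec q} {δh : ℝ}

theorem norm_le_pairNorm_left (y : Vec k) (w : Vec q) : ‖y‖ ≤ pairNorm y w :=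
  Real.le_sqrt_of_sq_le (by linarith [sq_nonneg ‖w‖])

theorem norm_le_pairNorm_right (y : Vec k) (w : Vec q) : ‖w‖ ≤ pairNorm y w :=
  Real.le_sqrt_of_sq_le (by linarith [sq_nonneg ‖y‖])

theorem pairNorm_le_add (y : Vec k) (w : Vec q) : pairNorm y w ≤ ‖y‖ + ‖w‖ := by
  refine Real.sqrt_le_iff.2 ⟨by positivity, ?_⟩
  nlinarith [norm_nonneg y, norm_nonneg w]

/-- Near the origin the perturbations `N₁`, `N₂` have arbitrarily small gains. -/
theorem IsCenterManifold.eventually_bound_N (hS : S.Standing) (hcm : S.IsCenterManifold δh h)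
    {σ p ε : ℝ} (hσ : 0 < σ) (hp : 1 < p) (hε : 0 < ε) :
    ∀ᶠ δ in 𝓝[>] (0 : ℝ), ∀ (y : Vec k) (w : Vec q) (ey : Vec k) (ev : Vec q),
      pairNorm y w < δ → ‖ev‖ ≤ σ * (‖w‖ + ‖y‖ ^ (p + 1)) →
        ‖S.N1 h y w ey ev‖ ≤ ε * (‖w‖ + ‖ev‖) ∧ ‖S.N2 h y w ey ev‖ ≤ ε * (‖w‖ + ‖ev‖) := by
  obtain ⟨C, hC, r, hr, hφ⟩ := hS.exists_lipschitz_phi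
  obtain ⟨r', hr', -, hD, hL⟩ := hcm.exists_lipschitz one_pos
  have hle : ∀ c : ℝ, 0 < c → ∀ᶠ δ in 𝓝[>] (0 : ℝ), δ ≤ c := fun c hc =>
    mem_of_superset (Ioc_mem_nhdsGT hc) fun x hx => hx.2
  filter_upwards [self_mem_nhdsWithin, hle 1 one_pos, hle _ (div_pos hr (by positivity :
    (0 : ℝ) < 2 + 2 * σ)), hle _ (div_pos hε (by positivity : 0 < 2 * C * (2 + 2 * σ))), hle r' hr']
    with δ hδ hδ1 hδr hδε hδr' y w ey ev hyw hev
  have hδ : 0 < δ := hδ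
  rw [le_div_iff₀ (by positivity)] at hδr hδε
  have hy : ‖y‖ < δ := (norm_le_pairNorm_left y w).trans_lt hyw
  have hw : ‖w‖ < δ := (norm_le_pairNorm_right y w).trans_lt hyw
  have hhy : ‖h y‖ ≤ ‖y‖ := by
    have := hL y 0 (hy.trans_le hδr') (by simpa using hr')
    simpa [hcm.2.2.1] using this
  have hyp : ‖y‖ ^ (p + 1) ≤ ‖y‖ := by
    have := Real.rpow_le_rpow_of_exponent_ge' (norm_nonneg y) (hy.le.trans hδ1) zero_le_one
      (by linarith : (1 : ℝ) ≤ p + 1)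
    rwa [Real.rpow_one] at this
  have hσδ : 0 < σ * δ := by positivity
  have hev' : ‖ev‖ ≤ 2 * σ * δ := by
    refine hev.trans ?_
    calc σ * (‖w‖ + ‖y‖ ^ (p + 1)) ≤ σ * (δ + δ) := by gcongr; exact hyp.trans hy.le
      _ = _ := by ring
  have hwh : ‖w + h y‖ ≤ 2 * δ := (norm_add_le _ _).trans (by linarith)
  obtain ⟨e1, e2⟩ := hφ ((2 + 2 * σ) * δ) (by linarith) y y (w + h y) (h y) ev 0
    (by linarith) (by linarith) (by linarith) (by linarith) (by linarith)
    (by rw [norm_zero]; linarith)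
  rw [sub_self, norm_zero, zero_add, add_sub_cancel_right, sub_zero] at e1 e2
  have hCε : C * ((2 + 2 * σ) * δ) ≤ ε / 2 := by linarith
  have hs : 0 ≤ ‖w‖ + ‖ev‖ := by positivity
  have e3 : C * ((2 + 2 * σ) * δ) * (‖w‖ + ‖ev‖) ≤ ε / 2 * (‖w‖ + ‖ev‖) := by gcongr
  have e1 := e1.trans e3
  have e2 := e2.trans e3
  have e4 : ε / 2 * (‖w‖ + ‖ev‖) ≤ ε * (‖w‖ + ‖ev‖) := by gcongr; linarith
  rw [hS.N1_eq, hS.N2_eq]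
  refine ⟨e1.trans e4, ?_⟩
  have e5 : ‖fderiv ℝ h y (S.phi1 y (w + h y) ev - S.phi1 y (h y) 0)‖ ≤
      1 * ‖S.phi1 y (w + h y) ev - S.phi1 y (h y) 0‖ :=
    (fderiv ℝ h y).le_of_opNorm_le (hD y (hy.trans_le hδr')) _
  have e6 := norm_sub_le (S.phi2 y (w + h y) ev - S.phi2 y (h y) 0)
    (fderiv ℝ h y (S.phi1 y (w + h y) ev - S.phi1 y (h y) 0))
  linarith

/-- Constants as in `LocalConstants` exist. The gains `k₁ = k₂` come first, then `k₈` is taken so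
large that `a₁ ≥ k₈ k₅` dominates, and finally `δ` is taken small. The last inequality is a strict
form of `LocalConstants.small_w`. -/
theorem IsCenterManifold.exists_localConstants (hS : S.Standing) (hcm : S.IsCenterManifold δh h)
    (hq : 0 < q) {P Q : Matrix (Fin q) (Fin q) ℝ} (hP : P.PosDef) (hQ : Q.PosDef)
    (hPQ : S.AK.transpose * P + P * S.AK = -Q) {p k5 k6 : ℝ} (hp : 1 < p) (hk5 : 0 < k5)
    (hk6 : 0 < k6) (hgrowth : ∀ᶠ y in 𝓝 (0 : Vec k), ‖S.g1Red h y‖ ≤ k5 * ‖y‖ ^ p)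
    (hdecay : ∀ᶠ y in 𝓝 (0 : Vec k), inner ℝ y (S.g1Red h y) ≤ -k6 * ‖y‖ ^ (p + 1))
    {sf σ : ℝ} (hsf : 0 < sf) (hσ : 0 < σ) :
    ∃ δ k1 k2 k8 sy : ℝ, S.LocalConstants δh h P Q p k5 k6 sf σ δ k1 k2 k8 sy ∧
      (S.a2 k1 k2 k8 δ + S.a3 p k1 k2 k5 δ) ^ 2 < 4 * S.a1 k1 k2 k5 k8 δ * S.a4 p k1 k2 δ ∧
      (1 + σ) * (k1 + k2 * (lamMax P / Real.sqrt (lamMin P))) <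
        sf * (lamMin Q / (2 * Real.sqrt (lamMax P))) := by
  obtain ⟨k8', hk8', r8, hr8, hDh⟩ :=
    hcm.exists_norm_fderiv_le hS hq hP hQ hPQ hp hk6 hdecay
  have hl := Real.sqrt_pos.2 (lamMin_pos hq hP)
  have hL := lamMax_pos hq hP
  have hμ := lamMin_pos hq hQ
  have hsL := Real.sqrt_pos.2 hL
  set X := sf * (lamMin Q / (2 * Real.sqrt (lamMax P))) with hX
  have hX0 : 0 < X := by positivity
  set R := lamMax P / Real.sqrt (lamMin P) with hR
  have hR0 : 0 < R := by positivity
  -- the common value of the gains `k₁` and `k₂`; it uses up half of the bound in `small_w`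
  set κ := X / 2 / ((1 + σ) * (1 + R)) with hκdef
  have hκ : 0 < κ := by positivity
  have hκX : (1 + σ) * (κ + κ * R) = X / 2 := by
    rw [hκdef]; field_simp
  set π := opNorm (P * S.B2 * S.K1) / Real.sqrt (lamMin P) with hπdef
  have hπ : 0 ≤ π := div_nonneg (opNorm_nonneg _) hl.le
  -- a bound on `a₂ + a₃` for `δ ≤ 1` and `δ κ k₈ ≤ 1`
  set M := opNorm (S.B2 * S.K11) + κ + 1 + (opNorm S.AK + κ + (p + 1) * κ + (p + 1) * k5) with hM
  set k8 := k8' + (M ^ 2 + 1) / (4 * κ * k5) with hk8def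
  have hk8 : 0 < k8 := by positivity
  have hle : ∀ c : ℝ, 0 < c → ∀ᶠ δ in 𝓝[>] (0 : ℝ), δ ≤ c := fun c hc =>
    mem_of_superset (Ioc_mem_nhdsGT hc) fun x hx => hx.2
  obtain ⟨rg, hrg, hg⟩ := Metric.eventually_nhds_iff.1 hgrowth
  obtain ⟨rd, hrd, hd⟩ := Metric.eventually_nhds_iff.1 hdecay
  have hcc : 0 < (κ + κ * R + π) * σ := by positivity
  have hpos : ∀ᶠ δ in 𝓝[>] (0 : ℝ), 0 < δ := self_mem_nhdsWithin
  obtain ⟨δ, hδ, hδ1, hδh, hδg, hδd, hδ8, hδk8, hδy, hN⟩ := (hpos.and <|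
    (hle 1 one_pos).and <| (hle δh hcm.1).and <| (hle rg hrg).and <| (hle rd hrd).and <|
    (hle r8 hr8).and <| (hle _ (div_pos one_pos (mul_pos hκ hk8))).and <|
    (hle _ (div_pos (half_pos hk6) hcc)).and
    (hcm.eventually_bound_N hS hσ hp hκ)).exists
  rw [le_div_iff₀ (by positivity)] at hδk8 hδy
  refine ⟨δ, κ, κ, k8, 1 / 2, ?_, ?_, ?_⟩
  · exact
    { pos_delta := hδ
      delta_le := hδh
      pos_k1 := hκ
      pos_k2 := hκ
      pos_k8 := hk8
      pos_sy := by norm_num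
      sy_lt_one := by norm_num
      growth := fun y hy => hg (by rw [dist_zero_right]; exact hy.trans_le hδg)
      decay := fun y hy => hd (by rw [dist_zero_right]; exact hy.trans_le hδd)
      deriv_h := fun y hy => (hDh y (hy.trans_le hδ8)).trans (by
        gcongr; rw [hk8def]; linarith [(by positivity : 0 < (M ^ 2 + 1) / (4 * κ * k5))])
      bound_N1 := fun y w ey ev h1 h2 => (hN y w ey ev h1 h2).1
      bound_N2 := fun y w ey ev h1 h2 => (hN y w ey ev h1 h2).2
      small_w := by rw [hκX]; linarith
      small_y := fun y hy => by
        have h1 : ‖y‖ ^ (p + 1) = ‖y‖ * ‖y‖ ^ p := by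
          rw [Real.rpow_add_one' (norm_nonneg y) (by linarith), mul_comm]
        rw [h1]
        calc (κ + κ * R + π) * σ * (‖y‖ * ‖y‖ ^ p)
            ≤ (κ + κ * R + π) * σ * (δ * ‖y‖ ^ p) := by gcongr
          _ = (δ * ((κ + κ * R + π) * σ)) * ‖y‖ ^ p := by ring
          _ ≤ (k6 / 2) * ‖y‖ ^ p := by gcongr
          _ = _ := by ring }
  · have hδp : δ ^ p ≤ 1 := Real.rpow_le_one hδ.le hδ1 (by linarith)
    have hδp1 : δ ^ (p - 1) ≤ 1 := Real.rpow_le_one hδ.le hδ1 (by linarith)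
    have hδp0 : 0 ≤ δ ^ p := by positivity
    have hAK := opNorm_nonneg S.AK
    have hBK := opNorm_nonneg (S.B2 * S.K11)
    have i1 : S.a2 κ κ k8 δ ≤ opNorm (S.B2 * S.K11) + κ + 1 := by
      rw [a2]; linarith
    have i2 : S.a3 p κ κ k5 δ ≤ opNorm S.AK + κ + (p + 1) * κ + (p + 1) * k5 := by
      have j1 : (p + 1) * δ ^ p * κ ≤ (p + 1) * 1 * κ := by gcongr
      have j2 : (p + 1) * δ ^ (p - 1) * k5 ≤ (p + 1) * 1 * k5 := by gcongr
      have j3 : 0 ≤ (p + 1) * κ := by positivity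
      have j4 : 0 ≤ (p + 1) * k5 := by positivity
      rw [a3]
      exact max_le (by linarith) (by linarith)
    have i3 : 0 ≤ S.a2 κ κ k8 δ := by rw [a2]; positivity
    have i4 : 0 ≤ S.a3 p κ κ k5 δ := by
      rw [a3]; exact le_max_of_le_right (by positivity)
    have i5 : κ ≤ S.a4 p κ κ δ := by
      rw [a4]
      have : 0 ≤ (p + 1) * δ ^ p * κ := by positivity
      linarith
    have i6 : k8 * k5 ≤ S.a1 κ κ k5 k8 δ := le_max_right _ _
    have i7 : 0 ≤ S.a1 κ κ k5 k8 δ := le_trans (by positivity) i6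
    calc (S.a2 κ κ k8 δ + S.a3 p κ κ k5 δ) ^ 2 ≤ M ^ 2 := by gcongr; rw [hM]; linarith
      _ < 4 * (((M ^ 2 + 1) / (4 * κ * k5)) * k5) * κ := by
        have : 4 * (((M ^ 2 + 1) / (4 * κ * k5)) * k5) * κ = M ^ 2 + 1 := by field_simp
        linarith
      _ ≤ 4 * (k8 * k5) * κ := by
        gcongr; rw [hk8def]; linarith
      _ ≤ _ := by gcongr
  · rw [hκX]; linarith

end Sys

/-! ### Differential inequalities along the closed loop -/

theorem exists_hasDerivWithinAt_norm {F : Type*} [NormedAddCommGroup F] [InnerProductSpace ℝ F]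
    {f : ℝ → F} {f' : F} {s : ℝ} (hf : HasDerivWithinAt f f' (Ici s) s) :
    ∃ D, HasDerivWithinAt (fun t => ‖f t‖) D (Ici s) s ∧ |D| ≤ ‖f'‖ := by
  classical
  refine ⟨_, hasDerivWithinAt_norm_right hf, ?_⟩
  split_ifs with h0
  · rw [abs_norm]
  · have hpos : 0 < ‖f s‖ := norm_pos_iff.2 h0
    rw [abs_div, abs_norm, div_le_iff₀ hpos, mul_comm]
    exact abs_real_inner_le_norm _ _

theorem arctanTime_pos {a1 a a4 σ : ℝ} (hdisc : a ^ 2 < 4 * a1 * a4) (ha4 : 0 < a4)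
    (hσ : 0 < σ) : 0 < arctanTime a1 a a4 σ := by
  have hb : 0 < Real.sqrt (4 * a1 * a4 - a ^ 2) := Real.sqrt_pos.2 (by linarith)
  refine mul_pos (by positivity) (sub_pos.2 (Real.arctan_strictMono ?_))
  gcongr
  linarith [mul_pos ha4 hσ]

/-- A function with `φ(a) = 0` and `φ' ≤ a₁ + A φ + a₄ φ²` needs at least `arctanTime` to reach
the value `σ`. -/
theorem arctanTime_le {φ φ' : ℝ → ℝ} {a b a1 A a4 σ : ℝ} (hab : a ≤ b)
    (hdisc : A ^ 2 < 4 * a1 * a4) (ha4 : 0 < a4) (hc : ContinuousOn φ (Icc a b))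
    (hφ : ∀ s ∈ Ico a b, HasDerivWithinAt φ (φ' s) (Ici s) s)
    (hle : ∀ s ∈ Ico a b, φ' s ≤ a1 + A * φ s + a4 * φ s ^ 2) (h0 : φ a = 0) (h1 : σ ≤ φ b) :
    arctanTime a1 A a4 σ ≤ b - a := by
  have hb2 : 0 < 4 * a1 * a4 - A ^ 2 := by linarith
  have hb : 0 < Real.sqrt (4 * a1 * a4 - A ^ 2) := Real.sqrt_pos.2 hb2
  have hsq := Real.sq_sqrt hb2.le
  unfold arctanTime
  set β := Real.sqrt (4 * a1 * a4 - A ^ 2) with hβ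
  -- the quadratic polynomial has no real zero, so `φ'` may be divided by it
  have hpos : ∀ x : ℝ, 0 < a1 + A * x + a4 * x ^ 2 := by
    intro x
    have : 0 < 4 * a4 * (a1 + A * x + a4 * x ^ 2) := by
      have : 4 * a4 * (a1 + A * x + a4 * x ^ 2) = β ^ 2 + (2 * a4 * x + A) ^ 2 := by
        rw [hsq]; ring
      rw [this]; positivity
    exact pos_of_mul_pos_right this (by positivity)
  have hcmp := image_le_of_deriv_right_le_deriv_boundary
    (f := fun s => 2 / β * (Real.arctan ((2 * a4 * φ s + A) / β) - Real.arctan (A / β)))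
    (f' := fun s => φ' s / (a1 + A * φ s + a4 * φ s ^ 2)) (B := fun s => s - a)
    (B' := fun _ => 1) (a := a) (b := b) ?_ ?_ ?_ ?_ ?_ ?_ (right_mem_Icc.2 hab)
  · refine le_trans ?_ hcmp
    gcongr
  · exact continuousOn_const.mul ((Real.continuous_arctan.comp_continuousOn
      (((continuousOn_const.mul hc).add continuousOn_const).div_const _)).sub continuousOn_const)
  · intro s hs
    have hd : HasDerivWithinAt (fun t => (2 * a4 * φ t + A) / β) (2 * a4 * φ' s / β) (Ici s) s :=
      (((hφ s hs).const_mul _).add_const _).div_const _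
    have h2 := ((hd.arctan).sub_const (Real.arctan (A / β))).const_mul (2 / β)
    refine h2.congr_deriv ?_
    have h3 : 1 + ((2 * a4 * φ s + A) / β) ^ 2 =
        4 * a4 * (a1 + A * φ s + a4 * φ s ^ 2) / β ^ 2 := by
      field_simp
      rw [hsq]; ring
    rw [h3]
    have := (hpos (φ s)).ne'
    field_simp
    norm_num
  · simp [h0]
  · fun_prop
  · exact fun s _ => ((hasDerivAt_id s).sub_const a).hasDerivWithinAt
  · exact fun s hs => (div_le_one (hpos _)).2 (hle s hs)

theorem lyap_nonneg {k q : ℕ} (P : Matrix (Fin q) (Fin q) ℝ) (y : Vec k) (w : Vec q) :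
    0 ≤ lyap P y w :=
  add_nonneg (norm_nonneg _) (Real.sqrt_nonneg _)

namespace Sys

variable {k q m : ℕ} {S : Sys k q m} {h : Vec k → Vec q} {δh : ℝ}
  {P Q : Matrix (Fin q) (Fin q) ℝ} {p k5 k6 sf σ δ k1 k2 k8 sy : ℝ}

/-- The hypotheses under which the event-triggered closed loop is analysed. -/
structure Setup (S : Sys k q m) (δh : ℝ) (h : Vec k → Vec q) (P Q : Matrix (Fin q) (Fin q) ℝ)
    (p k5 k6 sf σ δ k1 k2 k8 sy : ℝ) : Prop where
  standing : S.Standing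
  manifold : S.IsCenterManifold δh h
  dim_pos : 0 < q
  posDef_P : P.PosDef
  posDef_Q : Q.PosDef
  lyapunov : S.AK.transpose * P + P * S.AK = -Q
  one_lt_p : 1 < p
  pos_k5 : 0 < k5
  pos_k6 : 0 < k6
  pos_sigma : 0 < σ
  sigma_le : σ * (2 * opNorm (P * S.B2 * S.K1) * Real.sqrt (lamMax P)) ≤
    (1 - sf) * lamMin Q * Real.sqrt (lamMin P)
  const : S.LocalConstants δh h P Q p k5 k6 sf σ δ k1 k2 k8 sy

/-- The decay rate in `‖w‖` of the Lyapunov function; it is positive when the inequality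
`LocalConstants.small_w` is strict. -/
def gap (P Q : Matrix (Fin q) (Fin q) ℝ) (sf σ k1 k2 : ℝ) : ℝ :=
  sf * (lamMin Q / (2 * Real.sqrt (lamMax P))) -
    (1 + σ) * (k1 + k2 * (lamMax P / Real.sqrt (lamMin P)))

/-- The level of the Lyapunov function below which `‖(y; w)‖ < δ`. -/
def level (P : Matrix (Fin q) (Fin q) ℝ) (δ : ℝ) : ℝ := min 1 (Real.sqrt (lamMin P)) * δ

namespace Setup

variable (H : S.Setup δh h P Q p k5 k6 sf σ δ k1 k2 k8 sy)
include H

theorem sqrt_lamMin_pos : 0 < Real.sqrt (lamMin P) :=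
  Real.sqrt_pos.2 (lamMin_pos H.dim_pos H.posDef_P)

theorem min_pos : 0 < min 1 (Real.sqrt (lamMin P)) := lt_min one_pos H.sqrt_lamMin_pos

theorem min_mul_le_lyap (y : Vec k) (w : Vec q) :
    min 1 (Real.sqrt (lamMin P)) * (‖y‖ + ‖w‖) ≤ lyap P y w := by
  obtain ⟨B, hB⟩ : ∃ B, IsFactor P B := exists_factor H.posDef_P
  rw [hB.lyap_eq, mul_add]
  have h1 := hB.sqrt_lamMin_mul_norm_le H.posDef_P w
  have h2 : min 1 (Real.sqrt (lamMin P)) * ‖y‖ ≤ 1 * ‖y‖ := by gcongr; exact min_le_left _ _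
  have h3 : min 1 (Real.sqrt (lamMin P)) * ‖w‖ ≤ Real.sqrt (lamMin P) * ‖w‖ := by
    gcongr; exact min_le_right _ _
  linarith

theorem min_mul_pairNorm_le_lyap (y : Vec k) (w : Vec q) :
    min 1 (Real.sqrt (lamMin P)) * pairNorm y w ≤ lyap P y w :=
  (mul_le_mul_of_nonneg_left (pairNorm_le_add y w) H.min_pos.le).trans (H.min_mul_le_lyap y w)

theorem pairNorm_lt {y : Vec k} {w : Vec q} (hV : lyap P y w < level P δ) : pairNorm y w < δ :=
  lt_of_mul_lt_mul_left ((H.min_mul_pairNorm_le_lyap y w).trans_lt hV) H.min_pos.le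

theorem norm_lt {y : Vec k} {w : Vec q} (hV : lyap P y w < level P δ) : ‖y‖ < δ :=
  (norm_le_pairNorm_left y w).trans_lt (H.pairNorm_lt hV)

theorem lyap_eq_zero_iff {y : Vec k} {w : Vec q} : lyap P y w = 0 ↔ y = 0 ∧ w = 0 := by
  constructor
  · intro h0
    have h1 := H.min_mul_le_lyap y w
    rw [h0] at h1
    have h2 := nonpos_of_mul_nonpos_right h1 H.min_pos
    have h3 := norm_nonneg y
    have h4 := norm_nonneg w
    exact ⟨norm_eq_zero.1 (by linarith), norm_eq_zero.1 (by linarith)⟩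
  · rintro ⟨rfl, rfl⟩
    simp [lyap]

theorem a4_pos : 0 < S.a4 p k1 k2 δ := by
  have hp := H.one_lt_p
  have hδ := H.const.pos_delta
  have hk2 := H.const.pos_k2
  have hk1 := H.const.pos_k1
  have := opNorm_nonneg (S.B2 * S.K11)
  rw [a4]
  positivity

theorem gap_nonneg : 0 ≤ gap P Q sf σ k1 k2 := sub_nonneg.2 H.const.small_w

/-- The Lyapunov function decreases while the measurement error respects the event threshold. The
reference state `(yr, zr)` is the one at which the input was last updated. -/
theorem exists_hasDerivWithinAt_lyap {y : ℝ → Vec k} {z : ℝ → Vec q} {yr : Vec k} {zr : Vec q}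
    {s : ℝ} (hV : lyap P (y s) (S.wOf h (y s) (z s)) < level P δ)
    (he : ‖S.vOf yr zr - S.vOf (y s) (z s)‖ ≤
      σ * (‖S.wOf h (y s) (z s)‖ + ‖y s‖ ^ (p + 1)))
    (hy : HasDerivWithinAt y (S.yDot (y s) (z s) (S.K yr zr)) (Ici s) s)
    (hz : HasDerivWithinAt z (S.zDot (y s) (z s) (S.K yr zr)) (Ici s) s) :
    ∃ D, HasDerivWithinAt (fun t => lyap P (y t) (S.wOf h (y t) (z t))) D (Ici s) s ∧
      D ≤ -(k6 * (1 - sy) * ‖y s‖ ^ p + gap P Q sf σ k1 k2 * ‖S.wOf h (y s) (z s)‖) := by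
  obtain ⟨B, hB⟩ : ∃ B, IsFactor P B := exists_factor H.posDef_P
  have C := H.const
  have hys := H.norm_lt hV
  have hpair := H.pairNorm_lt hV
  obtain ⟨dy, dw⟩ := H.standing.hasDerivWithinAt_wOf H.manifold (hys.trans_le C.delta_le) hy hz
  have hN1 := C.bound_N1 (y s) (S.wOf h (y s) (z s)) (yr - y s) _ hpair he
  have hN2 := C.bound_N2 (y s) (S.wOf h (y s) (z s)) (yr - y s) _ hpair he
  have hsmall := C.small_y (y s) hys
  have hdecay := C.decay (y s) hys
  have hgrowth := C.growth (y s) hys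
  set e := S.vOf yr zr - S.vOf (y s) (z s)
  set n1 := S.N1 h (y s) (S.wOf h (y s) (z s)) (yr - y s) e
  set n2 := S.N2 h (y s) (S.wOf h (y s) (z s)) (yr - y s) e
  set w := S.wOf h (y s) (z s) with hw
  obtain ⟨Dw, hDw, hDwle⟩ := hB.hasDerivWithinAt_norm_le H.dim_pos H.posDef_P H.posDef_Q
    H.lyapunov (w := fun t => S.wOf h (y t) (z t)) dw
  have hDy := hasDerivWithinAt_norm_right dy
  refine ⟨_, (hDy.add hDw).congr (fun t _ => hB.lyap_eq _ _) (hB.lyap_eq _ _), ?_⟩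
  have hl := H.sqrt_lamMin_pos
  have hL := lamMax_pos H.dim_pos H.posDef_P
  have hsL := Real.sqrt_pos.2 hL
  have hp := H.one_lt_p
  -- the `y`-part
  have hyle : (if y s = 0 then ‖S.g1Red h (y s) + n1‖ else
      inner ℝ (y s) (S.g1Red h (y s) + n1) / ‖y s‖) ≤ -(k6 * ‖y s‖ ^ p) + k1 * (‖w‖ + ‖e‖) := by
    split_ifs with h0
    · rw [h0, norm_zero, Real.zero_rpow (by linarith), mul_zero] at hgrowth
      have h1 : S.g1Red h 0 = 0 := norm_le_zero_iff.1 hgrowth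
      rw [h0, h1, zero_add, norm_zero, Real.zero_rpow (by linarith), mul_zero, neg_zero, zero_add]
      exact hN1
    · have hpos : 0 < ‖y s‖ := norm_pos_iff.2 h0
      rw [div_le_iff₀ hpos, inner_add_right]
      have h1 := real_inner_le_norm (y s) n1
      have h2 : ‖y s‖ * ‖n1‖ ≤ ‖y s‖ * (k1 * (‖w‖ + ‖e‖)) := by gcongr
      rw [Real.rpow_add_one hpos.ne'] at hdecay
      linarith
  -- the `w`-part
  have hwle : ‖act P (act (S.B2 * S.K11) e + n2)‖ ≤
      opNorm (P * S.B2 * S.K1) * ‖e‖ + lamMax P * (k2 * (‖w‖ + ‖e‖)) := by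
    rw [act_map_add]
    refine (norm_add_le _ _).trans (add_le_add ?_ ?_)
    · have := norm_act_act_le_opNorm_mul_fromCols (P * S.B2) (S.K12 + S.K11 * S.E) S.K11 e
      rwa [mul_act P, ← mul_act S.B2] at this
    · exact (hB.norm_act_le_lamMax H.dim_pos H.posDef_P n2).trans (by gcongr)
  have hwle' := div_le_div_of_nonneg_right hwle hl.le
  have hσ' : σ * (opNorm (P * S.B2 * S.K1) / Real.sqrt (lamMin P)) ≤
      (1 - sf) * (lamMin Q / (2 * Real.sqrt (lamMax P))) := by
    have := H.sigma_le
    rw [← mul_div_assoc, ← mul_div_assoc, div_le_div_iff₀ hl (by positivity)]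
    linarith
  have hgap : gap P Q sf σ k1 k2 = sf * (lamMin Q / (2 * Real.sqrt (lamMax P))) -
    (1 + σ) * (k1 + k2 * (lamMax P / Real.sqrt (lamMin P))) := rfl
  rw [hgap]
  set X := lamMin Q / (2 * Real.sqrt (lamMax P))
  set R := lamMax P / Real.sqrt (lamMin P) with hR
  set ϖ := opNorm (P * S.B2 * S.K1) / Real.sqrt (lamMin P) with hϖ
  have hπ0 : 0 ≤ ϖ := div_nonneg (opNorm_nonneg _) hl.le
  have hR0 : 0 ≤ R := by positivity
  have hsplit : (opNorm (P * S.B2 * S.K1) * ‖e‖ + lamMax P * (k2 * (‖w‖ + ‖e‖))) /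
      Real.sqrt (lamMin P) = ϖ * ‖e‖ + k2 * R * (‖w‖ + ‖e‖) := by
    rw [hϖ, hR]; field_simp
  rw [hsplit] at hwle'
  have hk := C.pos_k1
  have hk2 := C.pos_k2
  have hcoef : 0 ≤ k1 + k2 * R + ϖ := by positivity
  have herr := mul_le_mul_of_nonneg_left he hcoef
  have hσw := mul_le_mul_of_nonneg_right hσ' (norm_nonneg w)
  refine (add_le_add hyle (hDwle.trans (add_le_add_right hwle' _))).trans ?_
  linarith

/-- The ratio `‖e_v‖ / (‖w‖ + ‖y‖ᵖ⁺¹)` satisfies a Riccati differential inequality: the numerator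
`e` and the denominator `n` satisfy `e' ≤ a₁ n + a₂ e` and `n' ≥ -(a₃ n + a₄ e)`. -/
theorem exists_hasDerivWithinAt_ratio {y : ℝ → Vec k} {z : ℝ → Vec q} {yr : Vec k} {zr : Vec q}
    {s : ℝ} (hV : lyap P (y s) (S.wOf h (y s) (z s)) < level P δ)
    (he : ‖S.vOf yr zr - S.vOf (y s) (z s)‖ ≤
      σ * (‖S.wOf h (y s) (z s)‖ + ‖y s‖ ^ (p + 1)))
    (hpos : 0 < ‖S.wOf h (y s) (z s)‖ + ‖y s‖ ^ (p + 1))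
    (hy : HasDerivWithinAt y (S.yDot (y s) (z s) (S.K yr zr)) (Ici s) s)
    (hz : HasDerivWithinAt z (S.zDot (y s) (z s) (S.K yr zr)) (Ici s) s) :
    ∃ D, HasDerivWithinAt (fun t => ‖S.vOf yr zr - S.vOf (y t) (z t)‖ /
        (‖S.wOf h (y t) (z t)‖ + ‖y t‖ ^ (p + 1))) D (Ici s) s ∧
      D ≤ S.a1 k1 k2 k5 k8 δ + (S.a2 k1 k2 k8 δ + S.a3 p k1 k2 k5 δ) *
          (‖S.vOf yr zr - S.vOf (y s) (z s)‖ / (‖S.wOf h (y s) (z s)‖ + ‖y s‖ ^ (p + 1))) +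
        S.a4 p k1 k2 δ *
          (‖S.vOf yr zr - S.vOf (y s) (z s)‖ /
            (‖S.wOf h (y s) (z s)‖ + ‖y s‖ ^ (p + 1))) ^ 2 := by
  have C := H.const
  have hys := H.norm_lt hV
  have hpair := H.pairNorm_lt hV
  have hp := H.one_lt_p
  obtain ⟨dy, dw⟩ := H.standing.hasDerivWithinAt_wOf H.manifold (hys.trans_le C.delta_le) hy hz
  have dh := (H.manifold.hasFDerivAt (hys.trans_le C.delta_le)).comp_hasDerivWithinAt s dy
  have dv : HasDerivWithinAt (fun t => S.vOf yr zr - S.vOf (y t) (z t)) _ (Ici s) s :=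
    ((dw.add dh).congr_of_mem (fun t _ => by simp [wOf]) self_mem_Ici).const_sub (S.vOf yr zr)
  have hN1 := C.bound_N1 (y s) (S.wOf h (y s) (z s)) (yr - y s) _ hpair he
  have hN2 := C.bound_N2 (y s) (S.wOf h (y s) (z s)) (yr - y s) _ hpair he
  have hgrowth := C.growth (y s) hys
  have hderiv := C.deriv_h (y s) hys
  obtain ⟨De, hDe, hDele⟩ := exists_hasDerivWithinAt_norm dv
  obtain ⟨Dw, hDw, hDwle⟩ := exists_hasDerivWithinAt_norm dw
  obtain ⟨Dy, hDy, hDyle⟩ := exists_hasDerivWithinAt_norm dy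
  have hDyp := hDy.rpow_const (p := p + 1) (Or.inr (by linarith))
  have hD := hDe.div (hDw.add hDyp) hpos.ne'
  refine ⟨_, hD, ?_⟩
  rw [norm_neg] at hDele
  set e := S.vOf yr zr - S.vOf (y s) (z s)
  set n1 := S.N1 h (y s) (S.wOf h (y s) (z s)) (yr - y s) e
  set n2 := S.N2 h (y s) (S.wOf h (y s) (z s)) (yr - y s) e
  set w := S.wOf h (y s) (z s) with hw
  set Y := ‖y s‖ with hYdef
  have hY0 : 0 ≤ Y := norm_nonneg _
  have hk1 := C.pos_k1
  have hk2 := C.pos_k2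
  have hk8 := C.pos_k8
  have hk5 := H.pos_k5
  have hδ := C.pos_delta
  have hnw := norm_nonneg w
  have hne := norm_nonneg e
  have hYp : Y ^ (p + 1) = Y ^ p * Y := Real.rpow_add_one' hY0 (by linarith)
  have hYp0 : 0 ≤ Y ^ (p + 1) := by positivity
  have hydot : ‖S.g1Red h (y s) + n1‖ ≤ k5 * Y ^ p + k1 * (‖w‖ + ‖e‖) :=
    (norm_add_le _ _).trans (add_le_add hgrowth hN1)
  have hwdot : ‖act S.AK w + (act (S.B2 * S.K11) e + n2)‖ ≤
      opNorm S.AK * ‖w‖ + (opNorm (S.B2 * S.K11) * ‖e‖ + k2 * (‖w‖ + ‖e‖)) :=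
    norm_add_le_of_le (norm_act_le _ _) (norm_add_le_of_le (norm_act_le _ _) hN2)
  have hvdot : De ≤ S.a1 k1 k2 k5 k8 δ * (‖w‖ + Y ^ (p + 1)) + S.a2 k1 k2 k8 δ * ‖e‖ := by
    have h1 : ‖fderiv ℝ h (y s) (S.g1Red h (y s) + n1)‖ ≤
        k8 * Y * (k5 * Y ^ p + k1 * (‖w‖ + ‖e‖)) :=
      ((fderiv ℝ h (y s)).le_of_opNorm_le hderiv _).trans (by gcongr)
    have h2 : k8 * Y * (k5 * Y ^ p + k1 * (‖w‖ + ‖e‖)) ≤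
        k8 * k5 * Y ^ (p + 1) + k8 * k1 * δ * (‖w‖ + ‖e‖) := by
      have : k8 * k1 * Y * (‖w‖ + ‖e‖) ≤ k8 * k1 * δ * (‖w‖ + ‖e‖) := by gcongr
      rw [hYp]; linarith
    have h3 : (opNorm S.AK + k2 + k8 * k1 * δ) * ‖w‖ ≤ S.a1 k1 k2 k5 k8 δ * ‖w‖ := by
      gcongr; exact le_max_left _ _
    have h4 : k8 * k5 * Y ^ (p + 1) ≤ S.a1 k1 k2 k5 k8 δ * Y ^ (p + 1) := by
      gcongr; exact le_max_right _ _
    have h5 := (le_abs_self De).trans (hDele.trans (norm_add_le_of_le hwdot h1))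
    rw [a2]
    linarith
  have hndot : -(S.a3 p k1 k2 k5 δ * (‖w‖ + Y ^ (p + 1)) + S.a4 p k1 k2 δ * ‖e‖) ≤
      Dw + Dy * (p + 1) * Y ^ (p + 1 - 1) := by
    rw [add_sub_cancel_right]
    have h1 := (neg_abs_le Dw).trans' (neg_le_neg (hDwle.trans hwdot))
    have h2 := (neg_abs_le Dy).trans' (neg_le_neg (hDyle.trans hydot))
    have hYpp : 0 ≤ Y ^ p := by positivity
    have h3 : -(k5 * Y ^ p + k1 * (‖w‖ + ‖e‖)) * ((p + 1) * Y ^ p) ≤ Dy * ((p + 1) * Y ^ p) := by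
      gcongr
    have h4 : Y ^ p * Y ^ p ≤ δ ^ (p - 1) * Y ^ (p + 1) := by
      have h5 : Y ^ p = Y ^ (p - 1) * Y := by
        rw [← Real.rpow_add_one' hY0 (by linarith)]; congr 1; ring
      calc Y ^ p * Y ^ p = Y ^ (p - 1) * (Y ^ p * Y) := by rw [h5]; ring
        _ ≤ δ ^ (p - 1) * (Y ^ p * Y) := by
          gcongr ?_ * _
          exact Real.rpow_le_rpow hY0 hys.le (by linarith)
        _ = _ := by rw [hYp]
    have h5 : (p + 1) * k5 * (Y ^ p * Y ^ p) ≤ (p + 1) * k5 * (δ ^ (p - 1) * Y ^ (p + 1)) := by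
      gcongr
    have h6 : (p + 1) * Y ^ p * k1 * (‖w‖ + ‖e‖) ≤ (p + 1) * δ ^ p * k1 * (‖w‖ + ‖e‖) := by
      gcongr
    have h7 : (opNorm S.AK + k2 + (p + 1) * δ ^ p * k1) * ‖w‖ ≤ S.a3 p k1 k2 k5 δ * ‖w‖ := by
      gcongr; exact le_max_left _ _
    have h8 : (p + 1) * δ ^ (p - 1) * k5 * Y ^ (p + 1) ≤ S.a3 p k1 k2 k5 δ * Y ^ (p + 1) := by
      gcongr; exact le_max_right _ _
    rw [a4]
    linarith
  simp only [Pi.add_apply]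
  set n := ‖w‖ + Y ^ (p + 1)
  have i1 : De * n ≤ (S.a1 k1 k2 k5 k8 δ * n + S.a2 k1 k2 k8 δ * ‖e‖) * n := by gcongr
  have i2 := mul_le_mul_of_nonneg_left hndot hne
  rw [div_le_iff₀ (by positivity)]
  have i3 : (S.a1 k1 k2 k5 k8 δ + (S.a2 k1 k2 k8 δ + S.a3 p k1 k2 k5 δ) * (‖e‖ / n) +
      S.a4 p k1 k2 δ * (‖e‖ / n) ^ 2) * n ^ 2 = S.a1 k1 k2 k5 k8 δ * n ^ 2 +
      (S.a2 k1 k2 k8 δ + S.a3 p k1 k2 k5 δ) * ‖e‖ * n + S.a4 p k1 k2 δ * ‖e‖ ^ 2 := by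
    field_simp
  rw [i3]
  linarith

end Setup
end Sys

/-! ### Trajectories between two events -/

namespace Sys

variable {k q m : ℕ} {S : Sys k q m} {h : Vec k → Vec q} {δh : ℝ}
  {P Q : Matrix (Fin q) (Fin q) ℝ} {p k5 k6 sf σ δ k1 k2 k8 sy : ℝ}

/-- A piece `[a, b]` of a trajectory without events in its interior, along which the input is held
at `K(y(a); z(a))`. The differential equations are only required as long as the Lyapunov function is
below its critical level, so that solutions of a plant that is modified far from the origin
qualify. -/
structure IsHeld (S : Sys k q m) (h : Vec k → Vec q) (P : Matrix (Fin q) (Fin q) ℝ) (σ p δ : ℝ)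
    (y : ℝ → Vec k) (z : ℝ → Vec q) (a b : ℝ) : Prop where
  le : a ≤ b
  cont_y : ContinuousOn y (Icc a b)
  cont_z : ContinuousOn z (Icc a b)
  deriv : ∀ s ∈ Ico a b, lyap P (y s) (S.wOf h (y s) (z s)) < level P δ →
    HasDerivWithinAt y (S.yDot (y s) (z s) (S.K (y a) (z a))) (Ici s) s ∧
    HasDerivWithinAt z (S.zDot (y s) (z s) (S.K (y a) (z a))) (Ici s) s
  no_trigger : ∀ s ∈ Ioo a b, ¬ S.Trigger h σ p y z a s

theorem vOf_eq_wOf_add (y : Vec k) (z : Vec q) : S.vOf y z = S.wOf h y z + h y := by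
  simp [wOf]

theorem continuous_vOf : Continuous fun x : Vec k × Vec q => S.vOf x.1 x.2 :=
  continuous_snd.sub ((continuous_act S.E).comp continuous_fst)

theorem IsCenterManifold.continuousAt_wOf (hcm : S.IsCenterManifold δh h) {x : Vec k × Vec q}
    (hx : ‖x.1‖ < δh) : ContinuousAt (fun x : Vec k × Vec q => S.wOf h x.1 x.2) x :=
  continuous_vOf.continuousAt.sub
    (ContinuousAt.comp (f := Prod.fst) (hcm.hasFDerivAt hx).continuousAt
      continuous_fst.continuousAt)

theorem continuous_lyap (P : Matrix (Fin q) (Fin q) ℝ) :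
    Continuous fun x : Vec k × Vec q => lyap P x.1 x.2 :=
  continuous_fst.norm.add
    (Real.continuous_sqrt.comp (continuous_snd.inner ((continuous_act P).comp continuous_snd)))

theorem IsCenterManifold.continuousAt_lyap (hcm : S.IsCenterManifold δh h)
    (P : Matrix (Fin q) (Fin q) ℝ) {x : Vec k × Vec q} (hx : ‖x.1‖ < δh) :
    ContinuousAt (fun x : Vec k × Vec q => lyap P x.1 (S.wOf h x.1 x.2)) x :=
  ContinuousAt.comp (g := fun x : Vec k × Vec q => lyap P x.1 x.2)
    (f := fun x : Vec k × Vec q => (x.1, S.wOf h x.1 x.2)) (continuous_lyap P).continuousAt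
    (continuousAt_fst.prodMk (hcm.continuousAt_wOf hx))

theorem Setup.isOpen_region (H : S.Setup δh h P Q p k5 k6 sf σ δ k1 k2 k8 sy) :
    IsOpen {x : Vec k × Vec q | lyap P x.1 (S.wOf h x.1 x.2) < level P δ} := by
  rw [isOpen_iff_mem_nhds]
  intro x hx
  exact (H.manifold.continuousAt_lyap P
    ((H.norm_lt hx).trans_le H.const.delta_le)).eventually_lt continuousAt_const hx

namespace IsHeld

variable {y : ℝ → Vec k} {z : ℝ → Vec q} {a b : ℝ}

theorem mono_right (hh : S.IsHeld h P σ p δ y z a b) {c : ℝ} (hac : a ≤ c) (hcb : c ≤ b) :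
    S.IsHeld h P σ p δ y z a c where
  le := hac
  cont_y := hh.cont_y.mono (Icc_subset_Icc_right hcb)
  cont_z := hh.cont_z.mono (Icc_subset_Icc_right hcb)
  deriv := fun s hs => hh.deriv s ⟨hs.1, hs.2.trans_le hcb⟩
  no_trigger := fun s hs => hh.no_trigger s ⟨hs.1, hs.2.trans_le hcb⟩

theorem continuousOn_pair (hh : S.IsHeld h P σ p δ y z a b) :
    ContinuousOn (fun s => (y s, z s)) (Icc a b) := hh.cont_y.prodMk hh.cont_z

theorem continuousOn_vOf (hh : S.IsHeld h P σ p δ y z a b) :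
    ContinuousOn (fun s => S.vOf (y s) (z s)) (Icc a b) :=
  continuous_vOf.comp_continuousOn hh.continuousOn_pair

theorem continuousOn_wOf (hh : S.IsHeld h P σ p δ y z a b) (hcm : S.IsCenterManifold δh h)
    (hy : ∀ s ∈ Icc a b, ‖y s‖ < δh) :
    ContinuousOn (fun s => S.wOf h (y s) (z s)) (Icc a b) := fun s hs =>
  ContinuousAt.comp_continuousWithinAt (g := fun x : Vec k × Vec q => S.wOf h x.1 x.2)
    (f := fun s => (y s, z s)) (hcm.continuousAt_wOf (hy s hs)) (hh.continuousOn_pair s hs)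

theorem continuousOn_lyap (hh : S.IsHeld h P σ p δ y z a b) (hcm : S.IsCenterManifold δh h)
    (hy : ∀ s ∈ Icc a b, ‖y s‖ < δh) :
    ContinuousOn (fun s => lyap P (y s) (S.wOf h (y s) (z s))) (Icc a b) :=
  Continuous.comp_continuousOn (g := fun x : Vec k × Vec q => lyap P x.1 x.2)
    (f := fun s => (y s, S.wOf h (y s) (z s))) (continuous_lyap P)
    (hh.cont_y.prodMk (hh.continuousOn_wOf hcm hy))

theorem continuousOn_threshold (hh : S.IsHeld h P σ p δ y z a b) (hcm : S.IsCenterManifold δh h)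
    (hp : 1 < p) (hy : ∀ s ∈ Icc a b, ‖y s‖ < δh) :
    ContinuousOn (fun s => ‖S.wOf h (y s) (z s)‖ + ‖y s‖ ^ (p + 1)) (Icc a b) :=
  (hh.continuousOn_wOf hcm hy).norm.add
    (hh.cont_y.norm.rpow_const fun _ _ => Or.inr (by linarith))

/-- If a trajectory reaches the origin without an event, the held input is already zero. -/
theorem vOf_eq_zero (hh : S.IsHeld h P σ p δ y z a b) (hcm : S.IsCenterManifold δh h)
    (hp : 1 < p) (hy : ∀ s ∈ Icc a b, ‖y s‖ < δh) {s : ℝ} (hs : s ∈ Icc a b) (hy0 : y s = 0)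
    (hw0 : S.wOf h (y s) (z s) = 0) : S.vOf (y a) (z a) = 0 := by
  by_contra hva
  have hclosed : IsClosed (Icc a b ∩ (fun s => (y s, S.wOf h (y s) (z s))) ⁻¹' {0}) :=
    (hh.cont_y.prodMk (hh.continuousOn_wOf hcm hy)).preimage_isClosed_of_isClosed isClosed_Icc
      isClosed_singleton
  have hcomp := isCompact_Icc.of_isClosed_subset hclosed inter_subset_left
  obtain ⟨c, ⟨hc, hc0⟩, hleast⟩ := hcomp.exists_isLeast ⟨s, hs, by simp [hy0]; rwa [hy0] at hw0⟩
  have hzero : ∀ t, y t = 0 → S.wOf h (y t) (z t) = 0 → S.vOf (y t) (z t) = 0 := by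
    intro t h1 h2
    rw [vOf_eq_wOf_add (h := h), h2, h1, hcm.2.2.1, add_zero]
  have hc1 : y c = 0 := congrArg Prod.fst hc0
  have hc2 : S.wOf h (y c) (z c) = 0 := congrArg Prod.snd hc0
  have hac : a < c := by
    refine lt_of_le_of_ne hc.1 fun hac => hva ?_
    rw [hac]; exact hzero c hc1 hc2
  have hsub : Ioo a c ⊆ Icc a b := fun t ht => ⟨ht.1.le, ht.2.le.trans hc.2⟩
  have hle : ‖S.vOf (y a) (z a) - S.vOf (y c) (z c)‖ ≤
      σ * (‖S.wOf h (y c) (z c)‖ + ‖y c‖ ^ (p + 1)) := by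
    refine ContinuousWithinAt.closure_le (s := Ioo a c)
      (f := fun t => ‖S.vOf (y a) (z a) - S.vOf (y t) (z t)‖)
      (g := fun t => σ * (‖S.wOf h (y t) (z t)‖ + ‖y t‖ ^ (p + 1)))
      (by rw [closure_Ioo hac.ne]; exact right_mem_Icc.2 hac.le)
      (((continuousOn_const.sub hh.continuousOn_vOf).norm c hc).mono hsub)
      (((continuousOn_const.mul (hh.continuousOn_threshold hcm hp hy)) c hc).mono hsub)
      fun t ht => ?_
    have hnt := hh.no_trigger t ⟨ht.1, ht.2.trans_le hc.2⟩
    by_contra hcon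
    refine hnt ⟨fun h0 => ?_, (not_le.1 hcon).le⟩
    exact absurd (hleast ⟨hsub ht, Prod.ext h0.1 h0.2⟩) (not_le.2 ht.2)
  rw [hc2, hc1, norm_zero, norm_zero, Real.zero_rpow (by linarith), add_zero, mul_zero, ← hc1,
    hzero c hc1 hc2, sub_zero] at hle
  exact hva (norm_le_zero_iff.1 hle)

/-- The measurement error stays below the threshold up to and including the next event. -/
theorem error_le (hh : S.IsHeld h P σ p δ y z a b) (hcm : S.IsCenterManifold δh h) (hσ : 0 < σ)
    (hp : 1 < p) (hy : ∀ s ∈ Icc a b, ‖y s‖ < δh) {s : ℝ} (hs : s ∈ Icc a b) :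
    ‖S.vOf (y a) (z a) - S.vOf (y s) (z s)‖ ≤
      σ * (‖S.wOf h (y s) (z s)‖ + ‖y s‖ ^ (p + 1)) := by
  have hIoo : ∀ t ∈ Ioo a b, ‖S.vOf (y a) (z a) - S.vOf (y t) (z t)‖ ≤
      σ * (‖S.wOf h (y t) (z t)‖ + ‖y t‖ ^ (p + 1)) := by
    intro t ht
    by_cases h0 : y t = 0 ∧ S.wOf h (y t) (z t) = 0
    · have h1 := hh.vOf_eq_zero hcm hp hy (Ioo_subset_Icc_self ht) h0.1 h0.2
      have h2 : S.vOf (y t) (z t) = 0 := by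
        rw [vOf_eq_wOf_add (h := h), h0.2, h0.1, hcm.2.2.1, add_zero]
      rw [h1, h2, sub_zero, norm_zero]
      positivity
    · by_contra hcon
      exact hh.no_trigger t ht ⟨h0, (not_le.1 hcon).le⟩
  rcases hs.1.eq_or_lt with h1 | h1
  · rw [← h1, sub_self, norm_zero]; positivity
  · have hab : a < b := h1.trans_le hs.2
    refine ContinuousWithinAt.closure_le (s := Ioo a b)
      (f := fun t => ‖S.vOf (y a) (z a) - S.vOf (y t) (z t)‖)
      (g := fun t => σ * (‖S.wOf h (y t) (z t)‖ + ‖y t‖ ^ (p + 1)))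
      (by rwa [closure_Ioo hab.ne])
      (((continuousOn_const.sub hh.continuousOn_vOf).norm s hs).mono Ioo_subset_Icc_self)
      (((continuousOn_const.mul (hh.continuousOn_threshold hcm hp hy)) s hs).mono
        Ioo_subset_Icc_self) hIoo

theorem antitoneOn_of_lt_level (hh : S.IsHeld h P σ p δ y z a b)
    (H : S.Setup δh h P Q p k5 k6 sf σ δ k1 k2 k8 sy)
    (hV : ∀ s ∈ Icc a b, lyap P (y s) (S.wOf h (y s) (z s)) < level P δ) :
    AntitoneOn (fun s => lyap P (y s) (S.wOf h (y s) (z s))) (Icc a b) := by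
  have hy : ∀ s ∈ Icc a b, ‖y s‖ < δh := fun s hs =>
    (H.norm_lt (hV s hs)).trans_le H.const.delta_le
  have hD : ∀ s ∈ Ico a b, ∃ D, HasDerivWithinAt
      (fun t => lyap P (y t) (S.wOf h (y t) (z t))) D (Ici s) s ∧ D ≤ 0 := by
    intro s hs
    have hs' := Ico_subset_Icc_self hs
    obtain ⟨d1, d2⟩ := hh.deriv s hs (hV s hs')
    obtain ⟨D, hD, hDle⟩ := H.exists_hasDerivWithinAt_lyap (hV s hs')
      (hh.error_le H.manifold H.pos_sigma H.one_lt_p hy hs') d1 d2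
    refine ⟨D, hD, hDle.trans (neg_nonpos.2 (add_nonneg ?_ ?_))⟩
    · exact mul_nonneg (mul_nonneg H.pos_k6.le (sub_nonneg.2 H.const.sy_lt_one.le)) (by positivity)
    · exact mul_nonneg H.gap_nonneg (norm_nonneg _)
  choose! D hD hD0 using hD
  intro s hs t ht hst
  exact image_le_of_deriv_right_le_deriv_boundary (a := s) (b := t)
    (B := fun _ => lyap P (y s) (S.wOf h (y s) (z s))) (B' := fun _ => 0)
    ((hh.continuousOn_lyap H.manifold hy).mono (Icc_subset_Icc hs.1 ht.2))
    (fun r hr => hD r ⟨hs.1.trans hr.1, hr.2.trans_le ht.2⟩) le_rfl continuousOn_const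
    (fun _ _ => hasDerivWithinAt_const _ _ _)
    (fun r hr => hD0 r ⟨hs.1.trans hr.1, hr.2.trans_le ht.2⟩) (right_mem_Icc.2 hst)

/-- The sublevel set of the Lyapunov function cannot be left: at a first exit time the Lyapunov
function would, by continuity, not exceed its initial value. -/
theorem lt_level (hh : S.IsHeld h P σ p δ y z a b)
    (H : S.Setup δh h P Q p k5 k6 sf σ δ k1 k2 k8 sy)
    (ha : lyap P (y a) (S.wOf h (y a) (z a)) < level P δ) :
    ∀ s ∈ Icc a b, lyap P (y s) (S.wOf h (y s) (z s)) < level P δ := by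
  by_contra! hcon
  obtain ⟨s, hs, hsV⟩ := hcon
  have hclosed := hh.continuousOn_pair.preimage_isClosed_of_isClosed isClosed_Icc
    H.isOpen_region.isClosed_compl
  obtain ⟨c, ⟨hc, hcV⟩, hleast⟩ :=
    (isCompact_Icc.of_isClosed_subset hclosed inter_subset_left).exists_isLeast
      ⟨s, hs, not_lt.2 hsV⟩
  have hbefore : ∀ t ∈ Ico a c, lyap P (y t) (S.wOf h (y t) (z t)) < level P δ := by
    intro t ht
    by_contra h1
    exact absurd (hleast ⟨⟨ht.1, ht.2.le.trans hc.2⟩, h1⟩) (not_le.2 ht.2)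
  have hac : a < c := by
    refine lt_of_le_of_ne hc.1 fun hac => hcV ?_
    subst hac; exact ha
  have hle : ∀ t ∈ Ico a c, lyap P (y t) (S.wOf h (y t) (z t)) ≤
      lyap P (y a) (S.wOf h (y a) (z a)) := fun t ht =>
    (hh.mono_right ht.1 (ht.2.le.trans hc.2)).antitoneOn_of_lt_level H
      (fun r hr => hbefore r ⟨hr.1, hr.2.trans_lt ht.2⟩) (left_mem_Icc.2 ht.1)
      (right_mem_Icc.2 ht.1) ht.1
  have hmem : c ∈ closure (Ico a c) := by
    rw [closure_Ico hac.ne]; exact right_mem_Icc.2 hac.le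
  have hsub : Ico a c ⊆ Icc a b := fun t ht => ⟨ht.1, ht.2.le.trans hc.2⟩
  -- the norm of `y` bounds the Lyapunov function from below, so `c` lies in the domain of `h`
  have hlev : level P δ ≤ δ :=
    (mul_le_mul_of_nonneg_right (min_le_left _ _) H.const.pos_delta.le).trans (one_mul δ).le
  have hyc : ‖y c‖ ≤ lyap P (y a) (S.wOf h (y a) (z a)) :=
    ContinuousWithinAt.closure_le hmem ((hh.cont_y.norm c hc).mono hsub)
      continuousWithinAt_const fun t ht =>
        (le_add_of_nonneg_right (Real.sqrt_nonneg _)).trans (hle t ht)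
  have hycδ : ‖y c‖ < δh := (hyc.trans_lt ha).trans_le (hlev.trans H.const.delta_le)
  have hVc : lyap P (y c) (S.wOf h (y c) (z c)) ≤ lyap P (y a) (S.wOf h (y a) (z a)) :=
    ContinuousWithinAt.closure_le hmem
      (ContinuousAt.comp_continuousWithinAt
        (g := fun x : Vec k × Vec q => lyap P x.1 (S.wOf h x.1 x.2)) (f := fun s => (y s, z s))
        (H.manifold.continuousAt_lyap P hycδ) ((hh.continuousOn_pair c hc).mono hsub))
      continuousWithinAt_const hle
  exact hcV (hVc.trans_lt ha)

theorem norm_lt (hh : S.IsHeld h P σ p δ y z a b)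
    (H : S.Setup δh h P Q p k5 k6 sf σ δ k1 k2 k8 sy)
    (ha : lyap P (y a) (S.wOf h (y a) (z a)) < level P δ) :
    ∀ s ∈ Icc a b, ‖y s‖ < δh := fun s hs =>
  (H.norm_lt (hh.lt_level H ha s hs)).trans_le H.const.delta_le

theorem antitoneOn (hh : S.IsHeld h P σ p δ y z a b)
    (H : S.Setup δh h P Q p k5 k6 sf σ δ k1 k2 k8 sy)
    (ha : lyap P (y a) (S.wOf h (y a) (z a)) < level P δ) :
    AntitoneOn (fun s => lyap P (y s) (S.wOf h (y s) (z s))) (Icc a b) :=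
  hh.antitoneOn_of_lt_level H (hh.lt_level H ha)

/-- The explicit lower bound on the time between an update of the input and the next event. -/
theorem arctanTime_le (hh : S.IsHeld h P σ p δ y z a b)
    (H : S.Setup δh h P Q p k5 k6 sf σ δ k1 k2 k8 sy)
    (hdisc : (S.a2 k1 k2 k8 δ + S.a3 p k1 k2 k5 δ) ^ 2 <
      4 * S.a1 k1 k2 k5 k8 δ * S.a4 p k1 k2 δ)
    (ha : lyap P (y a) (S.wOf h (y a) (z a)) < level P δ)
    (hb : lyap P (y b) (S.wOf h (y b) (z b)) ≠ 0)
    (hev : σ * (‖S.wOf h (y b) (z b)‖ + ‖y b‖ ^ (p + 1)) ≤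
      ‖S.vOf (y a) (z a) - S.vOf (y b) (z b)‖) :
    arctanTime (S.a1 k1 k2 k5 k8 δ) (S.a2 k1 k2 k8 δ + S.a3 p k1 k2 k5 δ)
      (S.a4 p k1 k2 δ) σ ≤ b - a := by
  have hV := hh.lt_level H ha
  have hy := hh.norm_lt H ha
  have hp := H.one_lt_p
  have hbm : b ∈ Icc a b := right_mem_Icc.2 hh.le
  have hpos : ∀ s ∈ Icc a b, 0 < ‖S.wOf h (y s) (z s)‖ + ‖y s‖ ^ (p + 1) := by
    intro s hs
    have h1 := hh.antitoneOn H ha hs hbm hs.2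
    have h2 : lyap P (y s) (S.wOf h (y s) (z s)) ≠ 0 :=
      ((lt_of_le_of_ne (lyap_nonneg _ _ _) hb.symm).trans_le h1).ne'
    refine lt_of_le_of_ne (by positivity) fun h3 => h2 (H.lyap_eq_zero_iff.2 ?_)
    have h4 := norm_nonneg (S.wOf h (y s) (z s))
    have h5 : 0 ≤ ‖y s‖ ^ (p + 1) := by positivity
    refine ⟨?_, norm_eq_zero.1 (by linarith)⟩
    have h6 : ‖y s‖ ^ (p + 1) = 0 := by linarith
    exact norm_eq_zero.1 ((Real.rpow_eq_zero (norm_nonneg _) (by linarith)).1 h6)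
  have hD : ∀ s ∈ Ico a b, ∃ D, HasDerivWithinAt
      (fun t => ‖S.vOf (y a) (z a) - S.vOf (y t) (z t)‖ /
        (‖S.wOf h (y t) (z t)‖ + ‖y t‖ ^ (p + 1))) D (Ici s) s ∧
      D ≤ S.a1 k1 k2 k5 k8 δ + (S.a2 k1 k2 k8 δ + S.a3 p k1 k2 k5 δ) *
          (‖S.vOf (y a) (z a) - S.vOf (y s) (z s)‖ /
            (‖S.wOf h (y s) (z s)‖ + ‖y s‖ ^ (p + 1))) +
        S.a4 p k1 k2 δ * (‖S.vOf (y a) (z a) - S.vOf (y s) (z s)‖ /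
            (‖S.wOf h (y s) (z s)‖ + ‖y s‖ ^ (p + 1))) ^ 2 := by
    intro s hs
    have hs' := Ico_subset_Icc_self hs
    obtain ⟨d1, d2⟩ := hh.deriv s hs (hV s hs')
    exact H.exists_hasDerivWithinAt_ratio (hV s hs')
      (hh.error_le H.manifold H.pos_sigma hp hy hs') (hpos s hs') d1 d2
  choose! D hD hDle using hD
  refine CenterETC.arctanTime_le hh.le hdisc H.a4_pos ?_ hD hDle ?_ ?_
  · exact (continuousOn_const.sub hh.continuousOn_vOf).norm.div
      (hh.continuousOn_threshold H.manifold hp hy) fun s hs => (hpos s hs).ne'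
  · simp
  · rwa [le_div_iff₀ (hpos b hbm)]

end IsHeld
end Sys

/-! ### Trajectories of the event-triggered loop -/

namespace Sys

variable {k q m : ℕ} {S : Sys k q m} {h : Vec k → Vec q} {δh : ℝ}
  {P Q : Matrix (Fin q) (Fin q) ℝ} {p k5 k6 sf σ δ k1 k2 k8 sy : ℝ}

theorem Setup.lyap_le (H : S.Setup δh h P Q p k5 k6 sf σ δ k1 k2 k8 sy) (y : Vec k) (w : Vec q) :
    lyap P y w ≤ ‖y‖ + Real.sqrt (lamMax P) * ‖w‖ := by
  obtain ⟨B, hB⟩ : ∃ B, IsFactor P B := exists_factor H.posDef_P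
  rw [hB.lyap_eq]
  linarith [hB.norm_le_sqrt_lamMax H.posDef_P w]

/-- If the measurement error is strictly below the threshold at some time, then it stays below for
a while. -/
theorem Setup.exists_forall_error_lt (H : S.Setup δh h P Q p k5 k6 sf σ δ k1 k2 k8 sy)
    {y : ℝ → Vec k} {z : ℝ → Vec q} {b : ℝ} {D : Set ℝ} {v : Vec q}
    (hc : ContinuousWithinAt (fun s => (y s, z s)) D b)
    (hV : lyap P (y b) (S.wOf h (y b) (z b)) < level P δ)
    (hlt : ‖v - S.vOf (y b) (z b)‖ < σ * (‖S.wOf h (y b) (z b)‖ + ‖y b‖ ^ (p + 1))) :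
    ∃ ε > 0, ∀ s ∈ D, b ≤ s → s < b + ε →
      ‖v - S.vOf (y s) (z s)‖ < σ * (‖S.wOf h (y s) (z s)‖ + ‖y s‖ ^ (p + 1)) := by
  have hyb : ‖y b‖ < δh := (H.norm_lt hV).trans_le H.const.delta_le
  have hw := ContinuousAt.comp_continuousWithinAt
    (g := fun x : Vec k × Vec q => S.wOf h x.1 x.2) (f := fun s => (y s, z s))
    (H.manifold.continuousAt_wOf hyb) hc
  have hv := ContinuousAt.comp_continuousWithinAt
    (g := fun x : Vec k × Vec q => S.vOf x.1 x.2) (f := fun s => (y s, z s))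
    continuous_vOf.continuousAt hc
  have hp := H.one_lt_p
  have hev : ∀ᶠ s in 𝓝[D] b,
      ‖v - S.vOf (y s) (z s)‖ < σ * (‖S.wOf h (y s) (z s)‖ + ‖y s‖ ^ (p + 1)) :=
    Filter.Tendsto.eventually_lt (continuousWithinAt_const.sub hv).norm
      (continuousWithinAt_const.mul (hw.norm.add
        (hc.fst.norm.rpow_const (Or.inr (by linarith))))) hlt
  obtain ⟨ε, hε, hball⟩ := Metric.mem_nhdsWithin_iff.1 hev
  refine ⟨ε, hε, fun s hs hbs hsε => hball ⟨?_, hs⟩⟩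
  rw [Metric.mem_ball, Real.dist_eq, abs_of_nonneg (sub_nonneg.2 hbs)]
  linarith

theorem Setup.lyap_le_pairNorm (H : S.Setup δh h P Q p k5 k6 sf σ δ k1 k2 k8 sy) (y : Vec k)
    (w : Vec q) : lyap P y w ≤ (1 + Real.sqrt (lamMax P)) * pairNorm y w := by
  refine (H.lyap_le y w).trans ?_
  have h1 := norm_le_pairNorm_left y w
  have h2 := mul_le_mul_of_nonneg_left (norm_le_pairNorm_right y w) (Real.sqrt_nonneg (lamMax P))
  linarith

namespace IsExecution

variable {T : EReal} {y : ℝ → Vec k} {z : ℝ → Vec q} {t : ℕ → EReal}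
  (hx : S.IsExecution h σ p T y z t)
include hx

theorem le_succ (i : ℕ) : t i ≤ t (i + 1) := by
  rw [hx.2.1 i]
  refine le_sInf ?_
  rintro _ ⟨s, hs, rfl⟩
  exact hs.1.le

theorem monotone : Monotone t := monotone_nat_of_le_succ hx.le_succ

theorem nonneg (i : ℕ) : 0 ≤ t i := hx.1 ▸ hx.monotone (Nat.zero_le i)

theorem eq_top_or_coe (i : ℕ) : t i = ⊤ ∨ ∃ a : ℝ, 0 ≤ a ∧ t i = a := by
  have h0 := hx.nonneg i
  induction hti : t i with
  | bot => rw [hti] at h0; exact absurd h0 (by simp)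
  | top => exact Or.inl rfl
  | coe a => rw [hti] at h0; exact Or.inr ⟨a, by exact_mod_cast h0, rfl⟩

theorem isHeld {i : ℕ} {a b : ℝ} (P : Matrix (Fin q) (Fin q) ℝ) (δ : ℝ) (ha : 0 ≤ a)
    (hia : t i = a) (hab : a ≤ b) (hb : (b : EReal) ≤ t (i + 1)) (hbT : (b : EReal) < T) :
    S.IsHeld h P σ p δ y z a b := by
  have hsub : Icc a b ⊆ {s : ℝ | 0 ≤ s ∧ (s : EReal) < T} := fun s hs =>
    ⟨ha.trans hs.1, (EReal.coe_le_coe_iff.2 hs.2).trans_lt hbT⟩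
  obtain ⟨-, hnext, -, hy, hz, hd⟩ := hx
  refine ⟨hab, hy.mono hsub, hz.mono hsub, fun s hs _ => ?_, fun s hs htr => ?_⟩
  · have := hd i s (by rw [hia]; exact_mod_cast hs.1)
      ((EReal.coe_lt_coe_iff.2 hs.2).trans_le hb) (hsub (Ico_subset_Icc_self hs)).2
    rwa [hia, EReal.toReal_coe] at this
  · have hmem : (s : EReal) ∈ Real.toEReal '' {s : ℝ | t i < (s : EReal) ∧ (s : EReal) < T ∧
        S.Trigger h σ p y z (t i).toReal s} := by
      refine ⟨s, ⟨?_, (hsub (Ioo_subset_Icc_self hs)).2, ?_⟩, rfl⟩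
      · rw [hia]; exact_mod_cast hs.1
      · rwa [hia, EReal.toReal_coe]
    have h1 := sInf_le hmem
    rw [← hnext i] at h1
    have h2 := hb.trans h1
    rw [EReal.coe_le_coe_iff] at h2
    exact absurd hs.2 (not_lt.2 h2)

theorem antitoneOn_of_le_event (H : S.Setup δh h P Q p k5 k6 sf σ δ k1 k2 k8 sy)
    (h0 : lyap P (y 0) (S.wOf h (y 0) (z 0)) < level P δ) (i : ℕ) :
    AntitoneOn (fun s => lyap P (y s) (S.wOf h (y s) (z s)))
      {s : ℝ | 0 ≤ s ∧ (s : EReal) < T ∧ (s : EReal) ≤ t i} := by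
  induction i with
  | zero =>
    rintro s ⟨hs0, -, hs⟩ s' ⟨hs0', -, hs'⟩ hss
    rw [hx.1] at hs hs'
    have e1 : s = 0 := le_antisymm (by exact_mod_cast hs) hs0
    have e2 : s' = 0 := le_antisymm (by exact_mod_cast hs') hs0'
    rw [e1, e2]
  | succ i ih =>
    rintro s ⟨hs0, hsT, hs⟩ s' ⟨hs0', hsT', hs'⟩ hss
    by_cases hle : (s' : EReal) ≤ t i
    · exact ih ⟨hs0, hsT, (EReal.coe_le_coe_iff.2 hss).trans hle⟩ ⟨hs0', hsT', hle⟩ hss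
    · rw [not_le] at hle
      rcases hx.eq_top_or_coe i with htop | ⟨a, ha, hia⟩
      · rw [htop] at hle; exact absurd hle not_top_lt
      · rw [hia] at hle
        have has : a ≤ s' := (EReal.coe_lt_coe_iff.1 hle).le
        have haT : (a : EReal) < T := hle.trans hsT'
        have hamem : a ∈ {s : ℝ | 0 ≤ s ∧ (s : EReal) < T ∧ (s : EReal) ≤ t i} :=
          ⟨ha, haT, hia.ge⟩
        have h0mem : (0 : ℝ) ∈ {s : ℝ | 0 ≤ s ∧ (s : EReal) < T ∧ (s : EReal) ≤ t i} :=
          ⟨le_rfl, (EReal.coe_le_coe_iff.2 ha).trans_lt haT, hx.nonneg i⟩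
        have hVa := (ih h0mem hamem ha).trans_lt h0
        have hanti := (hx.isHeld P δ ha hia has hs' hsT').antitoneOn H hVa
        rcases le_total a s with h1 | h1
        · exact hanti ⟨h1, hss⟩ ⟨has, le_rfl⟩ hss
        · exact (hanti ⟨le_rfl, has⟩ ⟨has, le_rfl⟩ has).trans
            (ih ⟨hs0, hsT, hia ▸ EReal.coe_le_coe_iff.2 h1⟩ hamem h1)

theorem antitoneOn (H : S.Setup δh h P Q p k5 k6 sf σ δ k1 k2 k8 sy)
    (h0 : lyap P (y 0) (S.wOf h (y 0) (z 0)) < level P δ) :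
    AntitoneOn (fun s => lyap P (y s) (S.wOf h (y s) (z s)))
      {s : ℝ | 0 ≤ s ∧ (s : EReal) < T} := by
  rintro s ⟨hs0, hsT⟩ s' ⟨hs0', hsT'⟩ hss
  obtain ⟨i, -, hi⟩ := hx.2.2.1 s' hs0' hsT'
  exact hx.antitoneOn_of_le_event H h0 (i + 1)
    ⟨hs0, hsT, (EReal.coe_le_coe_iff.2 hss).trans hi.le⟩ ⟨hs0', hsT', hi.le⟩ hss

theorem lyap_le_zero (H : S.Setup δh h P Q p k5 k6 sf σ δ k1 k2 k8 sy)
    (h0 : lyap P (y 0) (S.wOf h (y 0) (z 0)) < level P δ) {s : ℝ} (hs : 0 ≤ s)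
    (hsT : (s : EReal) < T) :
    lyap P (y s) (S.wOf h (y s) (z s)) ≤ lyap P (y 0) (S.wOf h (y 0) (z 0)) :=
  hx.antitoneOn H h0 ⟨le_rfl, (EReal.coe_le_coe_iff.2 hs).trans_lt hsT⟩ ⟨hs, hsT⟩ hs

theorem continuousOn_pair :
    ContinuousOn (fun s => (y s, z s)) {s : ℝ | 0 ≤ s ∧ (s : EReal) < T} :=
  hx.2.2.2.1.prodMk hx.2.2.2.2.1

/-- Inter-event times are bounded from below by `arctanTime`. -/
theorem add_arctanTime_le (H : S.Setup δh h P Q p k5 k6 sf σ δ k1 k2 k8 sy)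
    (hdisc : (S.a2 k1 k2 k8 δ + S.a3 p k1 k2 k5 δ) ^ 2 <
      4 * S.a1 k1 k2 k5 k8 δ * S.a4 p k1 k2 δ)
    (h0 : lyap P (y 0) (S.wOf h (y 0) (z 0)) < level P δ) (i : ℕ) :
    t i + ((arctanTime (S.a1 k1 k2 k5 k8 δ) (S.a2 k1 k2 k8 δ + S.a3 p k1 k2 k5 δ)
      (S.a4 p k1 k2 δ) σ : ℝ) : EReal) ≤ t (i + 1) := by
  set A := {s : ℝ | t i < (s : EReal) ∧ (s : EReal) < T ∧ S.Trigger h σ p y z (t i).toReal s}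
    with hA
  have hnext : t (i + 1) = sInf (Real.toEReal '' A) := hx.2.1 i
  rcases A.eq_empty_or_nonempty with hemp | ⟨s₀, hs₀⟩
  · rw [hnext, hemp, image_empty, sInf_empty]; exact le_top
  rcases hx.eq_top_or_coe i with htop | ⟨a, ha, hia⟩
  · exact absurd hs₀.1 (htop ▸ not_top_lt)
  have hle₀ : t (i + 1) ≤ s₀ := hnext ▸ sInf_le ⟨s₀, hs₀, rfl⟩
  obtain ⟨b, hb, hib⟩ : ∃ b : ℝ, 0 ≤ b ∧ t (i + 1) = b := by
    rcases hx.eq_top_or_coe (i + 1) with htop | hb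
    · rw [htop] at hle₀; exact absurd hle₀ (not_le.2 (EReal.coe_lt_top _))
    · exact hb
  have hbs₀ : (b : EReal) ≤ s₀ := hib ▸ hle₀
  have hbT : (b : EReal) < T := hbs₀.trans_lt hs₀.2.1
  have hab : a ≤ b := by
    have := hx.le_succ i
    rw [hia, hib] at this
    exact_mod_cast this
  have hAb : ∀ s ∈ A, b ≤ s := fun s hs => by
    have : t (i + 1) ≤ s := hnext ▸ sInf_le ⟨s, hs, rfl⟩
    rw [hib] at this
    exact_mod_cast this
  have hheld := hx.isHeld P δ ha hia hab hib.ge hbT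
  have hVb := (hx.lyap_le_zero H h0 hb hbT).trans_lt h0
  have hVa := (hx.lyap_le_zero H h0 ha ((EReal.coe_le_coe_iff.2 hab).trans_lt hbT)).trans_lt h0
  have hne : lyap P (y b) (S.wOf h (y b) (z b)) ≠ 0 := by
    intro hz
    have h1 := hx.antitoneOn H h0 ⟨hb, hbT⟩ ⟨hb.trans (hAb s₀ hs₀), hs₀.2.1⟩ (hAb s₀ hs₀)
    have h2 := le_antisymm (h1.trans hz.le) (lyap_nonneg _ _ _)
    exact hs₀.2.2.1 (H.lyap_eq_zero_iff.1 h2)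
  -- the infimum in the definition of the next event time is attained
  have hev : σ * (‖S.wOf h (y b) (z b)‖ + ‖y b‖ ^ (p + 1)) ≤
      ‖S.vOf (y a) (z a) - S.vOf (y b) (z b)‖ := by
    by_contra! hcon
    obtain ⟨ε, hε, hball⟩ :=
      H.exists_forall_error_lt (hx.continuousOn_pair b ⟨hb, hbT⟩) hVb hcon
    have hge : ((b + ε : ℝ) : EReal) ≤ t (i + 1) := by
      rw [hnext]
      refine le_sInf ?_
      rintro _ ⟨s, hs, rfl⟩
      rw [EReal.coe_le_coe_iff]
      by_contra! hlt
      have hbs := hAb s hs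
      have h2 := hball s ⟨hb.trans hbs, hs.2.1⟩ hbs hlt
      have h3 := hs.2.2.2
      rw [hia, EReal.toReal_coe] at h3
      exact absurd h3 (not_le.2 h2)
    rw [hib, EReal.coe_le_coe_iff] at hge
    linarith
  have hτ := hheld.arctanTime_le H hdisc hVa hne hev
  rw [hia, hib, ← EReal.coe_add, EReal.coe_le_coe_iff]
  linarith

theorem exists_hasDerivWithinAt_lyap (H : S.Setup δh h P Q p k5 k6 sf σ δ k1 k2 k8 sy)
    (h0 : lyap P (y 0) (S.wOf h (y 0) (z 0)) < level P δ) {s : ℝ} (hs : 0 ≤ s)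
    (hsT : (s : EReal) < T) :
    ∃ D, HasDerivWithinAt (fun t => lyap P (y t) (S.wOf h (y t) (z t))) D (Ici s) s ∧
      D ≤ -(k6 * (1 - sy) * ‖y s‖ ^ p + gap P Q sf σ k1 k2 * ‖S.wOf h (y s) (z s)‖) := by
  obtain ⟨i, hi1, hi2⟩ := hx.2.2.1 s hs hsT
  rcases hx.eq_top_or_coe i with htop | ⟨a, ha, hia⟩
  · rw [htop] at hi1; exact absurd hi1 (not_le.2 (EReal.coe_lt_top _))
  have has : a ≤ s := by rw [hia] at hi1; exact_mod_cast hi1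
  obtain ⟨d1, d2⟩ := hx.2.2.2.2.2 i s hi1 hi2 hsT
  rw [hia, EReal.toReal_coe] at d1 d2
  have hVa := (hx.lyap_le_zero H h0 ha ((EReal.coe_le_coe_iff.2 has).trans_lt hsT)).trans_lt h0
  have hVs := (hx.lyap_le_zero H h0 hs hsT).trans_lt h0
  have hheld := hx.isHeld P δ ha hia has hi2.le hsT
  exact H.exists_hasDerivWithinAt_lyap hVs (hheld.error_le H.manifold H.pos_sigma H.one_lt_p
    (hheld.norm_lt H hVa) (right_mem_Icc.2 has)) d1 d2

end IsExecution

/-- Trajectories that are defined for all times converge to the origin. -/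
theorem IsExecution.tendsto_pairNorm {y : ℝ → Vec k} {z : ℝ → Vec q} {t : ℕ → EReal}
    (hx : S.IsExecution h σ p ⊤ y z t) (H : S.Setup δh h P Q p k5 k6 sf σ δ k1 k2 k8 sy)
    (hgap : 0 < gap P Q sf σ k1 k2)
    (h0 : lyap P (y 0) (S.wOf h (y 0) (z 0)) < level P δ) :
    Tendsto (fun s => pairNorm (y s) (S.wOf h (y s) (z s))) atTop (𝓝 0) := by
  have hc := H.min_pos
  have hsL : 0 < Real.sqrt (lamMax P) := Real.sqrt_pos.2 (lamMax_pos H.dim_pos H.posDef_P)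
  have hk : 0 < k6 * (1 - sy) := mul_pos H.pos_k6 (sub_pos.2 H.const.sy_lt_one)
  have hp := H.one_lt_p
  have hV : Tendsto (fun s => lyap P (y s) (S.wOf h (y s) (z s))) atTop (𝓝 0) := by
    rw [Metric.tendsto_atTop]
    intro ε hε
    -- otherwise the Lyapunov function would decrease at least at a constant rate
    obtain ⟨s₀, hs₀, hlt⟩ : ∃ s ≥ 0, lyap P (y s) (S.wOf h (y s) (z s)) < ε := by
      by_contra! hcon
      set c := min (k6 * (1 - sy) * (ε / 2) ^ p)
        (gap P Q sf σ k1 k2 * (ε / (2 * Real.sqrt (lamMax P)))) with hcdef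
      have hcpos : 0 < c := by positivity
      have hD : ∀ s : ℝ, 0 ≤ s → ∃ D, HasDerivWithinAt
          (fun t => lyap P (y t) (S.wOf h (y t) (z t))) D (Ici s) s ∧ D ≤ -c := by
        intro s hs
        obtain ⟨D, hD, hDle⟩ := hx.exists_hasDerivWithinAt_lyap H h0 hs (EReal.coe_lt_top _)
        refine ⟨D, hD, hDle.trans (neg_le_neg ?_)⟩
        have h1 := (hcon s hs).trans (H.lyap_le _ _)
        have hw0 := norm_nonneg (S.wOf h (y s) (z s))
        rcases le_total (ε / 2) ‖y s‖ with h2 | h2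
        · have h3 : k6 * (1 - sy) * (ε / 2) ^ p ≤ k6 * (1 - sy) * ‖y s‖ ^ p := by gcongr
          have h4 : 0 ≤ gap P Q sf σ k1 k2 * ‖S.wOf h (y s) (z s)‖ := by positivity
          linarith [min_le_left (k6 * (1 - sy) * (ε / 2) ^ p)
            (gap P Q sf σ k1 k2 * (ε / (2 * Real.sqrt (lamMax P))))]
        · have h3 : ε / (2 * Real.sqrt (lamMax P)) ≤ ‖S.wOf h (y s) (z s)‖ := by
            rw [div_le_iff₀ (by positivity)]; linarith
          have h4 : gap P Q sf σ k1 k2 * (ε / (2 * Real.sqrt (lamMax P))) ≤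
              gap P Q sf σ k1 k2 * ‖S.wOf h (y s) (z s)‖ := by gcongr
          have h5 : 0 ≤ k6 * (1 - sy) * ‖y s‖ ^ p := by positivity
          linarith [min_le_right (k6 * (1 - sy) * (ε / 2) ^ p)
            (gap P Q sf σ k1 k2 * (ε / (2 * Real.sqrt (lamMax P))))]
      choose! D hD hDle using hD
      have hVc : ContinuousOn (fun s => lyap P (y s) (S.wOf h (y s) (z s))) (Ici 0) := by
        intro s hs
        have hVs := (hx.lyap_le_zero H h0 hs (EReal.coe_lt_top _)).trans_lt h0
        exact ContinuousAt.comp_continuousWithinAt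
          (g := fun x : Vec k × Vec q => lyap P x.1 (S.wOf h x.1 x.2)) (f := fun s => (y s, z s))
          (H.manifold.continuousAt_lyap P ((H.norm_lt hVs).trans_le H.const.delta_le))
          ((hx.continuousOn_pair s ⟨hs, EReal.coe_lt_top _⟩).mono
            fun r hr => ⟨hr, EReal.coe_lt_top _⟩)
      set L := lyap P (y 0) (S.wOf h (y 0) (z 0)) with hL
      have hL0 : 0 ≤ L := lyap_nonneg _ _ _
      have hT : 0 ≤ L / c := by positivity
      have hle := image_le_of_deriv_right_le_deriv_boundary (a := 0) (b := L / c)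
        (f' := D) (B := fun s => L + -c * s) (B' := fun _ => -c * 1)
        (hVc.mono Icc_subset_Ici_self) (fun s hs => hD s hs.1) (by simp [hL])
        (by fun_prop) (fun s _ => (((hasDerivAt_id s).const_mul _).const_add _).hasDerivWithinAt)
        (fun s hs => by rw [mul_one]; exact hDle s hs.1) (right_mem_Icc.2 hT)
      have h6 := hcon (L / c) hT
      have h7 : L + -c * (L / c) = 0 := by field_simp; ring
      rw [h7] at hle
      linarith
    refine ⟨s₀, fun s hs => ?_⟩
    have h1 := hx.antitoneOn H h0 ⟨hs₀, EReal.coe_lt_top _⟩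
      ⟨hs₀.trans hs, EReal.coe_lt_top _⟩ hs
    rw [Real.dist_eq, sub_zero, abs_of_nonneg (lyap_nonneg _ _ _)]
    exact lt_of_le_of_lt h1 hlt
  have hV' := hV.const_mul (min 1 (Real.sqrt (lamMin P)))⁻¹
  rw [mul_zero] at hV'
  refine squeeze_zero (fun s => Real.sqrt_nonneg _) (fun s => ?_) hV'
  rw [inv_mul_eq_div, le_div_iff₀ hc, mul_comm]
  exact H.min_mul_pairNorm_le_lyap _ _

end Sys

/-! ### Existence of trajectories -/

namespace Sys

variable {k q m : ℕ} {S : Sys k q m} {h : Vec k → Vec q} {δh : ℝ}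
  {P Q : Matrix (Fin q) (Fin q) ℝ} {p k5 k6 sf σ δ k1 k2 k8 sy : ℝ}

variable (S) in
/-- The vector field of the plant when the input is held at `u`. -/
def heldField (u : Vec m) (x : Vec k × Vec q) : Vec k × Vec q :=
  (S.yDot x.1 x.2 u, S.zDot x.1 x.2 u)

theorem Standing.contDiff_heldField (hS : S.Standing) (u : Vec m) :
    ContDiff ℝ 1 (S.heldField u) := by
  have hι : ContDiff ℝ 2 (fun x : Vec k × Vec q => (x.1, x.2, u)) :=
    contDiff_fst.prodMk (contDiff_snd.prodMk contDiff_const)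
  have h1 : ContDiff ℝ 2 (fun x : Vec k × Vec q => S.yDot x.1 x.2 u) :=
    ((actL S.A1).contDiff.comp contDiff_fst).add (hS.regular.1.comp hι)
  have h2 : ContDiff ℝ 2 (fun x : Vec k × Vec q => S.zDot x.1 x.2 u) :=
    (((actL S.A2).contDiff.comp contDiff_snd).add contDiff_const).add (hS.regular.2.1.comp hι)
  exact (h1.prodMk h2).of_le (by norm_num)

theorem Standing.heldField_zero (hS : S.Standing) : S.heldField 0 0 = 0 := by
  obtain ⟨-, -, h1, h2, -⟩ := hS.regular
  have e1 : S.G1 (0, 0, 0) = 0 := h1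
  have e2 : S.G2 (0, 0, 0) = 0 := h2
  simp [heldField, yDot, zDot, e1, e2]

/-- Below the critical level the plant state stays in a ball. -/
theorem Setup.exists_norm_le (H : S.Setup δh h P Q p k5 k6 sf σ δ k1 k2 k8 sy) :
    ∃ ρ > 0, ∀ x : Vec k × Vec q, lyap P x.1 (S.wOf h x.1 x.2) < level P δ → ‖x‖ ≤ ρ := by
  have C := H.const
  have hδ := C.pos_delta
  have hk8 := C.pos_k8
  have hE := opNorm_nonneg S.E
  refine ⟨δ + k8 * δ * δ + opNorm S.E * δ, by positivity, fun x hx => ?_⟩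
  have hy := H.norm_lt hx
  have hw := (norm_le_pairNorm_right _ _).trans_lt (H.pairNorm_lt hx)
  have hh : ‖h x.1‖ ≤ k8 * δ * δ := by
    have h1 := (convex_ball (0 : Vec k) δ).norm_image_sub_le_of_norm_fderiv_le (𝕜 := ℝ) (f := h)
      (C := k8 * δ) (x := 0) (y := x.1)
      (fun y hy => (H.manifold.hasFDerivAt
        ((mem_ball_zero_iff.1 hy).trans_le C.delta_le)).differentiableAt)
      (fun y hy => by
        have hy' := mem_ball_zero_iff.1 hy
        refine (C.deriv_h y hy').trans ?_
        gcongr) (Metric.mem_ball_self hδ) (mem_ball_zero_iff.2 hy)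
    rw [H.manifold.2.2.1, sub_zero, sub_zero] at h1
    exact h1.trans (by gcongr)
  have hz : x.2 = S.wOf h x.1 x.2 + h x.1 + act S.E x.1 := by simp [wOf, vOf]
  have hEy : ‖act S.E x.1‖ ≤ opNorm S.E * δ := (norm_act_le _ _).trans (by gcongr)
  rw [Prod.norm_def]
  refine max_le ?_ ?_
  · have : 0 ≤ k8 * δ * δ + opNorm S.E * δ := by positivity
    linarith
  · rw [hz]
    exact norm_add₃_le.trans (by linarith)

/-- One step of the event-triggered loop: the solution `X` with held input that starts at `x₀`, and
the time `θ` of its first event. The solution is that of a plant which is cut off outside of the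
region that is reached. -/
theorem Setup.exists_step (H : S.Setup δh h P Q p k5 k6 sf σ δ k1 k2 k8 sy)
    (hdisc : (S.a2 k1 k2 k8 δ + S.a3 p k1 k2 k5 δ) ^ 2 <
      4 * S.a1 k1 k2 k5 k8 δ * S.a4 p k1 k2 δ) {τ : ℝ}
    (hτle : τ ≤ arctanTime (S.a1 k1 k2 k5 k8 δ) (S.a2 k1 k2 k8 δ + S.a3 p k1 k2 k5 δ)
      (S.a4 p k1 k2 δ) σ) (x₀ : Vec k × Vec q)
    (h0 : lyap P x₀.1 (S.wOf h x₀.1 x₀.2) < level P δ) :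
    ∃ (X : ℝ → Vec k × Vec q) (θ : EReal), X 0 = x₀ ∧ Continuous X ∧ (τ : EReal) ≤ θ ∧
      (∀ s : ℝ, 0 < s → (s : EReal) < θ →
        ¬ S.Trigger h σ p (fun r => (X r).1) (fun r => (X r).2) 0 s) ∧
      (∀ s : ℝ, θ = s → S.Trigger h σ p (fun r => (X r).1) (fun r => (X r).2) 0 s) ∧
      (∀ s : ℝ, 0 ≤ s → (s : EReal) < θ →
        HasDerivAt X (S.heldField (S.K x₀.1 x₀.2) (X s)) s) ∧
      ∀ s : ℝ, 0 ≤ s → (s : EReal) ≤ θ →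
        lyap P (X s).1 (S.wOf h (X s).1 (X s).2) < level P δ := by
  obtain ⟨ρ, hρ, hbound⟩ := H.exists_norm_le
  obtain ⟨F, κ, hF, hFeq, hint⟩ := exists_cutoff hρ (lt_add_one ρ)
    (H.standing.contDiff_heldField (S.K x₀.1 x₀.2)).contDiffOn
  obtain ⟨X, hX0, hX⟩ := hint x₀
  have hXc : Continuous X := continuous_iff_continuousAt.2 fun s => (hX s).continuousAt
  set A := {s : ℝ | 0 < s ∧ S.Trigger h σ p (fun r => (X r).1) (fun r => (X r).2) 0 s} with hA
  set θ : EReal := sInf (Real.toEReal '' A) with hθ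
  have hAθ : ∀ s ∈ A, θ ≤ (s : EReal) := fun s hs => sInf_le ⟨s, hs, rfl⟩
  have hno : ∀ s : ℝ, 0 < s → (s : EReal) < θ →
      ¬ S.Trigger h σ p (fun r => (X r).1) (fun r => (X r).2) 0 s := fun s hs hsθ htr =>
    absurd (hAθ s ⟨hs, htr⟩) (not_le.2 hsθ)
  have hder : ∀ s, lyap P (X s).1 (S.wOf h (X s).1 (X s).2) < level P δ →
      HasDerivAt X (S.heldField (S.K x₀.1 x₀.2) (X s)) s := fun s hs => by
    have := hX s
    rwa [hFeq _ (hbound _ hs)] at this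
  have hheld : ∀ b : ℝ, 0 ≤ b → (b : EReal) ≤ θ →
      S.IsHeld h P σ p δ (fun r => (X r).1) (fun r => (X r).2) 0 b := by
    intro b hb hbθ
    refine ⟨hb, hXc.fst.continuousOn, hXc.snd.continuousOn, fun s hs hV => ?_,
      fun s hs => hno s hs.1 ((EReal.coe_lt_coe_iff.2 hs.2).trans_le hbθ)⟩
    rw [hX0]
    have hd₁ : HasDerivAt (fun r => (X r).1) _ s := (hder s hV).fst
    have hd₂ : HasDerivAt (fun r => (X r).2) _ s := (hder s hV).snd
    exact ⟨hd₁.hasDerivWithinAt, hd₂.hasDerivWithinAt⟩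
  have hlev : ∀ s : ℝ, 0 ≤ s → (s : EReal) ≤ θ →
      lyap P (X s).1 (S.wOf h (X s).1 (X s).2) < level P δ := fun s hs hsθ =>
    (hheld s hs hsθ).lt_level H (by rwa [hX0]) s ⟨hs, le_rfl⟩
  have hmain : θ = ⊤ ∨ ∃ b : ℝ, θ = b ∧ τ ≤ b ∧
      S.Trigger h σ p (fun r => (X r).1) (fun r => (X r).2) 0 b := by
    rcases A.eq_empty_or_nonempty with hemp | ⟨s₀, hs₀⟩
    · left; rw [hθ, hemp, image_empty, sInf_empty]
    right
    have hθ0 : (0 : EReal) ≤ θ := by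
      refine le_sInf ?_
      rintro _ ⟨s, hs, rfl⟩
      exact_mod_cast hs.1.le
    obtain ⟨b, hb, hb0⟩ : ∃ b : ℝ, θ = b ∧ 0 ≤ b := by
      have h1 := hAθ s₀ hs₀
      induction hc : θ with
      | bot => rw [hc] at hθ0; exact absurd hθ0 (by simp)
      | top => rw [hc] at h1; exact absurd h1 (not_le.2 (EReal.coe_lt_top _))
      | coe b => rw [hc] at hθ0; exact ⟨b, rfl, by exact_mod_cast hθ0⟩
    have hAb : ∀ s ∈ A, b ≤ s := fun s hs => by
      have := hAθ s hs
      rw [hb] at this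
      exact_mod_cast this
    have hh := hheld b hb0 hb.ge
    have hVb := hlev b hb0 hb.ge
    have hV0 : lyap P (X 0).1 (S.wOf h (X 0).1 (X 0).2) < level P δ := by rwa [hX0]
    -- after reaching the origin the state would stay there, without further events
    have hne : lyap P (X b).1 (S.wOf h (X b).1 (X b).2) ≠ 0 := by
      intro hz
      obtain ⟨hy0, hw0⟩ := H.lyap_eq_zero_iff.1 hz
      have hv0 := hh.vOf_eq_zero H.manifold H.one_lt_p (hh.norm_lt H hV0) ⟨hb0, le_rfl⟩ hy0 hw0
      have hu : S.K x₀.1 x₀.2 = 0 := by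
        rw [H.standing.feedback_eq, ← hX0]
        exact (congrArg _ hv0).trans (act_map_zero _)
      have hz0 : (X b).2 = 0 := by
        have : (X b).2 = S.wOf h (X b).1 (X b).2 + h (X b).1 + act S.E (X b).1 := by
          simp [wOf, vOf]
        rw [this, hw0, hy0, H.manifold.2.2.1, act_map_zero, add_zero, add_zero]
      have hF0 : F 0 = 0 := by
        rw [hFeq 0 (by simpa using hρ.le), hu, H.standing.heldField_zero]
      have hXz : X = fun _ => 0 := ODE_solution_unique_univ (v := fun _ => F)
        (s := fun _ => univ) (K := κ) (t₀ := b) (fun _ => hF.lipschitzOnWith)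
        (fun t => ⟨hX t, mem_univ _⟩)
        (fun t => ⟨by simpa [hF0] using hasDerivAt_const t (0 : Vec k × Vec q), mem_univ _⟩)
        (Prod.ext hy0 hz0)
      refine hs₀.2.1 ?_
      simp [hXz, wOf, vOf, H.manifold.2.2.1]
    -- the infimum that defines `θ` is attained
    have hev : σ * (‖S.wOf h (X b).1 (X b).2‖ + ‖(X b).1‖ ^ (p + 1)) ≤
        ‖S.vOf (X 0).1 (X 0).2 - S.vOf (X b).1 (X b).2‖ := by
      by_contra! hcon
      obtain ⟨ε, hε, hball⟩ := H.exists_forall_error_lt (y := fun r => (X r).1)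
        (z := fun r => (X r).2) (D := univ) (hXc.continuousAt.continuousWithinAt) hVb hcon
      have hge : ((b + ε : ℝ) : EReal) ≤ θ := by
        refine le_sInf ?_
        rintro _ ⟨s, hs, rfl⟩
        rw [EReal.coe_le_coe_iff]
        by_contra! hlt
        exact absurd hs.2.2 (not_le.2 (hball s (mem_univ _) (hAb s hs) hlt))
      rw [hb, EReal.coe_le_coe_iff] at hge
      linarith
    refine ⟨b, hb, ?_, fun h1 => hne (H.lyap_eq_zero_iff.2 h1), hev⟩
    have := hh.arctanTime_le H hdisc hV0 hne hev
    linarith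
  refine ⟨X, θ, hX0, hXc, ?_, hno, fun s hs => ?_,
    fun s hs hsθ => hder s (hlev s hs hsθ.le), hlev⟩
  · rcases hmain with h1 | ⟨b, hb, hτb, -⟩
    · rw [h1]; exact le_top
    · rw [hb]; exact_mod_cast hτb
  · rcases hmain with h1 | ⟨b, hb, -, htr⟩
    · rw [h1] at hs; exact absurd hs.symm (EReal.coe_ne_top s)
    · rw [hb, EReal.coe_eq_coe_iff] at hs
      rwa [← hs]

/-- Every initial state below the critical level is the initial state of a trajectory that is
defined for all times. -/
theorem Setup.exists_isExecution (H : S.Setup δh h P Q p k5 k6 sf σ δ k1 k2 k8 sy)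
    (hdisc : (S.a2 k1 k2 k8 δ + S.a3 p k1 k2 k5 δ) ^ 2 <
      4 * S.a1 k1 k2 k5 k8 δ * S.a4 p k1 k2 δ) {τ : ℝ} (hτ : 0 < τ)
    (hτle : τ ≤ arctanTime (S.a1 k1 k2 k5 k8 δ) (S.a2 k1 k2 k8 δ + S.a3 p k1 k2 k5 δ)
      (S.a4 p k1 k2 δ) σ) (y₀ : Vec k) (z₀ : Vec q)
    (h0 : lyap P y₀ (S.wOf h y₀ z₀) < level P δ) :
    ∃ y z t, S.IsExecution h σ p ⊤ y z t ∧ y 0 = y₀ ∧ z 0 = z₀ := by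
  classical
  choose! X θ hX0 hXc hθ hno htr hder hlev using H.exists_step hdisc hτle
  -- `x i` and `t i` are the state and the time at the `i`-th event; after the last event `t` is `⊤`
  -- and `x` is constant, as `toReal ⊤ = 0`
  let x : ℕ → Vec k × Vec q := fun i => Nat.rec (y₀, z₀) (fun _ x => X x (θ x).toReal) i
  let t : ℕ → EReal := fun i => Nat.rec 0 (fun i s => s + θ (x i)) i
  have hx0 : x 0 = (y₀, z₀) := rfl
  have hxs : ∀ i, x (i + 1) = X (x i) (θ (x i)).toReal := fun _ => rfl
  have ht0 : t 0 = 0 := rfl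
  have hts : ∀ i, t (i + 1) = t i + θ (x i) := fun _ => rfl
  clear_value x t
  have hθcases : ∀ x : Vec k × Vec q, lyap P x.1 (S.wOf h x.1 x.2) < level P δ →
      θ x = ⊤ ∨ ∃ c : ℝ, θ x = c ∧ τ ≤ c := by
    intro x hx
    have h1 := hθ x hx
    induction hc : θ x with
    | bot => rw [hc] at h1; exact absurd h1 (by simp)
    | top => exact Or.inl rfl
    | coe c => rw [hc] at h1; exact Or.inr ⟨c, rfl, by exact_mod_cast h1⟩
  have hxlev : ∀ i, lyap P (x i).1 (S.wOf h (x i).1 (x i).2) < level P δ := by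
    intro i
    induction i with
    | zero => rw [hx0]; exact h0
    | succ i ih =>
      rw [hxs]
      rcases hθcases _ ih with h1 | ⟨c, hc, hτc⟩
      · rw [h1, EReal.toReal_top, hX0 _ ih]; exact ih
      · rw [hc, EReal.toReal_coe]; exact hlev _ ih c (hτ.le.trans hτc) hc.ge
  have htcases : ∀ i, t i = ⊤ ∨ ∃ a : ℝ, t i = a ∧ i * τ ≤ a := by
    intro i
    induction i with
    | zero => exact Or.inr ⟨0, ht0, by simp⟩
    | succ i ih =>
      rw [hts]
      rcases hθcases _ (hxlev i) with h1 | ⟨c, hc, hτc⟩ <;> rcases ih with h2 | ⟨a, ha, hia⟩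
      · left; rw [h1, h2]; rfl
      · left; rw [h1, ha]; rfl
      · left; rw [hc, h2]; rfl
      · right
        refine ⟨a + c, by rw [ha, hc, EReal.coe_add], ?_⟩
        push_cast
        linarith
  have htnext : ∀ i (a : ℝ), t i = a → (θ (x i) = ⊤ ∧ t (i + 1) = ⊤) ∨
      ∃ c : ℝ, θ (x i) = c ∧ 0 < c ∧ t (i + 1) = ((a + c : ℝ) : EReal) := by
    intro i a ha
    rcases hθcases _ (hxlev i) with h1 | ⟨c, hc, hτc⟩
    · left; exact ⟨h1, by rw [hts, h1, ha]; rfl⟩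
    · right; exact ⟨c, hc, hτ.trans_le hτc, by rw [hts, hc, ha, EReal.coe_add]⟩
  have hmono : Monotone t := by
    refine monotone_nat_of_le_succ fun i => ?_
    rcases htcases i with h1 | ⟨a, ha, -⟩
    · rw [hts, h1]
      rcases hθcases _ (hxlev i) with h2 | ⟨c, hc, -⟩
      · rw [h2]; exact le_rfl
      · rw [hc]; exact le_rfl
    · rcases htnext i a ha with ⟨-, h2⟩ | ⟨c, -, hc, h2⟩
      · rw [h2]; exact le_top
      · rw [h2, ha, EReal.coe_le_coe_iff]; linarith
  have hunb : ∀ s : ℝ, ∃ i, (s : EReal) < t (i + 1) := by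
    intro s
    obtain ⟨n, hn⟩ := exists_nat_gt (s / τ)
    rw [div_lt_iff₀ hτ] at hn
    refine ⟨n, ?_⟩
    rcases htcases (n + 1) with h1 | ⟨a, ha, hia⟩
    · rw [h1]; exact EReal.coe_lt_top s
    · rw [ha, EReal.coe_lt_coe_iff]
      push_cast at hia
      linarith
  let Z : ℝ → Vec k × Vec q := fun s =>
    X (x (Nat.find (hunb s))) (s - (t (Nat.find (hunb s))).toReal)
  have hZlt : ∀ i (a s : ℝ), t i = a → a ≤ s → (s : EReal) < t (i + 1) →
      Z s = X (x i) (s - a) := by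
    intro i a s ha has hs
    have hfind : Nat.find (hunb s) = i := by
      rw [Nat.find_eq_iff]
      refine ⟨hs, fun j hj => ?_⟩
      rw [not_lt]
      exact (hmono (Nat.succ_le_of_lt hj)).trans (ha ▸ EReal.coe_le_coe_iff.2 has)
    simp only [Z, hfind, ha, EReal.toReal_coe]
  have hZle : ∀ i (a s : ℝ), t i = a → a ≤ s → (s : EReal) ≤ t (i + 1) →
      Z s = X (x i) (s - a) := by
    intro i a s ha has hs
    rcases hs.lt_or_eq with h1 | h1
    · exact hZlt i a s ha has h1
    · rcases htnext i a ha with ⟨-, h2⟩ | ⟨c, hc, hcpos, h2⟩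
      · rw [h2] at h1; exact absurd h1 (EReal.coe_ne_top s)
      · have hsc : s = a + c := by
          rw [h2, EReal.coe_eq_coe_iff] at h1; exact h1
        have hlt : (s : EReal) < t (i + 1 + 1) := by
          rcases htnext (i + 1) s h1.symm with ⟨-, h3⟩ | ⟨c', -, hc', h3⟩
          · rw [h3]; exact EReal.coe_lt_top s
          · rw [h3, EReal.coe_lt_coe_iff]; linarith
        rw [hZlt (i + 1) s s h1.symm le_rfl hlt, sub_self, hX0 _ (hxlev _), hxs, hc,
          EReal.toReal_coe, hsc, add_sub_cancel_left]
  have hZevent : ∀ i (a : ℝ), t i = a → Z a = x i := by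
    intro i a ha
    rw [hZle i a a ha le_rfl (ha ▸ hmono (Nat.le_succ i)), sub_self, hX0 _ (hxlev i)]
  have hcover : ∀ s : ℝ, 0 ≤ s → ∃ i, t i ≤ (s : EReal) ∧ (s : EReal) < t (i + 1) := by
    intro s hs
    refine ⟨Nat.find (hunb s), ?_, Nat.find_spec (hunb s)⟩
    rcases hn : Nat.find (hunb s) with _ | n
    · rw [ht0]; exact_mod_cast hs
    · exact not_lt.1 (Nat.find_min (hunb s) (hn ▸ Nat.lt_succ_self n))
  have htrig : ∀ i (a s : ℝ), t i = a → a ≤ s → (s : EReal) ≤ t (i + 1) →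
      (S.Trigger h σ p (fun r => (Z r).1) (fun r => (Z r).2) a s ↔
        S.Trigger h σ p (fun r => (X (x i) r).1) (fun r => (X (x i) r).2) 0 (s - a)) := by
    intro i a s ha has hs
    simp only [Trigger, hZle i a s ha has hs, hZevent i a ha, hX0 _ (hxlev i)]
  have hZcont : ∀ i, ContinuousOn Z {s : ℝ | 0 ≤ s ∧ (s : EReal) ≤ t i} := by
    intro i
    induction i with
    | zero =>
      refine Set.Subsingleton.continuousOn (fun r hr s hs => ?_) _
      have e1 : r ≤ 0 := by have := hr.2; rw [ht0] at this; exact_mod_cast this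
      have e2 : s ≤ 0 := by have := hs.2; rw [ht0] at this; exact_mod_cast this
      rw [le_antisymm e1 hr.1, le_antisymm e2 hs.1]
    | succ i ih =>
      rcases htcases i with h1 | ⟨a, ha, -⟩
      · refine ih.mono fun s hs => ⟨hs.1, h1 ▸ le_top⟩
      · have hnew : ContinuousOn Z {s : ℝ | a ≤ s ∧ (s : EReal) ≤ t (i + 1)} :=
          ((hXc _ (hxlev i)).comp (continuous_id.sub continuous_const)).continuousOn.congr
            fun s hs => hZle i a s ha hs.1 hs.2
        have hcl : ∀ (b : ℝ) (c : EReal), IsClosed {s : ℝ | b ≤ s ∧ (s : EReal) ≤ c} :=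
          fun b c => (isClosed_le continuous_const continuous_id).inter
            (isClosed_le continuous_coe_real_ereal continuous_const)
        refine (ih.union_of_isClosed hnew (hcl 0 _) (hcl a _)).mono fun s hs => ?_
        rcases le_total s a with h2 | h2
        · exact Or.inl ⟨hs.1, ha ▸ EReal.coe_le_coe_iff.2 h2⟩
        · exact Or.inr ⟨h2, hs.2⟩
  have hZc : ContinuousOn Z {s : ℝ | 0 ≤ s ∧ (s : EReal) < ⊤} := by
    intro s hs
    obtain ⟨i, -, hi⟩ := hcover s hs.1
    refine (hZcont (i + 1) s ⟨hs.1, hi.le⟩).mono_of_mem_nhdsWithin ?_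
    have hnhds : {r : ℝ | (r : EReal) < t (i + 1)} ∈ 𝓝 s :=
      (isOpen_lt continuous_coe_real_ereal continuous_const).mem_nhds hi
    filter_upwards [self_mem_nhdsWithin, mem_nhdsWithin_of_mem_nhds hnhds] with r hr1 hr2
    exact ⟨hr1.1, le_of_lt hr2⟩
  refine ⟨fun s => (Z s).1, fun s => (Z s).2, t, ⟨ht0, fun i => ?_, fun s hs _ => hcover s hs,
    hZc.fst, hZc.snd, fun i s hs1 hs2 _ => ?_⟩, ?_, ?_⟩
  · rcases htcases i with h1 | ⟨a, ha, -⟩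
    · have h2 : t (i + 1) = ⊤ := top_le_iff.1 (h1 ▸ hmono (Nat.le_succ i))
      rw [h2, h1]
      refine (sInf_eq_top.2 ?_).symm
      rintro _ ⟨s, hs, rfl⟩
      exact absurd hs.1 not_top_lt
    · rw [ha, EReal.toReal_coe]
      rcases htnext i a ha with ⟨h1, h2⟩ | ⟨c, hc, hcpos, h2⟩
      · rw [h2]
        refine (sInf_eq_top.2 ?_).symm
        rintro _ ⟨s, ⟨hs1, -, hs3⟩, rfl⟩
        rw [EReal.coe_lt_coe_iff] at hs1
        rw [htrig i a s ha hs1.le (h2 ▸ le_top)] at hs3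
        exact absurd hs3 (hno _ (hxlev i) _ (sub_pos.2 hs1) (h1 ▸ EReal.coe_lt_top _))
      · rw [h2]
        refine le_antisymm (le_sInf ?_) (sInf_le ⟨a + c, ⟨?_, EReal.coe_lt_top _, ?_⟩, rfl⟩)
        · rintro _ ⟨s, ⟨hs1, -, hs3⟩, rfl⟩
          rw [EReal.coe_le_coe_iff]
          by_contra! hlt
          rw [EReal.coe_lt_coe_iff] at hs1
          rw [htrig i a s ha hs1.le (by rw [h2, EReal.coe_le_coe_iff]; exact hlt.le)] at hs3
          refine absurd hs3 (hno _ (hxlev i) _ (sub_pos.2 hs1) ?_)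
          rw [hc, EReal.coe_lt_coe_iff]; linarith
        · rw [EReal.coe_lt_coe_iff]; linarith
        · rw [htrig i a (a + c) ha (by linarith) h2.ge, add_sub_cancel_left]
          exact htr _ (hxlev i) c hc
  · rcases htcases i with h1 | ⟨a, ha, -⟩
    · rw [h1] at hs1; exact absurd hs1 (not_le.2 (EReal.coe_lt_top s))
    · rw [ha, EReal.coe_le_coe_iff] at hs1
      have hsθ : ((s - a : ℝ) : EReal) < θ (x i) := by
        rcases htnext i a ha with ⟨h1, -⟩ | ⟨c, hc, hcpos, h2⟩
        · rw [h1]; exact EReal.coe_lt_top _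
        · rw [h2, EReal.coe_lt_coe_iff] at hs2
          rw [hc, EReal.coe_lt_coe_iff]; linarith
      have hd := (hder _ (hxlev i) (s - a) (sub_nonneg.2 hs1) hsθ).comp_sub_const s a
      have hZd : HasDerivWithinAt Z
          (S.heldField (S.K (x i).1 (x i).2) (X (x i) (s - a))) (Ici s) s := by
        refine hd.hasDerivWithinAt.congr_of_eventuallyEq ?_ (hZlt i a s ha hs1 hs2)
        have hnhds : {r : ℝ | (r : EReal) < t (i + 1)} ∈ 𝓝 s :=
          (isOpen_lt continuous_coe_real_ereal continuous_const).mem_nhds hs2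
        filter_upwards [self_mem_nhdsWithin, mem_nhdsWithin_of_mem_nhds hnhds] with r hr1 hr2
        exact hZlt i a r ha (hs1.trans hr1) hr2
      have hd₁ : HasDerivWithinAt (fun r => (Z r).1) _ (Ici s) s := hZd.fst
      have hd₂ : HasDerivWithinAt (fun r => (Z r).2) _ (Ici s) s := hZd.snd
      rw [ha, EReal.toReal_coe]
      beta_reduce
      rw [hZevent i a ha, hZlt i a s ha hs1 hs2]
      exact ⟨hd₁, hd₂⟩
  · simp only [hZevent 0 0 ht0, hx0]
  · simp only [hZevent 0 0 ht0, hx0]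

end Sys

/-! ### Stability and inter-event times -/

namespace Sys
variable {k q m : ℕ} {S : Sys k q m} {h : Vec k → Vec q} {δh : ℝ}
  {P Q : Matrix (Fin q) (Fin q) ℝ} {p k5 k6 sf σ δ k1 k2 k8 sy : ℝ}

/-- A sublevel set of the Lyapunov function contains a `pairNorm`-ball. -/
theorem Setup.exists_forall_lyap_lt (H : S.Setup δh h P Q p k5 k6 sf σ δ k1 k2 k8 sy) {ε : ℝ}
    (hε : 0 < ε) : ∃ r > (0 : ℝ), ∀ (y : Vec k) (w : Vec q), pairNorm y w < r →
      lyap P y w < ε := by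
  have hs : 0 < 1 + Real.sqrt (lamMax P) := by positivity
  refine ⟨ε / (1 + Real.sqrt (lamMax P)), by positivity, fun y w hyw => ?_⟩
  rw [lt_div_iff₀' hs] at hyw
  exact (H.lyap_le_pairNorm y w).trans_lt hyw

theorem Setup.level_pos (H : S.Setup δh h P Q p k5 k6 sf σ δ k1 k2 k8 sy) : 0 < level P δ :=
  mul_pos H.min_pos H.const.pos_delta

theorem Setup.arctanTime_pos (H : S.Setup δh h P Q p k5 k6 sf σ δ k1 k2 k8 sy)
    (hdisc : (S.a2 k1 k2 k8 δ + S.a3 p k1 k2 k5 δ) ^ 2 <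
      4 * S.a1 k1 k2 k5 k8 δ * S.a4 p k1 k2 δ) :
    0 < arctanTime (S.a1 k1 k2 k5 k8 δ) (S.a2 k1 k2 k8 δ + S.a3 p k1 k2 k5 δ)
      (S.a4 p k1 k2 δ) σ :=
  CenterETC.arctanTime_pos hdisc H.a4_pos H.pos_sigma

theorem Setup.originLAS (H : S.Setup δh h P Q p k5 k6 sf σ δ k1 k2 k8 sy)
    (hdisc : (S.a2 k1 k2 k8 δ + S.a3 p k1 k2 k5 δ) ^ 2 <
      4 * S.a1 k1 k2 k5 k8 δ * S.a4 p k1 k2 δ)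
    (hgap : 0 < gap P Q sf σ k1 k2) : S.OriginLAS h σ p := by
  constructor
  · intro ε hε
    have hc := H.min_pos
    obtain ⟨r, hr, hball⟩ := H.exists_forall_lyap_lt (lt_min H.level_pos (mul_pos hc hε))
    refine ⟨r, hr, fun T y z t hx h0 s hs hsT => ?_⟩
    obtain ⟨h1, h2⟩ := lt_min_iff.1 (hball _ _ h0)
    exact lt_of_mul_lt_mul_left ((H.min_mul_pairNorm_le_lyap _ _).trans_lt
      ((hx.lyap_le_zero H h1 hs hsT).trans_lt h2)) hc.le
  · obtain ⟨r, hr, hball⟩ := H.exists_forall_lyap_lt H.level_pos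
    exact ⟨r, hr, fun y₀ z₀ h0 => H.exists_isExecution hdisc (H.arctanTime_pos hdisc) le_rfl
      y₀ z₀ (hball _ _ h0), fun y z t hx h0 => hx.tendsto_pairNorm H hgap (hball _ _ h0)⟩

end Sys

end CenterETC

end

theorem proposition3 {k q m : ℕ} (hq : 0 < q) (S : CenterETC.Sys k q m)
    (hreg : S.Regular) (hAK : CenterETC.Hurwitz S.AK)
    (hE : S.AK * S.E - S.E * S.A1 + S.B2 * S.K12 = 0)
    (hA1 : S.A1 = 0) (hKn : S.Kn = 0) (hK1 : S.K12 + S.K11 * S.E = 0)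
    (δh : ℝ) (h : CenterETC.Vec k → CenterETC.Vec q) (hcm : S.IsCenterManifold δh h)
    (p k5 k6 : ℝ) (hp : 1 < p) (hk5 : 0 < k5) (hk6 : 0 < k6)
    (hgrowth : ∀ᶠ y in 𝓝 (0 : CenterETC.Vec k), ‖S.g1Red h y‖ ≤ k5 * ‖y‖ ^ p)
    (hdecay : ∀ᶠ y in 𝓝 (0 : CenterETC.Vec k),
      inner ℝ y (S.g1Red h y) ≤ -k6 * ‖y‖ ^ (p + 1))
    (P Q : Matrix (Fin q) (Fin q) ℝ) (hP : P.PosDef) (hQ : Q.PosDef)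
    (hPQ : S.AK.transpose * P + P * S.AK = -Q)
    (sf σ : ℝ) (hsf0 : 0 < sf) (hsf1 : sf < 1) (hσ : 0 < σ)
    (hσle : σ * (2 * CenterETC.opNorm (P * S.B2 * S.K1) * Real.sqrt (CenterETC.lamMax P)) ≤
      (1 - sf) * CenterETC.lamMin Q * Real.sqrt (CenterETC.lamMin P)) :
    -- local asymptotic stability of the origin
    S.OriginLAS h σ p ∧
    -- uniform positive lower bound on the inter-event times
    (∃ τ > (0 : ℝ), ∃ r > (0 : ℝ), ∀ T y z t, S.IsExecution h σ p T y z t →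
      CenterETC.pairNorm (y 0) (S.wOf h (y 0) (z 0)) < r →
      ∀ i : ℕ, t i + (τ : EReal) ≤ t (i + 1)) ∧
    -- the explicit bound, and the existence of constants to which it applies
    (∃ δ k1 k2 k8 sy : ℝ, S.LocalConstants δh h P Q p k5 k6 sf σ δ k1 k2 k8 sy ∧
      (S.a2 k1 k2 k8 δ + S.a3 p k1 k2 k5 δ) ^ 2 <
        4 * S.a1 k1 k2 k5 k8 δ * S.a4 p k1 k2 δ) ∧
    (∀ δ k1 k2 k8 sy : ℝ, S.LocalConstants δh h P Q p k5 k6 sf σ δ k1 k2 k8 sy →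
      (S.a2 k1 k2 k8 δ + S.a3 p k1 k2 k5 δ) ^ 2 <
        4 * S.a1 k1 k2 k5 k8 δ * S.a4 p k1 k2 δ →
      0 < CenterETC.arctanTime (S.a1 k1 k2 k5 k8 δ) (S.a2 k1 k2 k8 δ + S.a3 p k1 k2 k5 δ)
        (S.a4 p k1 k2 δ) σ ∧
      ∀ T y z t, S.IsExecution h σ p T y z t →
        CenterETC.lyap P (y 0) (S.wOf h (y 0) (z 0)) <
          min 1 (Real.sqrt (CenterETC.lamMin P)) * δ →
        ∀ i : ℕ, t i + ((CenterETC.arctanTime (S.a1 k1 k2 k5 k8 δ)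
          (S.a2 k1 k2 k8 δ + S.a3 p k1 k2 k5 δ) (S.a4 p k1 k2 δ) σ : ℝ) : EReal) ≤
            t (i + 1)) := by
  have hS : S.Standing := ⟨hreg, hA1, hKn, hK1, hE⟩
  have hSetup : ∀ δ k1 k2 k8 sy : ℝ, S.LocalConstants δh h P Q p k5 k6 sf σ δ k1 k2 k8 sy →
      S.Setup δh h P Q p k5 k6 sf σ δ k1 k2 k8 sy := fun _ _ _ _ _ C =>
    ⟨hS, hcm, hq, hP, hQ, hPQ, hp, hk5, hk6, hσ, hσle, C⟩
  obtain ⟨δ, k1, k2, k8, sy, C, hdisc, hstrict⟩ :=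
    hcm.exists_localConstants hS hq hP hQ hPQ hp hk5 hk6 hgrowth hdecay hsf0 hσ
  have H := hSetup δ k1 k2 k8 sy C
  refine ⟨H.originLAS hdisc (sub_pos.2 hstrict), ?_, ⟨δ, k1, k2, k8, sy, C, hdisc⟩,
    fun δ k1 k2 k8 sy C hdisc => ?_⟩
  · obtain ⟨r, hr, hball⟩ := H.exists_forall_lyap_lt H.level_pos
    exact ⟨_, H.arctanTime_pos hdisc, r, hr, fun T y z t hx h0 i =>
      hx.add_arctanTime_le H hdisc (hball _ _ h0) i⟩
  · have H := hSetup δ k1 k2 k8 sy C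
    exact ⟨H.arctanTime_pos hdisc, fun T y z t hx h0 i => hx.add_arctanTime_le H hdisc h0 i⟩
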